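/- **Setting.** For $\psi:\mathbb R^p\to\mathbb R$ let $\partial\psi(x)=\{v:\psi(y)\ge\psi(x)+\langle v,y-x\rangle+o(\|y-x\|),\ y\to x\}$; $\psi$ is $\rho$-weakly convex ($\rho>0$) if $\psi(x)\ge\psi(x')+\langle v,x-x'\rangle-\frac\rho2\|x-x'\|^2$ for all $x,x'$ and all $v\in\partial\psi(x')$. Consider, for $x\in\mathbb R^d$, $$\Phi(x)=F(x)+\frac{\beta}{m}\sum_{k=1}^m[h_k(x)]_+,\qquad F(x)=\frac1n\sum_{i=1}^n f_i(g_i(x)),\quad g_i(x)=\mathbb E_\zeta[g_i(x,\zeta)],\quad h_k(x)=\mathbb E_\xi[h_k(x,\xi)],$$ where $[z]_+=\max\{0,z\}$, $\beta>0$, $f_i:\mathbb R\to\mathbb R$, and $g_i,h_k$ are real-valued. Let $\phi_\theta(x)=\min_y\{\phi(y)+\frac1{2\theta}\|y-x\|^2\}$ denote the Moreau envelope. **Assumptions.** $F$ is $\rho_0$-weakly convex and $L_F$-Lipschitz; each $h_k$ is $\rho_1$-weakly convex and $L_h$-Lipschitz; each $f_i$ is non-decreasing, $\rho_f$-weakly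 convex and $L_f$-Lipschitz; each $g_i$ is $\rho_g$-weakly convex. For all $x,y$: $\mathbb E|g_i(x,\zeta)-g_i(y,\zeta)|^2\le L_g^2\|x-y\|^2$, $\mathbb E|g_i(x,\zeta)-g_i(x)|^2\le\sigma_g^2$, $\mathbb E|h_k(x,\xi)-h_k(y,\xi)|^2\le L_h^2\|x-y\|^2$, $\mathbb E|h_k(x,\xi)-h_k(x)|^2\le\sigma_h^2$. There are (measurable, integrable) stochastic subgradients $\partial g_i(x,\zeta)$, $\partial h_k(x,\xi)$ with $\mathbb E[\partial g_i(x,\zeta)]\in\partial g_i(x)$ and $\mathbb E[\partial h_k(x,\xi)]\in\partial h_k(x)$. Moreover, either (A) $\partial g_i(x,\zeta)$ and $\partial h_k(x,\xi)$ are almost surely subgradients at $x$ of $g_i(\cdot,\zeta)$ and $h_k(\cdot,\xi)$, and $d\le D$; or (B) $\mathbb E\|\partial g_i(x,\zeta)\|^2\le L_g^2$ and $\mathbb E\|\partial h_k(x,\xi)\|^2\le L_h^2$ for all $x$. **Algorithm.** Start from $x_{-1}=x_0$ and reals $u_{1,i}^0,u_{2,k}^0$. At iteration $t=0,1,\dots$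 draw, independently of the past and of each other, a uniformly random $\mathcal B^t\subset\{1,\dots,n\}$ of size $|\mathcal B|$ and $\mathcal B_c^t\subset\{1,\dots,m\}$ of size $|\mathcal B_c|$, and i.i.d. mini-batches $\mathcal B_{1,i}^t$ ($b_1$ samples of $\zeta$, $i\in\mathcal B^t$) and $\mathcal B_{2,k}^t$ ($b_2$ samples of $\xi$, $k\in\mathcal B_c^t$); $g(x;\mathcal B)$ denotes the mini-batch average. Put $$u_{1,i}^{t+1}=(1-\gamma_1)u_{1,i}^t+\gamma_1g_i(x_t;\mathcal B_{1,i}^t)+\gamma_1'\big(g_i(x_t;\mathcal B_{1,i}^t)-g_i(x_{t-1};\mathcal B_{1,i}^t)\big),\quad \gamma_1'=\tfrac{n-|\mathcal B|}{|\mathcal B|(1-\gamma_1)}+1-\gamma_1,$$ for $i\in\mathcal B^t$ and $u_{1,i}^{t+1}=u_{1,i}^t$ otherwise; in the same way $u_{2,k}^{t+1}$ from $h_k$, $\mathcal B_{2,k}^t$, $\mathcal B^t_c$, $\gamma_2$ and $\gamma_2'=\frac{m-|\mathcal B_c|}{|\mathcal B_c|(1-\gamma_2)}+1-\gamma_2$.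 Finally $$x_{t+1}=x_t-\eta\Big(\frac1{|\mathcal B|}\sum_{i\in\mathcal B^t}\partial f_i(u_{1,i}^t)\,\partial g_i(x_t;\mathcal B_{1,i}^t)+\frac{\beta}{|\mathcal B_c|}\sum_{k\in\mathcal B_c^t}[u_{2,k}^t]_+'\,\partial h_k(x_t;\mathcal B_{2,k}^t)\Big),$$ where $\partial f_i(u)$ and $[u]_+'$ are fixed choices of subgradients of $f_i$ and of $[\cdot]_+$ at $u$. **Theorem.** There is $a\in(0,1)$, depending only on the constants $L_f,L_g,L_F,L_h,\sigma_g,\sigma_h,\rho_f,\rho_g,\rho_0,\rho_1$, and for all $D,\beta_0>0,\epsilon_0,\kappa,\Delta,\delta_1,\delta_2$ there are $c_\gamma,c_\eta,c_T>0$, depending only on these and on the previous constants, such that the following holds for every problem as above, all $\beta\ge\beta_0$, $0<\epsilon\le\epsilon_0$, $1\le|\mathcal B|\le n$, $1\le|\mathcal B_c|\le m$, $b_1,b_2\ge1$ with $\min\{b_1,\frac{b_2}{\beta^2}\}\frac{\epsilon^4}{\beta^2}\le\kappa$, and all initial values with $\Phi(x_0)-\inf\Phi\le\Delta\beta$, $\frac1n\sum_i|u_{1,i}^0-g_i(x_0)|^2\le\delta_1$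 and $\frac1m\sum_k|u_{2,k}^0-h_k(x_0)|\le\delta_2$. Let $\theta=\frac{a}{\rho_0+\rho_1\beta}$ and $$\gamma_1=\gamma_2=c_\gamma\min\Big\{b_1,\frac{b_2}{\beta^2}\Big\}\frac{\epsilon^4}{\beta^2},\qquad \eta=c_\eta\min\Big\{\frac{|\mathcal B|}n,\frac{|\mathcal B_c|}{\beta m}\Big\}\min\Big\{b_1^{1/2},\frac{b_2^{1/2}}{\beta}\Big\}\frac{\epsilon^4}{\beta^3}.$$ Then $\gamma_1=\gamma_2\in(0,1)$, $\Phi_\theta$ is differentiable, and for every integer $$T\ \ge\ c_T\max\Big\{\frac{\beta}{b_1^{1/2}},\frac{\beta^2}{b_2^{1/2}},\frac1{b_1}\Big\}\max\Big\{\frac n{|\mathcal B|},\frac{\beta m}{|\mathcal B_c|}\Big\}\frac{\beta^3}{\epsilon^6}$$ the iterates satisfy $\mathbb E\|\nabla\Phi_\theta(x_{\hat t})\|\le\epsilon$, where $\hat t$ is uniform on $\{1,\dots,T\}$ and independent of the run. -/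

import Mathlib

open MeasureTheory ProbabilityTheory Topology
open scoped NNReal ENNReal Gradient

noncomputable section

/-- The Euclidean space `ℝ^d`. -/
abbrev Vec (d : ℕ) : Type := EuclideanSpace ℝ (Fin d)

/-! ### Nonsmooth analysis -/

section Nonsmooth

variable {V : Type*} [NormedAddCommGroup V] [InnerProductSpace ℝ V]

/-- The (Fréchet) subdifferential: all `v` with
`ψ y ≥ ψ x + ⟪v, y - x⟫ + o(‖y - x‖)` as `y → x`. -/
def subdiff (ψ : V → ℝ) (x : V) : Set V :=
  {v | ∀ r : ℝ, 0 < r → ∀ᶠ y in 𝓝 x, ψ x + inner ℝ v (y - x) - r * ‖y - x‖ ≤ ψ y}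

/-- `ψ` is `ρ`-weakly convex: the subgradient inequality holds up to `ρ/2 ‖x - x'‖²`. -/
def WeaklyConvex (ρ : ℝ) (ψ : V → ℝ) : Prop :=
  ∀ x x' : V, ∀ v ∈ subdiff ψ x', ψ x' + inner ℝ v (x - x') - ρ / 2 * ‖x - x'‖ ^ 2 ≤ ψ x

/-- The Moreau envelope `φ_θ(x) = min_y { φ(y) + ‖y - x‖² / (2θ) }`. -/
def moreauEnvelope (θ : ℝ) (φ : V → ℝ) (x : V) : ℝ :=
  ⨅ y : V, (φ y + 1 / (2 * θ) * ‖y - x‖ ^ 2)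

end Nonsmooth

/-- The hinge function `[z]_+ = max {0, z}`. -/
def hinge (z : ℝ) : ℝ := max 0 z

/-! ### The problem -/

/-- The constants of the assumptions: Lipschitz constants, standard deviations and
weak convexity moduli (`ρ0` for `F`, `ρ1` for the `h_k`). -/
structure Moduli where
  Lf : ℝ≥0
  Lg : ℝ≥0
  LF : ℝ≥0
  Lh : ℝ≥0
  σg : ℝ≥0
  σh : ℝ≥0
  ρf : ℝ
  ρg : ℝ
  ρ0 : ℝ
  ρ1 : ℝ
  ρf_pos : 0 < ρf
  ρg_pos : 0 < ρg
  ρ0_pos : 0 < ρ0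
  ρ1_pos : 0 < ρ1

/-- The data of the penalized problem and of its stochastic first-order oracle: the outer
functions `f i`, the sampled inner functions `g i x ζ`, the sampled constraint functions
`h k x ξ`, the laws `ν` of `ζ` and `τ` of `ξ`, and the chosen subgradients
`df i u` of `f i` at `u`, `dg i x ζ`, `dh k x ξ` (stochastic subgradients), and
`dhinge z` of the hinge function at `z`. -/
structure Problem (d n m : ℕ) (Z W : Type*) [MeasurableSpace Z] [MeasurableSpace W] where
  f : Fin n → ℝ → ℝ
  df : Fin n → ℝ → ℝ
  g : Fin n → Vec d → Z → ℝ
  dg : Fin n → Vec d → Z → Vec d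
  h : Fin m → Vec d → W → ℝ
  dh : Fin m → Vec d → W → Vec d
  dhinge : ℝ → ℝ
  ν : Measure Z
  τ : Measure W

namespace Problem

variable {d n m : ℕ} {Z W : Type*} [MeasurableSpace Z] [MeasurableSpace W]

/-- `g_i(x) = E_ζ[g_i(x, ζ)]`. -/
def gMean (P : Problem d n m Z W) (i : Fin n) (x : Vec d) : ℝ := ∫ ζ, P.g i x ζ ∂P.ν

/-- `h_k(x) = E_ξ[h_k(x, ξ)]`. -/
def hMean (P : Problem d n m Z W) (k : Fin m) (x : Vec d) : ℝ := ∫ ξ, P.h k x ξ ∂P.τ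

/-- The objective `F(x) = (1/n) ∑ f_i(E[g_i(x, ζ)])`. -/
def F (P : Problem d n m Z W) (x : Vec d) : ℝ :=
  (n : ℝ)⁻¹ * ∑ i, P.f i (P.gMean i x)

/-- The hinge-penalized objective `Φ(x) = F(x) + (β/m) ∑ [h_k(x)]_+`. -/
def Φ (P : Problem d n m Z W) (β : ℝ) (x : Vec d) : ℝ :=
  P.F x + β / (m : ℝ) * ∑ k, hinge (P.hMean k x)

/-- The standing assumptions. The mean-square bounds are stated with the Lebesgue integral of
nonnegative functions, so that they include the finiteness of the moments. -/
structure Assumptions (P : Problem d n m Z W) (c : Moduli) : Prop where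
  ν_prob : IsProbabilityMeasure P.ν
  τ_prob : IsProbabilityMeasure P.τ
  g_meas : ∀ i, Measurable (Function.uncurry (P.g i))
  dg_meas : ∀ i, Measurable (Function.uncurry (P.dg i))
  h_meas : ∀ k, Measurable (Function.uncurry (P.h k))
  dh_meas : ∀ k, Measurable (Function.uncurry (P.dh k))
  -- the objective
  F_weaklyConvex : WeaklyConvex c.ρ0 P.F
  F_lipschitz : LipschitzWith c.LF P.F
  -- the outer functions and the hinge function
  f_lipschitz : ∀ i, LipschitzWith c.Lf (P.f i)
  f_mono : ∀ i, Monotone (P.f i)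
  f_weaklyConvex : ∀ i, WeaklyConvex c.ρf (P.f i)
  df_mem : ∀ i u, P.df i u ∈ subdiff (P.f i) u
  dhinge_mem : ∀ z, P.dhinge z ∈ subdiff hinge z
  -- the inner functions
  g_integrable : ∀ i x, Integrable (P.g i x) P.ν
  g_weaklyConvex : ∀ i, WeaklyConvex c.ρg (P.gMean i)
  g_meanSquareLipschitz : ∀ i x y,
    ∫⁻ ζ, ENNReal.ofReal ((P.g i x ζ - P.g i y ζ) ^ 2) ∂P.ν
      ≤ ENNReal.ofReal ((c.Lg : ℝ) ^ 2 * ‖x - y‖ ^ 2)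
  g_variance : ∀ i x,
    ∫⁻ ζ, ENNReal.ofReal ((P.g i x ζ - P.gMean i x) ^ 2) ∂P.ν
      ≤ ENNReal.ofReal ((c.σg : ℝ) ^ 2)
  dg_integrable : ∀ i x, Integrable (P.dg i x) P.ν
  dg_mean_mem : ∀ i x, ∫ ζ, P.dg i x ζ ∂P.ν ∈ subdiff (P.gMean i) x
  -- the constraint functions
  h_integrable : ∀ k x, Integrable (P.h k x) P.τ
  h_weaklyConvex : ∀ k, WeaklyConvex c.ρ1 (P.hMean k)
  h_lipschitz : ∀ k, LipschitzWith c.Lh (P.hMean k)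
  h_meanSquareLipschitz : ∀ k x y,
    ∫⁻ ξ, ENNReal.ofReal ((P.h k x ξ - P.h k y ξ) ^ 2) ∂P.τ
      ≤ ENNReal.ofReal ((c.Lh : ℝ) ^ 2 * ‖x - y‖ ^ 2)
  h_variance : ∀ k x,
    ∫⁻ ξ, ENNReal.ofReal ((P.h k x ξ - P.hMean k x) ^ 2) ∂P.τ
      ≤ ENNReal.ofReal ((c.σh : ℝ) ^ 2)
  dh_integrable : ∀ k x, Integrable (P.dh k x) P.τ
  dh_mean_mem : ∀ k x, ∫ ξ, P.dh k x ξ ∂P.τ ∈ subdiff (P.hMean k) x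

/-- `∂g_i(x, ζ)` and `∂h_k(x, ξ)` are almost surely subgradients at `x` of the sampled
functions `g_i(·, ζ)` and `h_k(·, ξ)`. -/
def SampleSubgradients (P : Problem d n m Z W) : Prop :=
  (∀ i x, ∀ᵐ ζ ∂P.ν, P.dg i x ζ ∈ subdiff (fun y => P.g i y ζ) x) ∧
  (∀ k x, ∀ᵐ ξ ∂P.τ, P.dh k x ξ ∈ subdiff (fun y => P.h k y ξ) x)

/-- The stochastic subgradients have second moments at most `L_g²` and `L_h²`. -/
def MomentBounds (P : Problem d n m Z W) (c : Moduli) : Prop :=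
  (∀ i x, ∫⁻ ζ, ENNReal.ofReal (‖P.dg i x ζ‖ ^ 2) ∂P.ν ≤ ENNReal.ofReal ((c.Lg : ℝ) ^ 2)) ∧
  (∀ k x, ∫⁻ ξ, ENNReal.ofReal (‖P.dh k x ξ‖ ^ 2) ∂P.τ ≤ ENNReal.ofReal ((c.Lh : ℝ) ^ 2))

end Problem

/-! ### The algorithm -/

/-- The mini-batch average `φ(𝓑) = (1/|𝓑|) ∑_{ζ ∈ 𝓑} φ(ζ)` over `b` samples. -/
def batchMean {b : ℕ} {S V : Type*} [AddCommGroup V] [Module ℝ V] (φ : S → V)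
    (ζ : Fin b → S) : V :=
  (b : ℝ)⁻¹ • ∑ j, φ (ζ j)

/-- The MSVR correction weight `γ' = (N - |𝓑|) / (|𝓑| (1 - γ)) + 1 - γ`. -/
def msvrWeight (N B : ℕ) (γ : ℝ) : ℝ :=
  ((N : ℝ) - B) / (B * (1 - γ)) + 1 - γ

/-- The MSVR update of one estimator `u`: `new` and `old` are the mini-batch averages of one
and the same mini-batch at the current and at the previous iterate. -/
def msvrUpdate (N B : ℕ) (γ u new old : ℝ) : ℝ :=
  (1 - γ) * u + γ * new + msvrWeight N B γ * (new - old)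

/-- The randomness of one iteration: the outer mini-batches `𝓑^t` and `𝓑_c^t`, and the inner
mini-batches `𝓑_{1,i}^t` (of size `b₁`) and `𝓑_{2,k}^t` (of size `b₂`). Inner mini-batches
are drawn for all indices; those outside the outer mini-batches are never used. -/
abbrev Draw (n m b₁ b₂ : ℕ) (Z W : Type*) : Type _ :=
  (Finset (Fin n) × Finset (Fin m)) × ((Fin n → Fin b₁ → Z) × (Fin m → Fin b₂ → W))

/-- What the algorithm keeps: `x_{t-1}`, `x_t`, `u_{1,i}^t` and `u_{2,k}^t`. -/
structure AlgState (d n m : ℕ) where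
  xPrev : Vec d
  x : Vec d
  u₁ : Fin n → ℝ
  u₂ : Fin m → ℝ

namespace Problem

variable {d n m b₁ b₂ : ℕ} {Z W : Type*} [MeasurableSpace Z] [MeasurableSpace W]

/-- The law of the randomness of one iteration: uniformly random outer mini-batches of sizes
`B` and `Bc` (without replacement), i.i.d. inner samples, all independent. -/
def drawLaw (P : Problem d n m Z W) (B Bc b₁ b₂ : ℕ) : Measure (Draw n m b₁ b₂ Z W) :=
  ((uniformOn {s : Finset (Fin n) | s.card = B}).prod
      (uniformOn {s : Finset (Fin m) | s.card = Bc})).prod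
    ((Measure.pi fun _ : Fin n => Measure.pi fun _ : Fin b₁ => P.ν).prod
      (Measure.pi fun _ : Fin m => Measure.pi fun _ : Fin b₂ => P.τ))

/-- `G_1^t = (1/|𝓑^t|) ∑_{i ∈ 𝓑^t} ∂g_i(x_t; 𝓑_{1,i}^t) ∂f_i(u_{1,i}^t)`. -/
def G₁ (P : Problem d n m Z W) (s : AlgState d n m) (ω : Draw n m b₁ b₂ Z W) : Vec d :=
  (ω.1.1.card : ℝ)⁻¹ • ∑ i ∈ ω.1.1, P.df i (s.u₁ i) • batchMean (P.dg i s.x) (ω.2.1 i)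

/-- `G_2^t = (β/|𝓑_c^t|) ∑_{k ∈ 𝓑_c^t} ∂h_k(x_t; 𝓑_{2,k}^t) [u_{2,k}^t]'_+`. -/
def G₂ (P : Problem d n m Z W) (β : ℝ) (s : AlgState d n m) (ω : Draw n m b₁ b₂ Z W) : Vec d :=
  (β / (ω.1.2.card : ℝ)) • ∑ k ∈ ω.1.2, P.dhinge (s.u₂ k) • batchMean (P.dh k s.x) (ω.2.2 k)

/-- One iteration of the algorithm. -/
def step (P : Problem d n m Z W) (β γ₁ γ₂ η : ℝ) (s : AlgState d n m)
    (ω : Draw n m b₁ b₂ Z W) : AlgState d n m where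
  xPrev := s.x
  x := s.x - η • (P.G₁ s ω + P.G₂ β s ω)
  u₁ := fun i =>
    if i ∈ ω.1.1 then
      msvrUpdate n ω.1.1.card γ₁ (s.u₁ i)
        (batchMean (P.g i s.x) (ω.2.1 i)) (batchMean (P.g i s.xPrev) (ω.2.1 i))
    else s.u₁ i
  u₂ := fun k =>
    if k ∈ ω.1.2 then
      msvrUpdate m ω.1.2.card γ₂ (s.u₂ k)
        (batchMean (P.h k s.x) (ω.2.2 k)) (batchMean (P.h k s.xPrev) (ω.2.2 k))
    else s.u₂ k

/-- The state after `t` iterations, started at `x_{-1} = x_0` with estimators `u₁`, `u₂`. -/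
def run (P : Problem d n m Z W) (β γ₁ γ₂ η : ℝ) (x₀ : Vec d) (u₁ : Fin n → ℝ) (u₂ : Fin m → ℝ)
    (ω : ℕ → Draw n m b₁ b₂ Z W) : ℕ → AlgState d n m
  | 0 => ⟨x₀, x₀, u₁, u₂⟩
  | t + 1 => P.step β γ₁ γ₂ η (P.run β γ₁ γ₂ η x₀ u₁ u₂ ω t) (ω t)

end Problem

end

/-!
The proof is a descent argument for the Moreau envelope `Φ_θ`, run on the law of the state of the
algorithm, which is a Markov chain (`Problem.stateLaw`, `Assumptions.map_run`).

*Composite structure.* Since `f_i` and the hinge function are nondecreasing, the lower bound that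
weak convexity gives for an inner function passes through the outer one. So the expected search
direction, with outer subgradients evaluated at the estimators `u` in place of the inner values, is
a subgradient of `Φ` up to a quadratic term and a bias that is controlled by the estimation errors
(`chain_inexact`, `Assumptions.inner_meanDirection_le`). With exact estimators the bias vanishes:
`Φ` has global quadratic supports of a curvature linear in `β`. For `θ = a / (ρ0 + ρ1 β)` with small
`a` the proximal map is therefore single-valued and Lipschitz, and `Φ_θ` is differentiable with
gradient `θ⁻¹ (x - prox x)` (`IsProx.hasGradientAt`).

*Descent.* One iteration decreases `Φ_θ` in expectation by `(η / 4) ‖∇Φ_θ‖²`, up to `(η / θ)` times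
the bias and a second-order term `η² / (2θ) · O(β²)` (`Assumptions.lintegral_envelope_le`). The
second moment of the search direction is `O(β²)` under either hypothesis on the oracle; for sampled
subgradients it follows from Fatou's lemma in each coordinate direction, which is where the
dimension enters (`lintegral_norm_sq_subgradient_le`).

*Estimation errors.* Let `p` be the probability that an index is selected. The correction weight of
the variance-reduced update is the one for which the cross terms between the old error and the drift
of the inner value cancel between the selected and the unselected branch (`msvr_algebra`). So the
mean square error contracts by `(1 - pγ/2)²` per iteration, down to a stationary level of order
`γ / b + η² β² / (p² γ)`. The bias is linear in
the error plus a quadratic term whose transient decays even faster, and the mean absolute error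
decays like `(1 - pγ/2)^t`: the transients contribute `1 / (pγ)` in total over all times
(`Assumptions.lintegral_bias_le`, `Assumptions.sum_gradient_le`).

*Parameters.* With `w = √min(b₁, b₂/β²)` the prescribed `γ` and `η` are `s² w² ε⁴ / β²` and
`s² p w ε⁴ / β³`, where now `p = min(B/n, Bc/(βm))`. The stationary errors are then of order
`s ε² / β` (inner functions) and `s ε² / β²` (constraints), and since `1 / θ = O(β)` all persistent
terms are at most a small multiple of `ε²` once `s` is small. The initial gap `Δ β / (η T)` and the
transients `β / (pγ T)` are small for `T` above the stated threshold (`total_error_le`).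
Averaging over the times `1, …, T` gives the claim.
-/

noncomputable section

/-! ### Subgradients and weak convexity -/

section Subgradients

variable {V : Type*} [NormedAddCommGroup V] [InnerProductSpace ℝ V]

/-- The defining inequality of a Fréchet subgradient along a ray. -/
lemma eventually_le_of_mem_subdiff {ψ : V → ℝ} {x v : V} (hv : v ∈ subdiff ψ x) (w : V)
    {r : ℝ} (hr : 0 < r) :
    ∀ᶠ t : ℝ in 𝓝[>] 0, inner ℝ v w - r * ‖w‖ ≤ (ψ (x + t • w) - ψ x) / t := by
  have h1 : Filter.Tendsto (fun t : ℝ => x + t • w) (𝓝[>] 0) (𝓝 x) := by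
    have : Continuous fun t : ℝ => x + t • w := by fun_prop
    simpa using (this.tendsto 0).mono_left nhdsWithin_le_nhds
  filter_upwards [h1.eventually (hv r hr), self_mem_nhdsWithin] with t ht ht0
  have ht0 : 0 < t := ht0
  rw [le_div_iff₀ ht0]
  simp only [add_sub_cancel_left, inner_smul_right, norm_smul, Real.norm_eq_abs,
    abs_of_pos ht0] at ht
  linarith

/-- A Fréchet subgradient of a convex function is a global one. -/
lemma ConvexOn.le_of_mem_subdiff {ψ : V → ℝ} (hψ : ConvexOn ℝ Set.univ ψ) {x v : V}
    (hv : v ∈ subdiff ψ x) (y : V) : ψ x + inner ℝ v (y - x) ≤ ψ y := by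
  refine le_of_forall_pos_le_add fun δ hδ => ?_
  have hr : 0 < δ / (‖y - x‖ + 1) := by positivity
  have h1 : (Set.Iio (1 : ℝ)) ∈ 𝓝[>] (0 : ℝ) :=
    mem_nhdsWithin_of_mem_nhds (Iio_mem_nhds one_pos)
  obtain ⟨t, ⟨ht, ht0⟩, ht1⟩ := (((eventually_le_of_mem_subdiff hv (y - x) hr).and
    self_mem_nhdsWithin).and h1).exists
  have ht0 : 0 < t := ht0
  have ht1 : t < 1 := ht1
  rw [le_div_iff₀ ht0] at ht
  have hc := hψ.2 (Set.mem_univ x) (Set.mem_univ y) (by linarith : 0 ≤ 1 - t) ht0.le (by ring)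
  have he : (1 - t) • x + t • y = x + t • (y - x) := by module
  rw [he, smul_eq_mul, smul_eq_mul] at hc
  have hle : δ / (‖y - x‖ + 1) * ‖y - x‖ ≤ δ := by
    rw [div_mul_eq_mul_div, div_le_iff₀ (by positivity)]
    nlinarith [norm_nonneg (y - x)]
  have h2 : t * (inner ℝ v (y - x) - δ / (‖y - x‖ + 1) * ‖y - x‖) ≤ t * (ψ y - ψ x) := by
    nlinarith
  have := le_of_mul_le_mul_left h2 ht0
  linarith

end Subgradients

lemma subdiff_le_of_lipschitz {f : ℝ → ℝ} {L : ℝ≥0} (hf : LipschitzWith L f) {u v : ℝ}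
    (hv : v ∈ subdiff f u) : |v| ≤ L := by
  have key : ∀ w : ℝ, |w| = 1 → v * w ≤ L := by
    intro w hw
    refine le_of_forall_pos_le_add fun δ hδ => ?_
    obtain ⟨t, ht, ht0⟩ := ((eventually_le_of_mem_subdiff hv w hδ).and self_mem_nhdsWithin).exists
    have ht0 : 0 < t := ht0
    rw [le_div_iff₀ ht0] at ht
    have h1 := hf.dist_le_mul (u + t • w) u
    rw [Real.dist_eq, Real.dist_eq, add_sub_cancel_left, smul_eq_mul, abs_mul, hw,
      abs_of_pos ht0] at h1
    have h2 := (le_abs_self _).trans h1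
    have h3 : inner ℝ v w = v * w := by simp [mul_comm]
    rw [h3, Real.norm_eq_abs, hw] at ht
    simp only [smul_eq_mul] at ht
    have : t * (v * w - δ) ≤ t * L := by nlinarith
    linarith [le_of_mul_le_mul_left this ht0]
  rw [abs_le]
  constructor
  · linarith [key (-1) (by simp)]
  · linarith [key 1 (by simp)]

/-- The Fréchet subgradients of a nondecreasing function are nonnegative; this is what lets the lower
bound on the inner function pass through the outer one in `chain_inexact`. -/
lemma subdiff_nonneg_of_monotone {f : ℝ → ℝ} (hf : Monotone f) {u v : ℝ}
    (hv : v ∈ subdiff f u) : 0 ≤ v := by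
  refine le_of_forall_pos_le_add fun δ hδ => ?_
  obtain ⟨t, ht, ht0⟩ :=
    ((eventually_le_of_mem_subdiff hv (-1) hδ).and self_mem_nhdsWithin).exists
  have ht0 : 0 < t := ht0
  have h1 : f (u + t • (-1)) ≤ f u := hf (by simp; linarith)
  have h2 : (f (u + t • (-1)) - f u) / t ≤ 0 :=
    div_nonpos_of_nonpos_of_nonneg (by linarith) ht0.le
  have h3 : inner ℝ v (-1 : ℝ) = -v := by simp
  rw [h3] at ht
  simp only [norm_neg, norm_one, mul_one] at ht
  linarith

/-- Every selection of subgradients of a weakly convex function on the line is measurable: adding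
`ρ u` makes it monotone. -/
lemma measurable_of_mem_subdiff {f df : ℝ → ℝ} {ρ : ℝ} (hf : WeaklyConvex ρ f)
    (hdf : ∀ u, df u ∈ subdiff f u) : Measurable df := by
  have hmono : Monotone fun u => df u + ρ * u := by
    intro u v huv
    rcases huv.eq_or_lt with rfl | hlt
    · exact le_rfl
    have h1 := hf v u _ (hdf u)
    have h2 := hf u v _ (hdf v)
    simp only [RCLike.inner_apply, conj_trivial, Real.norm_eq_abs, sq_abs] at h1 h2
    have h3 : 0 ≤ (v - u) * ((df v + ρ * v) - (df u + ρ * u)) := by nlinarith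
    have := nonneg_of_mul_nonneg_right h3 (by linarith)
    simpa using this
  have h : df = fun u => (df u + ρ * u) - ρ * u := by funext u; ring
  rw [h]
  exact hmono.measurable.sub (measurable_id.const_mul ρ)

lemma hinge_mono : Monotone hinge := fun _ _ h => max_le_max le_rfl h

lemma hinge_lipschitz : LipschitzWith 1 hinge := by
  have := LipschitzWith.id.const_max (α := ℝ) (0 : ℝ)
  exact this

lemma hinge_convexOn : ConvexOn ℝ Set.univ hinge :=
  (convexOn_const 0 convex_univ).sup (convexOn_id convex_univ)

lemma hinge_weaklyConvex : WeaklyConvex 0 hinge := by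
  intro x x' v hv
  have := hinge_convexOn.le_of_mem_subdiff hv x
  simpa using this

section Chain

variable {V : Type*} [NormedAddCommGroup V] [InnerProductSpace ℝ V]

/-- The inequality behind the inexact chain rule: the product of a subgradient of `f` at `u` and of
a subgradient of `g` at `x` is a subgradient of `f ∘ g` at `x` up to a quadratic term and the error
made by evaluating the outer subgradient at `u` in place of `g x`. -/
lemma chain_inexact {f : ℝ → ℝ} {g : V → ℝ} {L Lg : ℝ≥0} {ρ ρg s u : ℝ} {x v : V}
    (hf : LipschitzWith L f) (hfm : Monotone f) (hfw : WeaklyConvex ρ f) (hρ : 0 ≤ ρ)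
    (hρg : 0 ≤ ρg)
    (hs : s ∈ subdiff f u) (hg : WeaklyConvex ρg g) (hgl : LipschitzWith Lg g)
    (hv : v ∈ subdiff g x) (y : V) :
    s * inner ℝ v (y - x) ≤ f (g y) - f (g x) + 2 * L * |u - g x| + ρ * |u - g x| ^ 2
      + (ρ * Lg ^ 2 + L * ρg / 2) * ‖y - x‖ ^ 2 := by
  have hs0 := subdiff_nonneg_of_monotone hfm hs
  have hsL : s ≤ L := (le_abs_self s).trans (subdiff_le_of_lipschitz hf hs)
  have h1 := hg y x v hv
  have h2 := hfw (g y) u s hs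
  simp only [RCLike.inner_apply, conj_trivial, Real.norm_eq_abs, sq_abs] at h2
  have h3 : |f u - f (g x)| ≤ L * |u - g x| := by
    simpa [Real.dist_eq] using hf.dist_le_mul u (g x)
  have h4 : |g y - g x| ≤ Lg * ‖y - x‖ := by
    simpa [Real.dist_eq, dist_eq_norm] using hgl.dist_le_mul y x
  have h5 : (g y - g x) ^ 2 ≤ Lg ^ 2 * ‖y - x‖ ^ 2 := by
    rw [← sq_abs (g y - g x), ← mul_pow]; gcongr
  have h6 : s * (u - g x) ≤ L * |u - g x| :=
    (mul_le_mul_of_nonneg_left (le_abs_self _) hs0).trans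
      (mul_le_mul_of_nonneg_right hsL (abs_nonneg _))
  have h7 : (g y - u) ^ 2 ≤ 2 * (g y - g x) ^ 2 + 2 * (u - g x) ^ 2 := by
    nlinarith [sq_nonneg ((g y - g x) + (u - g x))]
  have h8 : ρ / 2 * (g y - u) ^ 2 ≤ ρ * (u - g x) ^ 2 + ρ * (Lg ^ 2 * ‖y - x‖ ^ 2) := by
    nlinarith
  have h9 : s * (ρg / 2 * ‖y - x‖ ^ 2) ≤ L * (ρg / 2 * ‖y - x‖ ^ 2) :=
    mul_le_mul_of_nonneg_right hsL (by positivity)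
  have h10 : s * inner ℝ v (y - x) ≤ s * (g y - g x + ρg / 2 * ‖y - x‖ ^ 2) :=
    mul_le_mul_of_nonneg_left (by linarith) hs0
  rw [sq_abs]
  nlinarith [(abs_le.1 h3).1]

end Chain

/-! ### The Moreau envelope of a weakly convex function -/

section Moreau

variable {V : Type*} [NormedAddCommGroup V] {θ ρ : ℝ} {φ : V → ℝ}

/-- `p` is a proximal point of `φ` at `x` with parameter `θ`: it attains the minimum in the
definition of the Moreau envelope. -/
def IsProx (θ : ℝ) (φ : V → ℝ) (x p : V) : Prop :=
  ∀ y, φ p + 1 / (2 * θ) * ‖p - x‖ ^ 2 ≤ φ y + 1 / (2 * θ) * ‖y - x‖ ^ 2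

lemma exists_isProx [ProperSpace V] (hθ : 0 < θ) (hφ : Continuous φ) {c : ℝ} (hc : ∀ x, c ≤ φ x)
    (x : V) : ∃ p, IsProx θ φ x p := by
  refine Continuous.exists_forall_le (f := fun y => φ y + 1 / (2 * θ) * ‖y - x‖ ^ 2)
    (by fun_prop) ?_
  have h1 : Filter.Tendsto (fun y : V => c + 1 / (2 * θ) * ‖y - x‖ ^ 2) (Filter.cocompact V)
      Filter.atTop := by
    refine Filter.tendsto_atTop_add_const_left _ _
      (Filter.Tendsto.const_mul_atTop (by positivity) ?_)
    refine (Filter.tendsto_pow_atTop two_ne_zero).comp ?_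
    have := tendsto_norm_cocompact_atTop (E := V)
    refine Filter.tendsto_atTop_mono (f := fun y : V => ‖y‖ - ‖x‖)
      (fun y => norm_sub_norm_le y x) ?_
    exact Filter.tendsto_atTop_add_const_right _ _ this
  exact Filter.tendsto_atTop_mono (fun y => by gcongr; exact hc y) h1

lemma IsProx.moreauEnvelope_eq {x p : V} (h : IsProx θ φ x p) :
    moreauEnvelope θ φ x = φ p + 1 / (2 * θ) * ‖p - x‖ ^ 2 :=
  le_antisymm (ciInf_le ⟨φ p + 1 / (2 * θ) * ‖p - x‖ ^ 2, by rintro _ ⟨y, rfl⟩; exact h y⟩ p)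
    (le_ciInf h)

lemma IsProx.moreauEnvelope_le {x p : V} (h : IsProx θ φ x p) (y : V) :
    moreauEnvelope θ φ x ≤ φ y + 1 / (2 * θ) * ‖y - x‖ ^ 2 :=
  h.moreauEnvelope_eq.trans_le (h y)

variable [InnerProductSpace ℝ V]

/-- `φ` has at every point a global quadratic minorant of curvature `-ρ` touching it there. Unlike
`WeaklyConvex`, this contains the existence of a supporting vector at each point. -/
def HasSupports (ρ : ℝ) (φ : V → ℝ) : Prop :=
  ∀ x, ∃ v : V, ∀ y, φ x + inner ℝ v (y - x) - ρ / 2 * ‖y - x‖ ^ 2 ≤ φ y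

/-- At a proximal point `p` of `x`, the vector `θ⁻¹ (x - p)` supports `φ` globally. The proof moves
from `p` towards `y` and uses the support at the intermediate point. -/
lemma IsProx.support (hθ : 0 < θ) (hφ : HasSupports ρ φ) {x p : V} (h : IsProx θ φ x p) (y : V) :
    φ p + θ⁻¹ * inner ℝ (x - p) (y - p) - ρ / 2 * ‖y - p‖ ^ 2 ≤ φ y := by
  set N := ‖y - p‖ ^ 2 with hN
  have key : ∀ s : ℝ, 0 < s → s < 1 →
      φ p + θ⁻¹ * inner ℝ (x - p) (y - p) - ρ / 2 * N ≤ φ y + s * ((1 / (2 * θ) - ρ / 2) * N) := by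
    intro s hs0 hs1
    obtain ⟨w, hw⟩ := hφ (p + s • (y - p))
    have h1 := hw p
    have h2 := hw y
    have h3 := h (p + s • (y - p))
    have e1 : p - (p + s • (y - p)) = (-s) • (y - p) := by module
    have e2 : y - (p + s • (y - p)) = (1 - s) • (y - p) := by module
    have e3 : p + s • (y - p) - x = s • (y - p) - (x - p) := by module
    rw [e1, inner_smul_right, norm_smul, mul_pow, Real.norm_eq_abs, sq_abs, ← hN] at h1
    rw [e2, inner_smul_right, norm_smul, mul_pow, Real.norm_eq_abs, sq_abs, ← hN] at h2
    rw [e3, norm_sub_sq_real (s • (y - p)), inner_smul_left, norm_smul, mul_pow,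
      Real.norm_eq_abs, sq_abs, ← hN, ← norm_sub_rev x p, real_inner_comm] at h3
    simp only [conj_trivial] at h3
    set q := φ (p + s • (y - p))
    set I := inner ℝ (x - p) (y - p)
    have h4 : q ≤ (1 - s) * φ p + s * φ y + ρ / 2 * (s * (1 - s)) * N := by
      have a1 := mul_le_mul_of_nonneg_left h1 (by linarith : 0 ≤ 1 - s)
      have a2 := mul_le_mul_of_nonneg_left h2 hs0.le
      nlinarith
    have h5 : θ⁻¹ = 2 * (1 / (2 * θ)) := by field_simp
    rw [h5]
    set k := 1 / (2 * θ)
    have h6 : s * (φ p + 2 * k * I - ρ / 2 * N) ≤ s * (φ y + s * ((k - ρ / 2) * N)) := by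
      nlinarith
    exact le_of_mul_le_mul_left h6 hs0
  have hlim : Filter.Tendsto (fun s : ℝ => φ y + s * ((1 / (2 * θ) - ρ / 2) * N)) (𝓝[>] 0)
      (𝓝 (φ y)) := by
    have : Continuous fun s : ℝ => φ y + s * ((1 / (2 * θ) - ρ / 2) * N) := by fun_prop
    simpa using (this.tendsto 0).mono_left nhdsWithin_le_nhds
  refine ge_of_tendsto hlim ?_
  filter_upwards [self_mem_nhdsWithin, mem_nhdsWithin_of_mem_nhds (Iio_mem_nhds one_pos)]
    with s hs0 hs1 using key s hs0 hs1

/-- The proximal map is Lipschitz with constant `(1 - ρθ)⁻¹`. -/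
lemma IsProx.dist_le (hθ : 0 < θ) (hφ : HasSupports ρ φ) {x p x' p' : V} (h : IsProx θ φ x p)
    (h' : IsProx θ φ x' p') : (1 - ρ * θ) * ‖p - p'‖ ≤ ‖x - x'‖ := by
  have h1 := h.support hθ hφ p'
  have h2 := h'.support hθ hφ p
  rw [norm_sub_rev p' p] at h1
  have e1 : p' - p = -(p - p') := by module
  have e2 : inner ℝ (x - p) (p - p') - inner ℝ (x' - p') (p - p')
      = inner ℝ (x - x') (p - p') - ‖p - p'‖ ^ 2 := by
    rw [← inner_sub_left, ← real_inner_self_eq_norm_sq, ← inner_sub_left]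
    congr 1; abel
  rw [e1, inner_neg_right] at h1
  have h3 : θ⁻¹ * (‖p - p'‖ ^ 2 - inner ℝ (x - x') (p - p')) ≤ ρ * ‖p - p'‖ ^ 2 := by
    rw [← neg_sub, ← e2]
    linarith
  have h4 : ‖p - p'‖ ^ 2 - inner ℝ (x - x') (p - p') ≤ θ * (ρ * ‖p - p'‖ ^ 2) := by
    rwa [inv_mul_le_iff₀ hθ] at h3
  have h5 := real_inner_le_norm (x - x') (p - p')
  rcases (norm_nonneg (p - p')).eq_or_lt with h0 | h0
  · rw [← h0]; simp
  · refine le_of_mul_le_mul_right ?_ h0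
    nlinarith

/-- The gradient of the Moreau envelope. Testing the minimum at `x'` with the proximal point of `x`
gives a quadratic upper bound; exchanging the two points and using `IsProx.dist_le` gives the
matching lower bound. -/
lemma IsProx.hasGradientAt [CompleteSpace V] (hθ : 0 < θ) (hρθ : ρ * θ < 1) (hφ : HasSupports ρ φ)
    {prox : V → V} (hp : ∀ x, IsProx θ φ x (prox x)) (x : V) :
    HasGradientAt (moreauEnvelope θ φ) (θ⁻¹ • (x - prox x)) x := by
  have upper : ∀ x x' : V, moreauEnvelope θ φ x' ≤ moreauEnvelope θ φ x
      + θ⁻¹ * inner ℝ (x - prox x) (x' - x) + 1 / (2 * θ) * ‖x' - x‖ ^ 2 := by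
    intro x x'
    have h1 := (hp x').moreauEnvelope_le (prox x)
    rw [(hp x).moreauEnvelope_eq]
    have e : prox x - x' = -((x - prox x) + (x' - x)) := by abel
    rw [e, norm_neg, norm_add_sq_real] at h1
    have h5 : θ⁻¹ = 2 * (1 / (2 * θ)) := by field_simp
    rw [h5, norm_sub_rev (prox x) x]
    linarith
  set K := θ⁻¹ * (1 + (1 - ρ * θ)⁻¹) + 1 / (2 * θ) with hK
  have h1ρ : 0 < 1 - ρ * θ := by linarith
  have hbound : ∀ x', ‖moreauEnvelope θ φ x' - moreauEnvelope θ φ x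
      - inner ℝ (θ⁻¹ • (x - prox x)) (x' - x)‖ ≤ K * ‖x' - x‖ ^ 2 := by
    intro x'
    have hu := upper x x'
    have hl := upper x' x
    have hd : ‖prox x' - prox x‖ ≤ (1 - ρ * θ)⁻¹ * ‖x' - x‖ := by
      rw [inv_mul_eq_div, le_div_iff₀ h1ρ, mul_comm]
      exact (hp x').dist_le hθ hφ (hp x)
    have e1 : inner ℝ (x' - prox x') (x - x') = -(inner ℝ (x - prox x) (x' - x))
        - ‖x' - x‖ ^ 2 + inner ℝ (prox x' - prox x) (x' - x) := by
      have : x' - prox x' = (x - prox x) + (x' - x) - (prox x' - prox x) := by abel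
      rw [this, ← neg_sub x' x, inner_neg_right, inner_sub_left, inner_add_left,
        real_inner_self_eq_norm_sq]
      ring
    have h2 : inner ℝ (prox x' - prox x) (x' - x) ≤ (1 - ρ * θ)⁻¹ * ‖x' - x‖ ^ 2 := by
      refine (real_inner_le_norm _ _).trans ?_
      calc _ ≤ ((1 - ρ * θ)⁻¹ * ‖x' - x‖) * ‖x' - x‖ := by gcongr
        _ = _ := by ring
    rw [e1, norm_sub_rev x x'] at hl
    have hθi : 0 < θ⁻¹ := by positivity
    have h3 := mul_le_mul_of_nonneg_left h2 hθi.le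
    have h4 : 0 ≤ θ⁻¹ * ‖x' - x‖ ^ 2 := by positivity
    have h5 : 0 ≤ θ⁻¹ * ((1 - ρ * θ)⁻¹ * ‖x' - x‖ ^ 2) := by positivity
    rw [Real.norm_eq_abs, abs_le, inner_smul_left, hK]
    simp only [conj_trivial]
    constructor <;> nlinarith
  rw [hasGradientAt_iff_isLittleO]
  have hO : (fun x' => moreauEnvelope θ φ x' - moreauEnvelope θ φ x
      - inner ℝ (θ⁻¹ • (x - prox x)) (x' - x)) =O[𝓝 x] fun x' => ‖x' - x‖ ^ 2 :=
    Asymptotics.IsBigO.of_bound K (Filter.Eventually.of_forall fun x' => by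
      simpa using hbound x')
  refine hO.trans_isLittleO ?_
  have h0 := Asymptotics.isLittleO_pow_id (𝕜 := ℝ) one_lt_two
  have ht : Filter.Tendsto (fun x' => ‖x' - x‖) (𝓝 x) (𝓝 0) := by
    have : Continuous fun x' : V => ‖x' - x‖ := by fun_prop
    simpa using this.tendsto x
  exact (Asymptotics.isLittleO_norm_right.1 (h0.comp_tendsto ht))

end Moreau

/-! ### Second moments -/

section SecondMoments

variable {S : Type*} [MeasurableSpace S] {μ : Measure S}

lemma memLp_two_of_lintegral_sq_le {E : Type*} [NormedAddCommGroup E] {f : S → E} {K : ℝ}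
    (hf : AEStronglyMeasurable f μ)
    (h : ∫⁻ z, ENNReal.ofReal (‖f z‖ ^ 2) ∂μ ≤ ENNReal.ofReal K) : MemLp f 2 μ := by
  rw [memLp_two_iff_integrable_sq_norm hf]
  refine ⟨hf.norm.pow 2, ?_⟩
  rw [hasFiniteIntegral_iff_ofReal (Filter.Eventually.of_forall fun _ => by positivity)]
  exact h.trans_lt ENNReal.ofReal_lt_top

lemma integral_sq_le_of_lintegral_sq_le {E : Type*} [NormedAddCommGroup E] {f : S → E} {K : ℝ}
    (hK : 0 ≤ K) (hf : AEStronglyMeasurable f μ)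
    (h : ∫⁻ z, ENNReal.ofReal (‖f z‖ ^ 2) ∂μ ≤ ENNReal.ofReal K) : ∫ z, ‖f z‖ ^ 2 ∂μ ≤ K := by
  rw [integral_eq_lintegral_of_nonneg_ae (f := fun z => ‖f z‖ ^ 2)
    (Filter.Eventually.of_forall fun _ => by positivity) (hf.norm.pow 2)]
  exact ENNReal.toReal_le_of_le_ofReal hK h

lemma sq_integral_le [IsProbabilityMeasure μ] {f : S → ℝ} (hf : MemLp f 2 μ) :
    (∫ z, f z ∂μ) ^ 2 ≤ ∫ z, f z ^ 2 ∂μ := by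
  have h1 := variance_eq_sub hf
  have h2 := variance_nonneg f μ
  simp only [Pi.pow_apply] at h1
  linarith

/-- The mean of a mean-square Lipschitz random function is Lipschitz. -/
lemma lipschitzWith_integral {V : Type*} [SeminormedAddCommGroup V] [IsProbabilityMeasure μ]
    {φ : V → S → ℝ} {L : ℝ≥0} (hi : ∀ x, Integrable (φ x) μ)
    (hL : ∀ x y, ∫⁻ z, ENNReal.ofReal ((φ x z - φ y z) ^ 2) ∂μ
      ≤ ENNReal.ofReal ((L : ℝ) ^ 2 * ‖x - y‖ ^ 2)) :
    LipschitzWith L fun x => ∫ z, φ x z ∂μ := by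
  refine LipschitzWith.of_dist_le_mul fun x y => ?_
  have hm := ((hi x).sub (hi y)).aestronglyMeasurable
  have h : ∫⁻ z, ENNReal.ofReal (‖(φ x - φ y) z‖ ^ 2) ∂μ
      ≤ ENNReal.ofReal ((L : ℝ) ^ 2 * ‖x - y‖ ^ 2) := by simpa using hL x y
  have h1 := sq_integral_le (memLp_two_of_lintegral_sq_le hm h)
  have h2 := integral_sq_le_of_lintegral_sq_le (by positivity) hm h
  simp only [Real.norm_eq_abs, sq_abs] at h2
  have h3 : ∫ z, (φ x - φ y) z ∂μ = ∫ z, φ x z ∂μ - ∫ z, φ y z ∂μ :=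
    integral_sub (hi x) (hi y)
  rw [dist_eq_norm, dist_eq_norm, Real.norm_eq_abs, ← h3]
  refine abs_le_of_sq_le_sq ?_ (by positivity)
  rw [mul_pow]
  exact h1.trans h2

end SecondMoments

/-! ### Mini-batch averages -/

section Batch

variable {S : Type*} {b : ℕ}

lemma batchMean_sub {V : Type*} [AddCommGroup V] [Module ℝ V] (φ ψ : S → V)
    (z : Fin b → S) : batchMean (fun s => φ s - ψ s) z = batchMean φ z - batchMean ψ z := by
  simp [batchMean, smul_sub]

lemma batchMean_const_mul (c : ℝ) (φ : S → ℝ) (z : Fin b → S) :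
    batchMean (fun s => c * φ s) z = c * batchMean φ z := by
  simp only [batchMean, smul_eq_mul, ← Finset.mul_sum]; ring

lemma batchMean_add (φ ψ : S → ℝ) (z : Fin b → S) :
    batchMean (fun s => φ s + ψ s) z = batchMean φ z + batchMean ψ z := by
  simp [batchMean, Finset.sum_add_distrib, mul_add]

lemma batchMean_const (hb : b ≠ 0) (c : ℝ) (z : Fin b → S) :
    batchMean (fun _ => c) z = c := by
  have : (b : ℝ) ≠ 0 := by exact_mod_cast hb
  simp [batchMean, this]

lemma norm_sq_mean_le {ι V : Type*} [SeminormedAddCommGroup V] [NormedSpace ℝ V] (s : Finset ι)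
    (v : ι → V) : ‖(s.card : ℝ)⁻¹ • ∑ i ∈ s, v i‖ ^ 2 ≤ (s.card : ℝ)⁻¹ * ∑ i ∈ s, ‖v i‖ ^ 2 := by
  rcases s.eq_empty_or_nonempty with rfl | hs
  · simp
  have hc : (0 : ℝ) < s.card := by exact_mod_cast hs.card_pos
  rw [norm_smul, mul_pow, norm_inv, Real.norm_of_nonneg hc.le]
  have h1 : ‖∑ i ∈ s, v i‖ ^ 2 ≤ s.card * ∑ i ∈ s, ‖v i‖ ^ 2 :=
    (pow_le_pow_left₀ (norm_nonneg _) (norm_sum_le _ _) 2).trans sq_sum_le_card_mul_sum_sq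
  calc ((s.card : ℝ)⁻¹) ^ 2 * ‖∑ i ∈ s, v i‖ ^ 2
      ≤ ((s.card : ℝ)⁻¹) ^ 2 * (s.card * ∑ i ∈ s, ‖v i‖ ^ 2) := by gcongr
    _ = _ := by field_simp

lemma norm_sq_batchMean_le {V : Type*} [SeminormedAddCommGroup V] [NormedSpace ℝ V]
    (φ : S → V) (z : Fin b → S) : ‖batchMean φ z‖ ^ 2 ≤ batchMean (fun s => ‖φ s‖ ^ 2) z := by
  have := norm_sq_mean_le Finset.univ fun j => φ (z j)
  simpa [batchMean] using this

variable [MeasurableSpace S] {μ : Measure S} [IsProbabilityMeasure μ]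

lemma integral_batchMean {V : Type*} [NormedAddCommGroup V] [NormedSpace ℝ V]
    (hb : b ≠ 0) {φ : S → V} (hφ : Integrable φ μ) :
    ∫ z, batchMean φ z ∂(Measure.pi fun _ : Fin b => μ) = ∫ s, φ s ∂μ := by
  have hb' : (b : ℝ) ≠ 0 := by exact_mod_cast hb
  unfold batchMean
  rw [integral_smul, integral_finsetSum _ fun j _ =>
    integrable_comp_eval (μ := fun _ : Fin b => μ) (i := j) hφ]
  have : ∀ j : Fin b, ∫ z, φ (z j) ∂(Measure.pi fun _ : Fin b => μ) = ∫ s, φ s ∂μ := fun j =>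
    integral_comp_eval (μ := fun _ : Fin b => μ) (i := j) hφ.aestronglyMeasurable
  simp only [this, Finset.sum_const, Finset.card_univ, Fintype.card_fin]
  rw [← Nat.cast_smul_eq_nsmul ℝ, smul_smul, inv_mul_cancel₀ hb', one_smul]

lemma integrable_batchMean {V : Type*} [NormedAddCommGroup V] [NormedSpace ℝ V]
    {φ : S → V} (hφ : Integrable φ μ) :
    Integrable (batchMean φ) (Measure.pi fun _ : Fin b => μ) := by
  unfold batchMean
  exact Integrable.smul _ (integrable_finsetSum _ fun j _ =>
    integrable_comp_eval (μ := fun _ : Fin b => μ) (i := j) hφ)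

lemma memLp_batchMean {φ : S → ℝ} (hφ : MemLp φ 2 μ) :
    MemLp (batchMean φ) 2 (Measure.pi fun _ : Fin b => μ) := by
  unfold batchMean
  have h : MemLp (fun z : Fin b → S => ∑ j, φ (z j)) 2 (Measure.pi fun _ : Fin b => μ) :=
    memLp_finsetSum (f := fun (j : Fin b) (z : Fin b → S) => φ (z j)) Finset.univ fun j _ =>
      hφ.comp_measurePreserving (measurePreserving_eval (fun _ : Fin b => μ) j)
  exact h.const_smul (b : ℝ)⁻¹

/-- Averaging `b` independent copies of a centred variable divides its second moment by `b`. -/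
lemma integral_sq_batchMean (hb : b ≠ 0) {φ : S → ℝ} (hφ : MemLp φ 2 μ) (h0 : ∫ s, φ s ∂μ = 0) :
    ∫ z, batchMean φ z ^ 2 ∂(Measure.pi fun _ : Fin b => μ) = (∫ s, φ s ^ 2 ∂μ) / b := by
  have hb' : (b : ℝ) ≠ 0 := by exact_mod_cast hb
  have h1 := variance_sum_pi (ι := Fin b) (μ := fun _ => μ) (X := fun _ => φ) fun _ => hφ
  have h2 : ∫ z, batchMean φ z ∂(Measure.pi fun _ : Fin b => μ) = 0 := by
    rw [integral_batchMean hb (hφ.integrable one_le_two), h0]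
  rw [← variance_of_integral_eq_zero (memLp_batchMean hφ).aestronglyMeasurable.aemeasurable h2]
  have h3 : (batchMean φ : (Fin b → S) → ℝ)
      = fun z => (b : ℝ)⁻¹ * (∑ j : Fin b, fun z : Fin b → S => φ (z j)) z := by
    funext z; simp [batchMean]
  rw [h3, variance_const_mul, h1, variance_of_integral_eq_zero
    hφ.aestronglyMeasurable.aemeasurable h0]
  simp
  field_simp

/-- The bias-variance decomposition for a mini-batch average. -/
lemma lintegral_sq_add_batchMean_le (hb : b ≠ 0) {φ : S → ℝ} (hφ : MemLp φ 2 μ)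
    (h0 : ∫ s, φ s ∂μ = 0) {K : ℝ} (hK : ∫ s, φ s ^ 2 ∂μ ≤ K) (c : ℝ) :
    ∫⁻ z, ENNReal.ofReal ((c + batchMean φ z) ^ 2) ∂(Measure.pi fun _ : Fin b => μ)
      ≤ ENNReal.ofReal (c ^ 2 + K / b) := by
  have hm := memLp_batchMean (b := b) hφ
  have hm2 : MemLp (fun z => c + batchMean φ z) 2 (Measure.pi fun _ : Fin b => μ) :=
    (memLp_const c).add hm
  rw [← ofReal_integral_eq_lintegral_ofReal hm2.integrable_sq
    (Filter.Eventually.of_forall fun _ => by positivity)]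
  refine ENNReal.ofReal_le_ofReal ?_
  have h1 : ∀ z : Fin b → S, (c + batchMean φ z) ^ 2
      = c ^ 2 + (2 * c) * batchMean φ z + batchMean φ z ^ 2 := fun z => by ring
  have hi := hm.integrable one_le_two
  have hi1 : Integrable (fun z => c ^ 2 + (2 * c) * batchMean φ z)
      (Measure.pi fun _ : Fin b => μ) := (integrable_const _).add (hi.const_mul (2 * c))
  simp only [h1]
  rw [integral_add hi1 hm.integrable_sq, integral_add (integrable_const _) (hi.const_mul _),
    integral_const_mul, integral_batchMean hb (hφ.integrable one_le_two), h0,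
    integral_sq_batchMean hb hφ h0]
  simp only [integral_const, probReal_univ, smul_eq_mul, one_mul, mul_zero, add_zero]
  gcongr

lemma measurable_batchMean {X V : Type*} [MeasurableSpace X] [NormedAddCommGroup V]
    [NormedSpace ℝ V] [MeasurableSpace V] [BorelSpace V] [SecondCountableTopology V]
    {φ : X → S → V} (hφ : Measurable (Function.uncurry φ)) :
    Measurable fun q : X × (Fin b → S) => batchMean (φ q.1) q.2 := by
  unfold batchMean
  refine Measurable.const_smul (Finset.measurable_sum _ fun j _ => ?_) _
  have : Measurable fun q : X × (Fin b → S) => (q.1, q.2 j) := by fun_prop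
  exact hφ.comp this

end Batch

/-! ### Moments of sampled subgradients -/

section SampleMoments

variable {d : ℕ} {S : Type*} [MeasurableSpace S] {μ : Measure S}

/-- Fatou's lemma along the difference quotients in a unit direction bounds the positive part of
the directional component of a sampled subgradient. -/
lemma lintegral_inner_subgradient_le {φ : Vec d → S → ℝ} {v : S → Vec d} {x w : Vec d}
    {L : ℝ≥0} (hφ : ∀ x, Measurable (φ x)) (hw : ‖w‖ = 1)
    (hv : ∀ᵐ z ∂μ, v z ∈ subdiff (fun y => φ y z) x)
    (hL : ∀ x y, ∫⁻ z, ENNReal.ofReal ((φ x z - φ y z) ^ 2) ∂μ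
      ≤ ENNReal.ofReal ((L : ℝ) ^ 2 * ‖x - y‖ ^ 2)) :
    ∫⁻ z, ENNReal.ofReal ((max 0 (inner ℝ (v z) w)) ^ 2) ∂μ ≤ ENNReal.ofReal ((L : ℝ) ^ 2) := by
  let t : ℕ → ℝ := fun k => 1 / ((k : ℝ) + 1)
  have ht0 : ∀ k, 0 < t k := fun k => by positivity
  have ht : Filter.Tendsto t Filter.atTop (𝓝[>] 0) :=
    tendsto_nhdsWithin_iff.2 ⟨tendsto_one_div_add_atTop_nhds_zero_nat,
      Filter.Eventually.of_forall ht0⟩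
  let Q : ℕ → S → ℝ≥0∞ := fun k z =>
    ENNReal.ofReal (((φ (x + t k • w) z - φ x z) / t k) ^ 2)
  have hQ : ∀ k, Measurable (Q k) := fun k =>
    ((((hφ _).sub (hφ _)).div_const _).pow_const 2).ennreal_ofReal
  have h1 : ∀ᵐ z ∂μ, ENNReal.ofReal ((max 0 (inner ℝ (v z) w)) ^ 2)
      ≤ Filter.liminf (fun k => Q k z) Filter.atTop := by
    filter_upwards [hv] with z hz
    set a := inner ℝ (v z) w
    refine le_of_forall_lt fun c hc => ?_
    have hcont : Continuous fun δ : ℝ => ENNReal.ofReal ((max 0 (a - δ)) ^ 2) :=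
      ENNReal.continuous_ofReal.comp (by fun_prop)
    have hev : ∀ᶠ δ in 𝓝[>] (0 : ℝ), c < ENNReal.ofReal ((max 0 (a - δ)) ^ 2) := by
      refine ((hcont.tendsto 0).mono_left nhdsWithin_le_nhds).eventually (lt_mem_nhds ?_)
      simpa using hc
    obtain ⟨δ, hδ, hδ0⟩ := (hev.and self_mem_nhdsWithin).exists
    refine hδ.trans_le (Filter.le_liminf_of_le (by isBoundedDefault) ?_)
    filter_upwards [ht.eventually (eventually_le_of_mem_subdiff hz w hδ0)] with k hk
    rw [hw, mul_one] at hk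
    refine ENNReal.ofReal_le_ofReal ?_
    rw [← sq_abs ((φ (x + t k • w) z - φ x z) / t k)]
    exact pow_le_pow_left₀ (le_max_left _ _)
      (max_le (abs_nonneg _) (hk.trans (le_abs_self _))) 2
  refine (lintegral_mono_ae h1).trans ((lintegral_liminf_le hQ).trans ?_)
  refine Filter.liminf_le_of_le (by isBoundedDefault) fun b hb => ?_
  obtain ⟨k, hk⟩ := hb.exists
  refine hk.trans ?_
  have h2 : ∀ z, Q k z = ENNReal.ofReal ((t k)⁻¹ ^ 2)
      * ENNReal.ofReal ((φ (x + t k • w) z - φ x z) ^ 2) := by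
    intro z
    rw [← ENNReal.ofReal_mul (by positivity)]
    simp only [Q]
    congr 1
    rw [div_eq_mul_inv]; ring
  simp only [h2]
  rw [lintegral_const_mul' _ _ ENNReal.ofReal_ne_top]
  refine (mul_le_mul_right (hL _ _) _).trans ?_
  rw [← ENNReal.ofReal_mul (by positivity)]
  refine ENNReal.ofReal_le_ofReal (le_of_eq ?_)
  have := (ht0 k).ne'
  rw [add_sub_cancel_left, norm_smul, hw, Real.norm_eq_abs, abs_of_pos (ht0 k)]
  field_simp

/-- Sampled subgradients inherit a second-moment bound from mean-square Lipschitz continuity, with a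
factor `2d`: the differentiability of `φ · z` is not known, so that each of the `2d` signed
coordinate directions is bounded by itself. -/
lemma lintegral_norm_sq_subgradient_le {φ : Vec d → S → ℝ} {v : S → Vec d} {x : Vec d}
    {L : ℝ≥0} (hφ : ∀ x, Measurable (φ x)) (hvm : Measurable v)
    (hv : ∀ᵐ z ∂μ, v z ∈ subdiff (fun y => φ y z) x)
    (hL : ∀ x y, ∫⁻ z, ENNReal.ofReal ((φ x z - φ y z) ^ 2) ∂μ
      ≤ ENNReal.ofReal ((L : ℝ) ^ 2 * ‖x - y‖ ^ 2)) :
    ∫⁻ z, ENNReal.ofReal (‖v z‖ ^ 2) ∂μ ≤ ENNReal.ofReal (2 * d * (L : ℝ) ^ 2) := by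
  let e : Fin d → Vec d := fun j => EuclideanSpace.single j 1
  have he : ∀ j, ‖e j‖ = 1 := fun j => by simp [e]
  have hp : ∀ z, ENNReal.ofReal (‖v z‖ ^ 2) ≤ ∑ j : Fin d,
      (ENNReal.ofReal ((max 0 (inner ℝ (v z) (e j))) ^ 2)
        + ENNReal.ofReal ((max 0 (inner ℝ (v z) (-e j))) ^ 2)) := by
    intro z
    rw [EuclideanSpace.norm_sq_eq, ENNReal.ofReal_sum_of_nonneg fun _ _ => by positivity]
    refine Finset.sum_le_sum fun j _ => ?_
    rw [← ENNReal.ofReal_add (by positivity) (by positivity)]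
    refine ENNReal.ofReal_le_ofReal ?_
    rw [inner_neg_right]
    simp only [e, EuclideanSpace.inner_single_right, one_mul, conj_trivial, Real.norm_eq_abs,
      sq_abs]
    rcases le_total 0 ((v z).ofLp j) with h | h
    · rw [max_eq_right h]; nlinarith [sq_nonneg (max 0 (-(v z).ofLp j))]
    · rw [max_eq_right (neg_nonneg.2 h)]; nlinarith [sq_nonneg (max 0 ((v z).ofLp j))]
  have hm : ∀ w : Vec d, Measurable fun z => ENNReal.ofReal ((max 0 (inner ℝ (v z) w)) ^ 2) :=
    fun w => by fun_prop
  refine (lintegral_mono hp).trans ?_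
  rw [lintegral_finsetSum _ fun j _ => Measurable.fun_add (hm _) (hm _)]
  calc _ ≤ ∑ _j : Fin d, (ENNReal.ofReal ((L : ℝ) ^ 2) + ENNReal.ofReal ((L : ℝ) ^ 2)) := by
        refine Finset.sum_le_sum fun j _ => ?_
        rw [lintegral_add_left (hm _)]
        exact add_le_add (lintegral_inner_subgradient_le hφ (he j) hv hL)
          (lintegral_inner_subgradient_le hφ (by rw [norm_neg, he j]) hv hL)
    _ = _ := by
        rw [← ENNReal.ofReal_add (by positivity) (by positivity), Finset.sum_const,
          Finset.card_univ, Fintype.card_fin, nsmul_eq_mul, ← ENNReal.ofReal_natCast,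
          ← ENNReal.ofReal_mul (by positivity)]
        congr 1; ring

end SampleMoments

/-! ### Uniformly random blocks of indices -/

section Blocks

/-- The uniform law on the index sets of size `B`. -/
abbrev subsetLaw (N B : ℕ) : Measure (Finset (Fin N)) := uniformOn {s | s.card = B}

/-- The joint law of a uniformly random index set of size `B` and of independent mini-batches of
`b` samples for all `N` indices. -/
abbrev blockLaw {S : Type*} [MeasurableSpace S] (N B b : ℕ) (μ : Measure S) :
    Measure (Finset (Fin N) × (Fin N → Fin b → S)) :=
  (subsetLaw N B).prod (Measure.pi fun _ : Fin N => Measure.pi fun _ : Fin b => μ)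

/-- The average over the index set of the weighted mini-batch means. -/
def blockMean {S V : Type*} [AddCommGroup V] [Module ℝ V] {N b : ℕ} (a : Fin N → ℝ)
    (v : Fin N → S → V) (q : Finset (Fin N) × (Fin N → Fin b → S)) : V :=
  (q.1.card : ℝ)⁻¹ • ∑ i ∈ q.1, a i • batchMean (v i) (q.2 i)

variable {N B b : ℕ}

lemma setOf_card_eq (N B : ℕ) :
    {s : Finset (Fin N) | s.card = B}
      = ↑(Finset.powersetCard B (Finset.univ : Finset (Fin N))) := by
  ext s; simp [Finset.mem_powersetCard]

lemma isProbabilityMeasure_subsetLaw (hB : B ≤ N) : IsProbabilityMeasure (subsetLaw N B) := by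
  refine isProbabilityMeasure_uniformOn (Set.toFinite _) ?_
  rw [setOf_card_eq, Finset.coe_nonempty]
  exact Finset.powersetCard_nonempty.2 (by simpa using hB)

lemma ae_card_eq_subsetLaw : ∀ᵐ s ∂(subsetLaw N B), s.card = B := by
  rw [ae_iff]
  change uniformOn _ _ = 0
  rw [uniformOn_eq_zero_iff (Set.toFinite _)]
  ext s; simp

/-- An index belongs to a random set of size `B` with probability `B / N`. -/
lemma subsetLaw_real_mem (hB1 : 1 ≤ B) (hB : B ≤ N) (i : Fin N) :
    (subsetLaw N B).real {s | i ∈ s} = (B : ℝ) / N := by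
  obtain ⟨B, rfl⟩ : ∃ k, B = k + 1 := ⟨B - 1, by omega⟩
  obtain ⟨N, rfl⟩ : ∃ k, N = k + 1 := ⟨N - 1, by omega⟩
  have h1 : {s : Finset (Fin (N + 1)) | i ∈ s}
      = ↑(Finset.univ.filter fun s : Finset (Fin (N + 1)) => i ∈ s) := by ext s; simp
  have h2 : Finset.powersetCard (B + 1) (Finset.univ : Finset (Fin (N + 1)))
      ∩ (Finset.univ.filter fun s => i ∈ s)
      = (Finset.powersetCard B (Finset.univ.erase i)).image (insert i) := by
    ext s
    simp only [Finset.mem_inter, Finset.mem_powersetCard, Finset.subset_univ, true_and,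
      Finset.mem_filter, Finset.mem_univ, Finset.mem_image]
    constructor
    · rintro ⟨hc, hi⟩
      exact ⟨s.erase i, ⟨Finset.erase_subset_erase _ (Finset.subset_univ _),
        by rw [Finset.card_erase_of_mem hi, hc]; rfl⟩, Finset.insert_erase hi⟩
    · rintro ⟨t, ⟨ht, hc⟩, rfl⟩
      have hi : i ∉ t := fun h => by simpa using ht h
      exact ⟨by rw [Finset.card_insert_of_notMem hi, hc], Finset.mem_insert_self _ _⟩
  have h3 : ((Finset.powersetCard B (Finset.univ.erase i)).image (insert i)).card
      = N.choose B := by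
    rw [Finset.card_image_of_injOn, Finset.card_powersetCard, Finset.card_erase_of_mem
      (Finset.mem_univ _)]
    · simp
    · intro s hs t ht hst
      have his : i ∉ s := fun h => by simpa using (Finset.mem_powersetCard.1 hs).1 h
      have hit : i ∉ t := fun h => by simpa using (Finset.mem_powersetCard.1 ht).1 h
      rw [← Finset.erase_insert his, ← Finset.erase_insert hit]
      exact congrArg (fun r => r.erase i) hst
  have h4 : (N + 1) * N.choose B = (N + 1).choose (B + 1) * (B + 1) :=
    Nat.add_one_mul_choose_eq N B
  have h5 : ((N : ℝ) + 1) * N.choose B = (N + 1).choose (B + 1) * ((B : ℝ) + 1) := by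
    exact_mod_cast h4
  have h6 : ((N + 1).choose (B + 1) : ℝ) ≠ 0 := by
    exact_mod_cast (Nat.choose_pos hB).ne'
  rw [measureReal_def, subsetLaw, setOf_card_eq, h1, uniformOn_apply_finset, h2, h3]
  simp only [Finset.card_powersetCard, Finset.card_univ, Fintype.card_fin, ENNReal.toReal_div,
    ENNReal.toReal_natCast]
  push_cast
  rw [div_eq_div_iff h6 (by positivity)]
  linarith

variable {S : Type*}

lemma norm_sq_blockMean_le {V : Type*} [NormedAddCommGroup V] [NormedSpace ℝ V] {A : ℝ}
    {a : Fin N → ℝ} (ha : ∀ i, |a i| ≤ A) (v : Fin N → S → V)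
    (q : Finset (Fin N) × (Fin N → Fin b → S)) :
    ‖blockMean a v q‖ ^ 2 ≤ A ^ 2 * blockMean (fun _ => (1 : ℝ)) (fun i s => ‖v i s‖ ^ 2) q := by
  calc _ ≤ (q.1.card : ℝ)⁻¹ * ∑ i ∈ q.1, ‖a i • batchMean (v i) (q.2 i)‖ ^ 2 :=
        norm_sq_mean_le q.1 fun i => a i • batchMean (v i) (q.2 i)
    _ ≤ (q.1.card : ℝ)⁻¹ * ∑ i ∈ q.1, A ^ 2 * batchMean (fun s => ‖v i s‖ ^ 2) (q.2 i) := by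
        gcongr with i hi
        rw [norm_smul, mul_pow, Real.norm_eq_abs]
        exact mul_le_mul (pow_le_pow_left₀ (abs_nonneg _) (ha i) 2) (norm_sq_batchMean_le _ _)
          (by positivity) (by positivity)
    _ = _ := by
        simp only [blockMean, ← Finset.mul_sum, smul_eq_mul, one_mul]
        ring

variable [MeasurableSpace S] {μ : Measure S} [IsProbabilityMeasure μ]

lemma measurePreserving_block_eval (i : Fin N) :
    MeasurePreserving (fun q : Finset (Fin N) × (Fin N → Fin b → S) => (q.1, q.2 i))
      (blockLaw N B b μ) ((subsetLaw N B).prod (Measure.pi fun _ : Fin b => μ)) := by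
  exact (MeasurePreserving.id _).prod
    (measurePreserving_eval (fun _ : Fin N => Measure.pi fun _ : Fin b => μ) i)

lemma ae_card_eq_block {T : Type*} [MeasurableSpace T] {π : Measure T} :
    ∀ᵐ q ∂((subsetLaw N B).prod π), q.1.card = B := by
  exact Measure.quasiMeasurePreserving_fst.ae ae_card_eq_subsetLaw

/-- The block average is an unbiased estimator of the full average. -/
lemma integrable_integral_blockMean {V : Type*} [NormedAddCommGroup V] [NormedSpace ℝ V]
    [CompleteSpace V] (hB1 : 1 ≤ B) (hB : B ≤ N) (hb : b ≠ 0) (a : Fin N → ℝ)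
    {v : Fin N → S → V} (hv : ∀ i, Integrable (v i) μ) :
    Integrable (blockMean a v) (blockLaw N B b μ) ∧
      ∫ q, blockMean a v q ∂(blockLaw N B b μ) = (N : ℝ)⁻¹ • ∑ i, a i • ∫ s, v i s ∂μ := by
  classical
  have := isProbabilityMeasure_subsetLaw hB
  set ind : Fin N → Finset (Fin N) → ℝ := fun i => Set.indicator {s | i ∈ s} 1 with hind
  set F : Fin N → Finset (Fin N) × (Fin N → Fin b → S) → V := fun i q =>
    ((B : ℝ)⁻¹ * a i) • (ind i q.1 • batchMean (v i) (q.2 i)) with hF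
  have hae : blockMean a v =ᵐ[blockLaw N B b μ] fun q => ∑ i, F i q := by
    filter_upwards [ae_card_eq_block] with q hq
    rw [blockMean, hq, Finset.smul_sum]
    rw [← Finset.sum_subset (Finset.subset_univ q.1)]
    · refine Finset.sum_congr rfl fun i hi => ?_
      simp [hF, hind, hi, smul_smul]
    · intro i _ hi
      simp [hF, hind, hi]
  have hindi : ∀ i, Integrable (ind i) (subsetLaw N B) := fun i =>
    (integrable_const (1 : ℝ)).indicator (MeasurableSet.of_discrete)
  have hprod : ∀ i, Integrable (fun q : Finset (Fin N) × (Fin b → S) =>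
      ind i q.1 • batchMean (v i) q.2) ((subsetLaw N B).prod (Measure.pi fun _ : Fin b => μ)) :=
    fun i => (hindi i).smul_prod (integrable_batchMean (hv i))
  have hFi : ∀ i, Integrable (F i) (blockLaw N B b μ) := fun i =>
    ((measurePreserving_block_eval i).integrable_comp_of_integrable (hprod i)).smul _
  refine ⟨(integrable_finsetSum _ fun i _ => hFi i).congr hae.symm, ?_⟩
  rw [integral_congr_ae hae, integral_finsetSum _ fun i _ => hFi i, Finset.smul_sum]
  refine Finset.sum_congr rfl fun i _ => ?_
  have h1 : ∫ q, ind i q.1 • batchMean (v i) (q.2 i) ∂(blockLaw N B b μ)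
      = ((B : ℝ) / N) • ∫ s, v i s ∂μ := by
    have h2 := (measurePreserving_block_eval (B := B) (b := b) (μ := μ) i).map_eq
    have h3 := integral_map (μ := blockLaw N B b μ)
      (measurePreserving_block_eval (B := B) (b := b) (μ := μ) i).measurable.aemeasurable
      (f := fun q : Finset (Fin N) × (Fin b → S) => ind i q.1 • batchMean (v i) q.2)
      (by rw [h2]; exact (hprod i).aestronglyMeasurable)
    rw [← h3, h2, integral_prod_smul (ind i) (batchMean (v i)), integral_batchMean hb (hv i)]
    congr 1
    rw [hind, integral_indicator_one MeasurableSet.of_discrete, subsetLaw_real_mem hB1 hB]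
  simp only [hF]
  rw [integral_smul, h1, smul_smul, smul_smul]
  congr 1
  have : (B : ℝ) ≠ 0 := by exact_mod_cast (by omega : B ≠ 0)
  field_simp

/-- The second moment of a block average is at most that of the summands. -/
lemma integral_blockMean_sq_le {V : Type*} [NormedAddCommGroup V] (hB1 : 1 ≤ B) (hB : B ≤ N)
    (hb : b ≠ 0) {v : Fin N → S → V} {M : ℝ} (hM : 0 ≤ M) (hvm : ∀ i, AEStronglyMeasurable (v i) μ)
    (hv : ∀ i, ∫⁻ s, ENNReal.ofReal (‖v i s‖ ^ 2) ∂μ ≤ ENNReal.ofReal M) :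
    Integrable (blockMean (fun _ => (1 : ℝ)) (fun i s => ‖v i s‖ ^ 2)) (blockLaw N B b μ) ∧
    ∫ q, blockMean (fun _ => (1 : ℝ)) (fun i s => ‖v i s‖ ^ 2) q ∂(blockLaw N B b μ) ≤ M := by
  have hi : ∀ i, Integrable (fun s => ‖v i s‖ ^ 2) μ := fun i =>
    (memLp_two_iff_integrable_sq_norm (hvm i)).1 (memLp_two_of_lintegral_sq_le (hvm i) (hv i))
  obtain ⟨h1, h2⟩ := integrable_integral_blockMean (b := b) hB1 hB hb (fun _ => 1) hi
  refine ⟨h1, h2.trans_le ?_⟩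
  have hN : (0 : ℝ) < N := by exact_mod_cast (by omega : 0 < N)
  rw [smul_eq_mul, inv_mul_le_iff₀ hN]
  refine (Finset.sum_le_card_nsmul _ _ M fun i _ => ?_).trans ?_
  · rw [one_smul]
    exact integral_sq_le_of_lintegral_sq_le hM (hvm i) (hv i)
  · simp

end Blocks

/-! ### One step of the variance-reduced estimators -/

section MSVR

lemma measurable_msvrUpdate {X S : Type*} [MeasurableSpace X] [MeasurableSpace S] {N b : ℕ}
    {φ φ' : X → S → ℝ} {u : X → ℝ} (hφ : Measurable (Function.uncurry φ))
    (hφ' : Measurable (Function.uncurry φ')) (hu : Measurable u) (γ : ℝ) (i : Fin N) :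
    Measurable fun q : X × (Finset (Fin N) × (Fin N → Fin b → S)) =>
      if i ∈ q.2.1 then msvrUpdate N q.2.1.card γ (u q.1) (batchMean (φ q.1) (q.2.2 i))
        (batchMean (φ' q.1) (q.2.2 i)) else u q.1 := by
  have h2 : Measurable fun q : X × (Finset (Fin N) × (Fin N → Fin b → S)) =>
      (q.1, q.2.2 i) := by fun_prop
  have h3 := (measurable_batchMean (b := b) hφ).comp h2
  have h4 := (measurable_batchMean (b := b) hφ').comp h2
  have h5 : Measurable fun q : X × (Finset (Fin N) × (Fin N → Fin b → S)) =>
      msvrWeight N q.2.1.card γ :=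
    (Measurable.of_discrete (f := fun s : Finset (Fin N) => msvrWeight N s.card γ)).comp
      measurable_snd.fst
  refine Measurable.ite (measurable_snd.fst
    (MeasurableSet.of_discrete (s := {s : Finset (Fin N) | i ∈ s}))) ?_ (hu.comp measurable_fst)
  unfold msvrUpdate
  exact (((hu.comp measurable_fst).const_mul _).add (h3.const_mul _)).add (h5.mul (h3.sub h4))

lemma lintegral_ite_prod {X Y : Type*} [MeasurableSpace X] [MeasurableSpace Y] {μ : Measure X}
    {π : Measure Y} [IsProbabilityMeasure π] {A : Set X} [DecidablePred (· ∈ A)]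
    (hA : MeasurableSet A) {ψ : Y → ℝ≥0∞} (hψ : Measurable ψ) (k : ℝ≥0∞) :
    ∫⁻ q : X × Y, (if q.1 ∈ A then ψ q.2 else k) ∂(μ.prod π)
      = μ A * ∫⁻ y, ψ y ∂π + μ Aᶜ * k := by
  have hm : Measurable fun q : X × Y => (if q.1 ∈ A then ψ q.2 else k) :=
    Measurable.ite (measurable_fst hA) (hψ.comp measurable_snd) measurable_const
  rw [lintegral_prod _ hm.aemeasurable]
  have h1 : ∀ x, ∫⁻ y, (if x ∈ A then ψ y else k) ∂π
      = A.indicator (fun _ => ∫⁻ y, ψ y ∂π) x + Aᶜ.indicator (fun _ => k) x := by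
    intro x
    by_cases hx : x ∈ A <;> simp [hx]
  simp only [h1]
  rw [lintegral_add_left (measurable_const.indicator hA), lintegral_indicator_const hA,
    lintegral_indicator_const hA.compl, mul_comm, mul_comm k]

/-- The choice of the correction weight cancels the cross terms `e * Δ` between the selected and
the unselected branch. Here `e` is the old error, `Δ` the drift of the tracked value, `p` the
probability of selection, and `w = (1 - p) / (p (1 - γ)) + 1 - γ` the correction weight. -/
lemma msvr_algebra {p γ w e Δ L2 σ2 b : ℝ} (hp : 0 < p) (hp1 : p ≤ 1) (hγ : 0 < γ)
    (hγ1 : γ ≤ 1 / 2) (hw : w = (1 - p) / (p * (1 - γ)) + 1 - γ) (hΔ : Δ ^ 2 ≤ L2)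
    (hb : 1 ≤ b) :
    p * (((1 - γ) * e + (w - (1 - γ)) * Δ) ^ 2 + (2 * γ ^ 2 * σ2 + 2 * w ^ 2 * L2) / b)
      + (1 - p) * (e - Δ) ^ 2
      ≤ (1 - p * γ / 2) ^ 2 * e ^ 2 + (2 * p * γ ^ 2 * σ2 / b + 13 / p * L2) := by
  have hL2 : 0 ≤ L2 := (sq_nonneg _).trans hΔ
  have hg : 0 < 1 - γ := by linarith
  set l := (1 - p) / (p * (1 - γ)) with hl
  have hl1 : p * l * (1 - γ) = 1 - p := by rw [hl]; field_simp
  have hl0 : 0 ≤ l := div_nonneg (by linarith) (by positivity)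
  have hl2 : p * l ≤ 2 * (1 - p) := by nlinarith [mul_nonneg hp.le hl0]
  have hwl : w - (1 - γ) = l := by rw [hw]; ring
  have hw0 : 0 ≤ w := by rw [hw]; linarith
  have hpw : p * w ≤ 2 := by
    have : p * w = p * l + p * (1 - γ) := by rw [hw]; ring
    nlinarith
  have hpw2 : (p * w) ^ 2 ≤ 4 := by nlinarith [mul_nonneg hp.le hw0]
  have hpl2 : (p * l) ^ 2 ≤ 4 := by nlinarith [mul_nonneg hp.le hl0]
  have t1 : p * (2 * w ^ 2 * L2 / b) ≤ 8 / p * L2 := by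
    have a1 : p * (2 * w ^ 2 * L2 / b) ≤ p * (2 * w ^ 2 * L2) :=
      mul_le_mul_of_nonneg_left (div_le_self (by positivity) hb) hp.le
    have a2 : p * (2 * w ^ 2 * L2) = 2 * (p * w) ^ 2 / p * L2 := by field_simp
    have a3 : 2 * (p * w) ^ 2 / p * L2 ≤ 8 / p * L2 := by
      gcongr; linarith
    linarith
  have t2 : (p * l ^ 2 + (1 - p)) * Δ ^ 2 ≤ 5 / p * L2 := by
    have a1 : p * l ^ 2 + (1 - p) ≤ 5 / p := by
      rw [le_div_iff₀ hp]; nlinarith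
    exact mul_le_mul a1 hΔ (sq_nonneg _) (by positivity)
  have t3 : (p * (1 - γ) ^ 2 + (1 - p)) * e ^ 2 ≤ (1 - p * γ / 2) ^ 2 * e ^ 2 := by
    refine mul_le_mul_of_nonneg_right ?_ (sq_nonneg _)
    nlinarith [mul_pos hp hγ, mul_nonneg (mul_pos hp hγ).le hg.le, sq_nonneg (p * γ)]
  have t4 : p * (((1 - γ) * e + (w - (1 - γ)) * Δ) ^ 2) + (1 - p) * (e - Δ) ^ 2
      = (p * (1 - γ) ^ 2 + (1 - p)) * e ^ 2 + (p * l ^ 2 + (1 - p)) * Δ ^ 2 := by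
    rw [hwl, ← hl1]; ring
  have t5 : p * ((2 * γ ^ 2 * σ2 + 2 * w ^ 2 * L2) / b)
      = 2 * p * γ ^ 2 * σ2 / b + p * (2 * w ^ 2 * L2 / b) := by ring
  have t6 : 8 / p * L2 + 5 / p * L2 = 13 / p * L2 := by ring
  rw [mul_add, t5]
  linarith

/-- The mean-square recursion of one variance-reduced estimator: the error of the updated estimator
for the value at `x` in terms of the error of the old one for the value at the previous point `y`.
The selected branch averages fresh samples, the unselected one only sees the drift of the value. -/
lemma lintegral_msvrUpdate_le {V S : Type*} [SeminormedAddCommGroup V] [MeasurableSpace S]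
    {μ : Measure S} [IsProbabilityMeasure μ] {N B b : ℕ} (hB1 : 1 ≤ B) (hB : B ≤ N) (hb : 1 ≤ b)
    {φ : V → S → ℝ} {L σ : ℝ≥0} (hm : ∀ x, Measurable (φ x)) (hi : ∀ x, Integrable (φ x) μ)
    (hL : ∀ x y, ∫⁻ z, ENNReal.ofReal ((φ x z - φ y z) ^ 2) ∂μ
      ≤ ENNReal.ofReal ((L : ℝ) ^ 2 * ‖x - y‖ ^ 2))
    (hσ : ∀ x, ∫⁻ z, ENNReal.ofReal ((φ x z - ∫ z, φ x z ∂μ) ^ 2) ∂μ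
      ≤ ENNReal.ofReal ((σ : ℝ) ^ 2))
    {γ : ℝ} (hγ : 0 < γ) (hγ1 : γ ≤ 1 / 2) (u : ℝ) (x y : V) (i : Fin N) :
    ∫⁻ q, ENNReal.ofReal (((if i ∈ q.1 then msvrUpdate N q.1.card γ u (batchMean (φ x) (q.2 i))
        (batchMean (φ y) (q.2 i)) else u) - ∫ z, φ x z ∂μ) ^ 2) ∂(blockLaw N B b μ)
      ≤ ENNReal.ofReal ((1 - (B / N : ℝ) * γ / 2) ^ 2 * (u - ∫ z, φ y z ∂μ) ^ 2
        + (2 * (B / N : ℝ) * γ ^ 2 * (σ : ℝ) ^ 2 / b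
          + 13 / (B / N : ℝ) * ((L : ℝ) ^ 2 * ‖x - y‖ ^ 2))) := by
  classical
  have := isProbabilityMeasure_subsetLaw hB
  have hBr : (1 : ℝ) ≤ B := by exact_mod_cast hB1
  have hBN : (B : ℝ) ≤ N := by exact_mod_cast hB
  have hbr : (1 : ℝ) ≤ b := by exact_mod_cast hb
  have hb0 : b ≠ 0 := by omega
  have hN0 : (0 : ℝ) < N := by linarith
  set p : ℝ := (B : ℝ) / N with hp
  have hp0 : 0 < p := by positivity
  have hp1 : p ≤ 1 := (div_le_one hN0).2 hBN
  set mx := ∫ z, φ x z ∂μ with hmx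
  set my := ∫ z, φ y z ∂μ with hmy
  set w := msvrWeight N B γ with hw
  have hwp : w = (1 - p) / (p * (1 - γ)) + 1 - γ := by
    rw [hw, msvrWeight, hp]
    have : (1 : ℝ) - γ ≠ 0 := by linarith
    field_simp
  have hw0 : 0 ≤ w := by
    rw [hwp]
    have : 0 ≤ (1 - p) / (p * (1 - γ)) :=
      div_nonneg (by linarith) (mul_nonneg hp0.le (by linarith))
    linarith
  -- the centred noise of one sample
  set ψ : S → ℝ := fun z => γ * (φ x z - mx) + w * ((φ x z - φ y z) - (mx - my)) with hψ
  have hΔm : MemLp (fun z => φ x z - φ y z) 2 μ :=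
    memLp_two_of_lintegral_sq_le ((hi x).sub (hi y)).aestronglyMeasurable
      (by simpa only [Real.norm_eq_abs, sq_abs] using hL x y)
  have hxm : MemLp (fun z => φ x z - mx) 2 μ :=
    memLp_two_of_lintegral_sq_le ((hi x).sub (integrable_const _)).aestronglyMeasurable
      (by simpa only [Real.norm_eq_abs, sq_abs] using hσ x)
  have hΔc : MemLp (fun z => (φ x z - φ y z) - (mx - my)) 2 μ := hΔm.sub (memLp_const _)
  have hψm : MemLp ψ 2 μ := (hxm.const_mul γ).add (hΔc.const_mul w)
  have hΔint : ∫ z, (φ x z - φ y z) ∂μ = mx - my := integral_sub (hi x) (hi y)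
  have hψ0 : ∫ z, ψ z ∂μ = 0 := by
    rw [hψ, integral_add ((hxm.integrable one_le_two).const_mul γ)
      ((hΔc.integrable one_le_two).const_mul w), integral_const_mul, integral_const_mul,
      integral_sub (hi x) (integrable_const _),
      integral_sub (hΔm.integrable one_le_two) (integrable_const _), hΔint]
    simp [hmx]
  have hΔ2 : ∫ z, (φ x z - φ y z) ^ 2 ∂μ ≤ (L : ℝ) ^ 2 * ‖x - y‖ ^ 2 := by
    have := integral_sq_le_of_lintegral_sq_le (f := fun z => φ x z - φ y z)
      (K := (L : ℝ) ^ 2 * ‖x - y‖ ^ 2) (by positivity) hΔm.aestronglyMeasurable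
      (by simpa only [Real.norm_eq_abs, sq_abs] using hL x y)
    simpa only [Real.norm_eq_abs, sq_abs] using this
  have hx2 : ∫ z, (φ x z - mx) ^ 2 ∂μ ≤ (σ : ℝ) ^ 2 := by
    have := integral_sq_le_of_lintegral_sq_le (f := fun z => φ x z - mx)
      (K := (σ : ℝ) ^ 2) (by positivity) hxm.aestronglyMeasurable
      (by simpa only [Real.norm_eq_abs, sq_abs] using hσ x)
    simpa only [Real.norm_eq_abs, sq_abs] using this
  have hΔc2 : ∫ z, ((φ x z - φ y z) - (mx - my)) ^ 2 ∂μ ≤ (L : ℝ) ^ 2 * ‖x - y‖ ^ 2 := by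
    have h1 := variance_eq_integral hΔm.aestronglyMeasurable.aemeasurable
    have h2 := variance_eq_sub hΔm
    rw [hΔint] at h1 h2
    simp only [Pi.pow_apply] at h2
    have := sq_nonneg (mx - my)
    linarith
  have hψ2 : ∫ z, ψ z ^ 2 ∂μ
      ≤ 2 * γ ^ 2 * (σ : ℝ) ^ 2 + 2 * w ^ 2 * ((L : ℝ) ^ 2 * ‖x - y‖ ^ 2) := by
    have h1 : ∀ z, ψ z ^ 2 ≤ 2 * γ ^ 2 * (φ x z - mx) ^ 2
        + 2 * w ^ 2 * ((φ x z - φ y z) - (mx - my)) ^ 2 := fun z => by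
      simp only [hψ]
      nlinarith [sq_nonneg (γ * (φ x z - mx) - w * ((φ x z - φ y z) - (mx - my)))]
    refine (integral_mono hψm.integrable_sq
      (Integrable.fun_add (hxm.integrable_sq.const_mul _) (hΔc.integrable_sq.const_mul _))
      h1).trans ?_
    rw [integral_add (hxm.integrable_sq.const_mul _) (hΔc.integrable_sq.const_mul _),
      integral_const_mul, integral_const_mul]
    gcongr
  have hΔs : (mx - my) ^ 2 ≤ (L : ℝ) ^ 2 * ‖x - y‖ ^ 2 := by
    rw [← hΔint]
    exact (sq_integral_le hΔm).trans hΔ2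
  set e := u - my with he
  set c := (1 - γ) * e + (w - (1 - γ)) * (mx - my) with hc
  have hψmeas : Measurable ψ :=
    (((hm x).sub_const mx).const_mul γ).add
      ((((hm x).sub (hm y)).sub_const (mx - my)).const_mul w)
  have hbm : Measurable fun z : Fin b → S => batchMean ψ z := by
    unfold batchMean
    exact Measurable.fun_const_smul
      (Finset.measurable_sum _ fun j _ => hψmeas.comp (measurable_pi_apply j)) (b : ℝ)⁻¹
  have hupd : ∀ z : Fin b → S,
      msvrUpdate N B γ u (batchMean (φ x) z) (batchMean (φ y) z) - mx = c + batchMean ψ z := by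
    intro z
    have : batchMean ψ z = γ * (batchMean (φ x) z - mx)
        + w * ((batchMean (φ x) z - batchMean (φ y) z) - (mx - my)) := by
      rw [hψ, batchMean_add, batchMean_const_mul, batchMean_const_mul, batchMean_sub,
        batchMean_sub, batchMean_sub, batchMean_const hb0, batchMean_const hb0]
    rw [msvrUpdate, ← hw, this, hc, he]
    ring
  set Ψ : (Fin b → S) → ℝ≥0∞ := fun z => ENNReal.ofReal ((c + batchMean ψ z) ^ 2) with hΨ
  have hΨm : Measurable Ψ := ((hbm.const_add c).pow_const 2).ennreal_ofReal
  have hstep : ∫⁻ q, ENNReal.ofReal (((if i ∈ q.1 then msvrUpdate N q.1.card γ u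
        (batchMean (φ x) (q.2 i)) (batchMean (φ y) (q.2 i)) else u) - mx) ^ 2)
        ∂(blockLaw N B b μ)
      = ∫⁻ q, (if q.1 ∈ {s : Finset (Fin N) | i ∈ s} then Ψ q.2
          else ENNReal.ofReal ((e - (mx - my)) ^ 2))
          ∂((subsetLaw N B).prod (Measure.pi fun _ : Fin b => μ)) := by
    rw [← (measurePreserving_block_eval (B := B) (b := b) (μ := μ) i).lintegral_comp
      (f := fun q => if q.1 ∈ {s : Finset (Fin N) | i ∈ s} then Ψ q.2
          else ENNReal.ofReal ((e - (mx - my)) ^ 2))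
      (Measurable.ite (measurable_fst (MeasurableSet.of_discrete)) (hΨm.comp measurable_snd)
        measurable_const)]
    refine lintegral_congr_ae ?_
    filter_upwards [ae_card_eq_block] with q hq
    by_cases h : i ∈ q.1
    · simp only [h, if_true, hq, hupd, hΨ]
    · simp only [h, if_false, he]
      congr 2; ring
  have hA : subsetLaw N B {s : Finset (Fin N) | i ∈ s} = ENNReal.ofReal p := by
    rw [hp, ← subsetLaw_real_mem hB1 hB i, ofReal_measureReal]
  have hAc : subsetLaw N B {s : Finset (Fin N) | i ∈ s}ᶜ = ENNReal.ofReal (1 - p) := by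
    rw [hp, ← subsetLaw_real_mem hB1 hB i, ← probReal_compl_eq_one_sub MeasurableSet.of_discrete,
      ofReal_measureReal]
  rw [hstep, lintegral_ite_prod MeasurableSet.of_discrete hΨm, hA, hAc]
  refine (add_le_add (mul_le_mul_right (lintegral_sq_add_batchMean_le hb0 hψm hψ0 hψ2 c) _)
    le_rfl).trans ?_
  rw [← ENNReal.ofReal_mul hp0.le, ← ENNReal.ofReal_mul (by linarith),
    ← ENNReal.ofReal_add (by positivity) (mul_nonneg (by linarith) (sq_nonneg _))]
  refine ENNReal.ofReal_le_ofReal ?_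
  exact msvr_algebra hp0 hp1 hγ hγ1 hwp hΔs hbr

end MSVR

/-! ### The penalized objective -/

namespace Problem

variable {d n m b₁ b₂ : ℕ} {Z W : Type*} [MeasurableSpace Z] [MeasurableSpace W]
  {P : Problem d n m Z W} {c : Moduli}

lemma Assumptions.gMean_lipschitz (hA : P.Assumptions c) (i : Fin n) :
    LipschitzWith c.Lg (P.gMean i) :=
  have := hA.ν_prob
  lipschitzWith_integral (hA.g_integrable i) (hA.g_meanSquareLipschitz i)

lemma Assumptions.continuous_Φ (hA : P.Assumptions c) (β : ℝ) : Continuous (P.Φ β) := by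
  have h1 : ∀ i, Continuous fun x => P.f i (P.gMean i x) := fun i =>
    (hA.f_lipschitz i).continuous.comp (hA.gMean_lipschitz i).continuous
  have h2 : ∀ k, Continuous fun x => hinge (P.hMean k x) := fun k =>
    hinge_lipschitz.continuous.comp (hA.h_lipschitz k).continuous
  unfold Problem.Φ Problem.F
  fun_prop

/-- The expectation of the search direction at the state `s`. -/
def meanDirection (P : Problem d n m Z W) (β : ℝ) (s : AlgState d n m) : Vec d :=
  (n : ℝ)⁻¹ • ∑ i, P.df i (s.u₁ i) • ∫ ζ, P.dg i s.x ζ ∂P.ν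
    + β • (m : ℝ)⁻¹ • ∑ k, P.dhinge (s.u₂ k) • ∫ ξ, P.dh k s.x ξ ∂P.τ

/-- A bound on the bias caused by evaluating the outer subgradients at the estimators instead of at
the inner function values. -/
def bias (P : Problem d n m Z W) (c : Moduli) (β : ℝ) (s : AlgState d n m) : ℝ :=
  (n : ℝ)⁻¹ * ∑ i, (2 * c.Lf * |s.u₁ i - P.gMean i s.x| + c.ρf * |s.u₁ i - P.gMean i s.x| ^ 2)
    + β * ((m : ℝ)⁻¹ * ∑ k, 2 * |s.u₂ k - P.hMean k s.x|)

/-- Half of the weak convexity modulus that the composite structure gives to `Φ`. -/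
def curvature (c : Moduli) (β : ℝ) : ℝ :=
  c.ρf * (c.Lg : ℝ) ^ 2 + c.Lf * c.ρg / 2 + β * (c.ρ1 / 2)

lemma bias_nonneg (P : Problem d n m Z W) (c : Moduli) {β : ℝ} (hβ : 0 ≤ β)
    (s : AlgState d n m) : 0 ≤ P.bias c β s := by
  have := c.ρf_pos
  unfold bias
  positivity

/-- The expected search direction is a subgradient of `Φ` up to the curvature and the bias. -/
lemma Assumptions.inner_meanDirection_le (hA : P.Assumptions c) {β : ℝ} (hβ : 0 ≤ β) (hn : 0 < n)
    (hm : 0 < m) (s : AlgState d n m) (y : Vec d) :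
    inner ℝ (P.meanDirection β s) (y - s.x)
      ≤ P.Φ β y - P.Φ β s.x + P.bias c β s + curvature c β * ‖y - s.x‖ ^ 2 := by
  have hn' : (0 : ℝ) < n := by exact_mod_cast hn
  have hm' : (0 : ℝ) < m := by exact_mod_cast hm
  set N := ‖y - s.x‖ ^ 2 with hN
  have h1 : ∀ i, P.df i (s.u₁ i) * inner ℝ (∫ ζ, P.dg i s.x ζ ∂P.ν) (y - s.x)
      ≤ (P.f i (P.gMean i y) - P.f i (P.gMean i s.x)
        + (2 * c.Lf * |s.u₁ i - P.gMean i s.x| + c.ρf * |s.u₁ i - P.gMean i s.x| ^ 2))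
        + (c.ρf * (c.Lg : ℝ) ^ 2 + c.Lf * c.ρg / 2) * N := fun i =>
    (chain_inexact (hA.f_lipschitz i) (hA.f_mono i) (hA.f_weaklyConvex i) c.ρf_pos.le
      c.ρg_pos.le (hA.df_mem i (s.u₁ i)) (hA.g_weaklyConvex i) (hA.gMean_lipschitz i)
      (hA.dg_mean_mem i s.x) y).trans_eq (by ring)
  have h2 : ∀ k, P.dhinge (s.u₂ k) * inner ℝ (∫ ξ, P.dh k s.x ξ ∂P.τ) (y - s.x)
      ≤ (hinge (P.hMean k y) - hinge (P.hMean k s.x) + 2 * |s.u₂ k - P.hMean k s.x|)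
        + (c.ρ1 / 2) * N := fun k =>
    (chain_inexact hinge_lipschitz hinge_mono hinge_weaklyConvex le_rfl c.ρ1_pos.le
      (hA.dhinge_mem (s.u₂ k)) (hA.h_weaklyConvex k) (hA.h_lipschitz k)
      (hA.dh_mean_mem k s.x) y).trans_eq (by simp [N])
  have h3 := mul_le_mul_of_nonneg_left (Finset.sum_le_sum fun i (_ : i ∈ Finset.univ) => h1 i)
    (inv_nonneg.2 hn'.le)
  have h4 := mul_le_mul_of_nonneg_left (mul_le_mul_of_nonneg_left
    (Finset.sum_le_sum fun k (_ : k ∈ Finset.univ) => h2 k) (inv_nonneg.2 hm'.le)) hβ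
  simp only [Finset.sum_add_distrib, Finset.sum_sub_distrib, Finset.sum_const, Finset.card_univ,
    Fintype.card_fin, nsmul_eq_mul] at h3 h4
  simp only [meanDirection, inner_add_left, inner_smul_left, sum_inner, conj_trivial]
  simp only [Problem.Φ, Problem.F, bias, curvature, Finset.sum_add_distrib]
  refine (add_le_add h3 h4).trans (le_of_eq ?_)
  field_simp
  ring

/-- Evaluated at exact estimators, the expected search direction supports `Φ`. -/
lemma Assumptions.hasSupports (hA : P.Assumptions c) {β : ℝ} (hβ : 0 ≤ β) (hn : 0 < n)
    (hm : 0 < m) : HasSupports (2 * curvature c β) (P.Φ β) := by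
  intro x
  let s : AlgState d n m := ⟨x, x, fun i => P.gMean i x, fun k => P.hMean k x⟩
  have hs : P.bias c β s = 0 := by simp [bias, s]
  refine ⟨P.meanDirection β s, fun y => ?_⟩
  have := hA.inner_meanDirection_le hβ hn hm s y
  rw [hs] at this
  change inner ℝ (P.meanDirection β s) (y - x)
    ≤ P.Φ β y - P.Φ β x + 0 + curvature c β * ‖y - x‖ ^ 2 at this
  linarith

/-- Under either hypothesis on the oracle, the stochastic subgradients have bounded second
moments. -/
lemma Assumptions.second_moments (hA : P.Assumptions c) {D : ℕ}
    (h : (d ≤ D ∧ P.SampleSubgradients) ∨ P.MomentBounds c) :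
    (∀ i x, ∫⁻ ζ, ENNReal.ofReal (‖P.dg i x ζ‖ ^ 2) ∂P.ν
      ≤ ENNReal.ofReal ((2 * D + 1) * (c.Lg : ℝ) ^ 2)) ∧
    (∀ k x, ∫⁻ ξ, ENNReal.ofReal (‖P.dh k x ξ‖ ^ 2) ∂P.τ
      ≤ ENNReal.ofReal ((2 * D + 1) * (c.Lh : ℝ) ^ 2)) := by
  have hD : (0 : ℝ) ≤ D := Nat.cast_nonneg D
  rcases h with ⟨hd, h1, h2⟩ | ⟨h1, h2⟩
  · have hd' : (d : ℝ) ≤ D := by exact_mod_cast hd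
    refine ⟨fun i x => ?_, fun k x => ?_⟩
    · refine (lintegral_norm_sq_subgradient_le (φ := P.g i)
        (fun x => (hA.g_meas i).comp measurable_prodMk_left)
        ((hA.dg_meas i).comp measurable_prodMk_left) (h1 i x)
        (hA.g_meanSquareLipschitz i)).trans (ENNReal.ofReal_le_ofReal ?_)
      gcongr; linarith
    · refine (lintegral_norm_sq_subgradient_le (φ := P.h k)
        (fun x => (hA.h_meas k).comp measurable_prodMk_left)
        ((hA.dh_meas k).comp measurable_prodMk_left) (h2 k x)
        (hA.h_meanSquareLipschitz k)).trans (ENNReal.ofReal_le_ofReal ?_)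
      gcongr; linarith
  · refine ⟨fun i x => (h1 i x).trans (ENNReal.ofReal_le_ofReal ?_),
      fun k x => (h2 k x).trans (ENNReal.ofReal_le_ofReal ?_)⟩
    · nlinarith [sq_nonneg (c.Lg : ℝ), mul_nonneg hD (sq_nonneg (c.Lg : ℝ))]
    · nlinarith [sq_nonneg (c.Lh : ℝ), mul_nonneg hD (sq_nonneg (c.Lh : ℝ))]

/-! ### One iteration of the algorithm -/

lemma Assumptions.isProbabilityMeasure_drawLaw (hA : P.Assumptions c) {B Bc : ℕ} (hB : B ≤ n)
    (hBc : Bc ≤ m) : IsProbabilityMeasure (P.drawLaw B Bc b₁ b₂) := by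
  have := hA.ν_prob
  have := hA.τ_prob
  have := isProbabilityMeasure_subsetLaw hB
  have := isProbabilityMeasure_subsetLaw hBc
  unfold drawLaw
  infer_instance

lemma Assumptions.measurePreserving_block₁ (hA : P.Assumptions c) {B Bc : ℕ}
    (hBc : Bc ≤ m) :
    MeasurePreserving (fun ω : Draw n m b₁ b₂ Z W => (ω.1.1, ω.2.1)) (P.drawLaw B Bc b₁ b₂)
      (blockLaw n B b₁ P.ν) := by
  have := hA.ν_prob
  have := hA.τ_prob
  have := isProbabilityMeasure_subsetLaw hBc
  exact measurePreserving_fst.prod measurePreserving_fst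

lemma Assumptions.measurePreserving_block₂ (hA : P.Assumptions c) {B Bc : ℕ}
    (hB : B ≤ n) :
    MeasurePreserving (fun ω : Draw n m b₁ b₂ Z W => (ω.1.2, ω.2.2)) (P.drawLaw B Bc b₁ b₂)
      (blockLaw m Bc b₂ P.τ) := by
  have := hA.ν_prob
  have := hA.τ_prob
  have := isProbabilityMeasure_subsetLaw hB
  exact measurePreserving_snd.prod measurePreserving_snd

lemma G₁_eq (P : Problem d n m Z W) (s : AlgState d n m) (ω : Draw n m b₁ b₂ Z W) :
    P.G₁ s ω = blockMean (fun i => P.df i (s.u₁ i)) (fun i => P.dg i s.x) (ω.1.1, ω.2.1) := rfl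

lemma G₂_eq (P : Problem d n m Z W) (β : ℝ) (s : AlgState d n m) (ω : Draw n m b₁ b₂ Z W) :
    P.G₂ β s ω
      = β • blockMean (fun k => P.dhinge (s.u₂ k)) (fun k => P.dh k s.x) (ω.1.2, ω.2.2) := by
  rw [G₂, blockMean, smul_smul, div_eq_mul_inv]

/-- The search direction is unbiased for `meanDirection`, and its second moment is bounded. The
bound goes through an integrable majorant `Q` of its square. -/
lemma Assumptions.direction_moments (hA : P.Assumptions c) {β : ℝ} {B Bc : ℕ}
    (hB1 : 1 ≤ B) (hB : B ≤ n) (hBc1 : 1 ≤ Bc) (hBc : Bc ≤ m) (hb₁ : 1 ≤ b₁) (hb₂ : 1 ≤ b₂)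
    {Mg Mh : ℝ} (hMg0 : 0 ≤ Mg) (hMh0 : 0 ≤ Mh)
    (hMg : ∀ i x, ∫⁻ ζ, ENNReal.ofReal (‖P.dg i x ζ‖ ^ 2) ∂P.ν ≤ ENNReal.ofReal Mg)
    (hMh : ∀ k x, ∫⁻ ξ, ENNReal.ofReal (‖P.dh k x ξ‖ ^ 2) ∂P.τ ≤ ENNReal.ofReal Mh)
    (s : AlgState d n m) :
    Integrable (fun ω => P.G₁ s ω + P.G₂ β s ω) (P.drawLaw B Bc b₁ b₂) ∧
    ∫ ω, (P.G₁ s ω + P.G₂ β s ω) ∂(P.drawLaw B Bc b₁ b₂) = P.meanDirection β s ∧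
    ∃ Q : Draw n m b₁ b₂ Z W → ℝ, Integrable Q (P.drawLaw B Bc b₁ b₂) ∧
      (∀ ω, ‖P.G₁ s ω + P.G₂ β s ω‖ ^ 2 ≤ Q ω) ∧
      ∫ ω, Q ω ∂(P.drawLaw B Bc b₁ b₂) ≤ 2 * (c.Lf : ℝ) ^ 2 * Mg + 2 * β ^ 2 * Mh := by
  have := hA.ν_prob
  have := hA.τ_prob
  have mp1 := hA.measurePreserving_block₁ (B := B) (b₁ := b₁) (b₂ := b₂) hBc
  have mp2 := hA.measurePreserving_block₂ (Bc := Bc) (b₁ := b₁) (b₂ := b₂) hB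
  obtain ⟨i1, e1⟩ := integrable_integral_blockMean (b := b₁) (μ := P.ν) hB1 hB (by omega)
    (fun i => P.df i (s.u₁ i)) (v := fun i => P.dg i s.x) fun i => hA.dg_integrable i s.x
  obtain ⟨i2, e2⟩ := integrable_integral_blockMean (b := b₂) (μ := P.τ) hBc1 hBc (by omega)
    (fun k => P.dhinge (s.u₂ k)) (v := fun k => P.dh k s.x) fun k => hA.dh_integrable k s.x
  obtain ⟨j1, f1⟩ := integral_blockMean_sq_le (b := b₁) (μ := P.ν) hB1 hB (by omega)
    (v := fun i => P.dg i s.x) hMg0 (fun i => (hA.dg_integrable i s.x).aestronglyMeasurable)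
    fun i => hMg i s.x
  obtain ⟨j2, f2⟩ := integral_blockMean_sq_le (b := b₂) (μ := P.τ) hBc1 hBc (by omega)
    (v := fun k => P.dh k s.x) hMh0 (fun k => (hA.dh_integrable k s.x).aestronglyMeasurable)
    fun k => hMh k s.x
  have transfer1 : ∀ {E : Type} [NormedAddCommGroup E] [NormedSpace ℝ E]
      (ψ : Finset (Fin n) × (Fin n → Fin b₁ → Z) → E), Integrable ψ (blockLaw n B b₁ P.ν) →
      ∫ ω : Draw n m b₁ b₂ Z W, ψ (ω.1.1, ω.2.1) ∂(P.drawLaw B Bc b₁ b₂)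
        = ∫ q, ψ q ∂(blockLaw n B b₁ P.ν) := by
    intro E _ _ ψ hψ
    rw [← mp1.map_eq, integral_map mp1.measurable.aemeasurable
      (by rw [mp1.map_eq]; exact hψ.aestronglyMeasurable)]
  have transfer2 : ∀ {E : Type} [NormedAddCommGroup E] [NormedSpace ℝ E]
      (ψ : Finset (Fin m) × (Fin m → Fin b₂ → W) → E), Integrable ψ (blockLaw m Bc b₂ P.τ) →
      ∫ ω : Draw n m b₁ b₂ Z W, ψ (ω.1.2, ω.2.2) ∂(P.drawLaw B Bc b₁ b₂)
        = ∫ q, ψ q ∂(blockLaw m Bc b₂ P.τ) := by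
    intro E _ _ ψ hψ
    rw [← mp2.map_eq, integral_map mp2.measurable.aemeasurable
      (by rw [mp2.map_eq]; exact hψ.aestronglyMeasurable)]
  have I1 := mp1.integrable_comp_of_integrable i1
  have I2 := (mp2.integrable_comp_of_integrable i2).smul β
  have J1 := (mp1.integrable_comp_of_integrable j1).const_mul (2 * (c.Lf : ℝ) ^ 2)
  have J2 := (mp2.integrable_comp_of_integrable j2).const_mul (2 * β ^ 2)
  simp only [G₁_eq, G₂_eq]
  refine ⟨I1.fun_add I2, ?_, _, J1.fun_add J2, fun ω => ?_, ?_⟩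
  · refine (integral_add I1 I2).trans ?_
    simp only [Pi.smul_apply, integral_smul, Function.comp_apply]
    rw [transfer1 _ i1, transfer2 _ i2, e1, e2]
    rfl
  · set A := blockMean (fun i => P.df i (s.u₁ i)) (fun i => P.dg i s.x) (ω.1.1, ω.2.1) with hAdef
    set A' := blockMean (fun k => P.dhinge (s.u₂ k)) (fun k => P.dh k s.x) (ω.1.2, ω.2.2)
    have k1 : ‖A‖ ^ 2 ≤ _ := norm_sq_blockMean_le (A := (c.Lf : ℝ))
      (fun i => subdiff_le_of_lipschitz (hA.f_lipschitz i) (hA.df_mem i (s.u₁ i)))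
      (fun i => P.dg i s.x) (ω.1.1, ω.2.1)
    have k2 : ‖A'‖ ^ 2 ≤ _ := norm_sq_blockMean_le (A := 1)
      (fun k => subdiff_le_of_lipschitz hinge_lipschitz (hA.dhinge_mem (s.u₂ k)))
      (fun k => P.dh k s.x) (ω.1.2, ω.2.2)
    have k3 : ‖A + β • A'‖ ^ 2 ≤ 2 * ‖A‖ ^ 2 + 2 * (β ^ 2 * ‖A'‖ ^ 2) := by
      have h1 := norm_add_le A (β • A')
      have h2 : ‖β • A'‖ ^ 2 = β ^ 2 * ‖A'‖ ^ 2 := by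
        rw [norm_smul, mul_pow, Real.norm_eq_abs, sq_abs]
      rw [← h2]
      nlinarith [norm_nonneg (A + β • A'), sq_nonneg (‖A‖ - ‖β • A'‖)]
    have k4 := mul_le_mul_of_nonneg_left k2 (sq_nonneg β)
    simp only [Function.comp_apply]
    nlinarith
  · rw [integral_add J1 J2, integral_const_mul, integral_const_mul]
    simp only [Function.comp_apply]
    rw [transfer1 _ j1, transfer2 _ j2]
    gcongr

/-- The expected squared length of one move. -/
lemma Assumptions.lintegral_move_le (hA : P.Assumptions c) {β γ η : ℝ} {B Bc : ℕ}
    (hB1 : 1 ≤ B) (hB : B ≤ n) (hBc1 : 1 ≤ Bc) (hBc : Bc ≤ m) (hb₁ : 1 ≤ b₁) (hb₂ : 1 ≤ b₂)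
    {Mg Mh : ℝ} (hMg0 : 0 ≤ Mg) (hMh0 : 0 ≤ Mh)
    (hMg : ∀ i x, ∫⁻ ζ, ENNReal.ofReal (‖P.dg i x ζ‖ ^ 2) ∂P.ν ≤ ENNReal.ofReal Mg)
    (hMh : ∀ k x, ∫⁻ ξ, ENNReal.ofReal (‖P.dh k x ξ‖ ^ 2) ∂P.τ ≤ ENNReal.ofReal Mh)
    (s : AlgState d n m) :
    ∫⁻ ω, ENNReal.ofReal (‖(P.step β γ γ η s ω).x - (P.step β γ γ η s ω).xPrev‖ ^ 2)
        ∂(P.drawLaw B Bc b₁ b₂)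
      ≤ ENNReal.ofReal (η ^ 2 * (2 * (c.Lf : ℝ) ^ 2 * Mg + 2 * β ^ 2 * Mh)) := by
  obtain ⟨-, -, Q, hQi, hQ, hQb⟩ := hA.direction_moments (β := β) hB1 hB hBc1 hBc hb₁ hb₂
    hMg0 hMh0 hMg hMh s
  have hQ0 : ∀ ω, 0 ≤ Q ω := fun ω => (sq_nonneg _).trans (hQ ω)
  calc _ ≤ ∫⁻ ω, ENNReal.ofReal (η ^ 2 * Q ω) ∂(P.drawLaw B Bc b₁ b₂) := by
        refine lintegral_mono fun ω => ENNReal.ofReal_le_ofReal ?_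
        have : (P.step β γ γ η s ω).x - (P.step β γ γ η s ω).xPrev
            = -(η • (P.G₁ s ω + P.G₂ β s ω)) := by simp [step]
        rw [this, norm_neg, norm_smul, mul_pow, Real.norm_eq_abs, sq_abs]
        exact mul_le_mul_of_nonneg_left (hQ ω) (sq_nonneg _)
    _ = ENNReal.ofReal (∫ ω, η ^ 2 * Q ω ∂(P.drawLaw B Bc b₁ b₂)) :=
        (ofReal_integral_eq_lintegral_ofReal (hQi.const_mul _)
          (Filter.Eventually.of_forall fun ω => mul_nonneg (sq_nonneg _) (hQ0 ω))).symm
    _ ≤ _ := by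
        rw [integral_const_mul]
        exact ENNReal.ofReal_le_ofReal (mul_le_mul_of_nonneg_left hQb (sq_nonneg _))

/-- The expected decrease of the Moreau envelope in one iteration. -/
lemma Assumptions.lintegral_envelope_le (hA : P.Assumptions c) {β γ η θ ℓ : ℝ} {B Bc : ℕ}
    (hβ : 0 ≤ β) (hη : 0 ≤ η) (hθ : 0 < θ) (hθc : curvature c β ≤ 1 / (4 * θ))
    (hℓ : ∀ x, ℓ ≤ P.Φ β x)
    (hB1 : 1 ≤ B) (hB : B ≤ n) (hBc1 : 1 ≤ Bc) (hBc : Bc ≤ m) (hb₁ : 1 ≤ b₁) (hb₂ : 1 ≤ b₂)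
    {Mg Mh : ℝ} (hMg0 : 0 ≤ Mg) (hMh0 : 0 ≤ Mh)
    (hMg : ∀ i x, ∫⁻ ζ, ENNReal.ofReal (‖P.dg i x ζ‖ ^ 2) ∂P.ν ≤ ENNReal.ofReal Mg)
    (hMh : ∀ k x, ∫⁻ ξ, ENNReal.ofReal (‖P.dh k x ξ‖ ^ 2) ∂P.τ ≤ ENNReal.ofReal Mh)
    {prox : Vec d → Vec d} (hprox : ∀ x, IsProx θ (P.Φ β) x (prox x))
    (s : AlgState d n m) :
    ∫⁻ ω, ENNReal.ofReal (moreauEnvelope θ (P.Φ β) (P.step β γ γ η s ω).x - ℓ)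
        ∂(P.drawLaw B Bc b₁ b₂)
        + ENNReal.ofReal (η / 4 * ‖θ⁻¹ • (s.x - prox s.x)‖ ^ 2)
      ≤ ENNReal.ofReal (moreauEnvelope θ (P.Φ β) s.x - ℓ) + ENNReal.ofReal (η / θ * P.bias c β s
        + η ^ 2 / (2 * θ) * (2 * (c.Lf : ℝ) ^ 2 * Mg + 2 * β ^ 2 * Mh)) := by
  have := hA.isProbabilityMeasure_drawLaw (b₁ := b₁) (b₂ := b₂) hB hBc
  obtain ⟨hGi, hGe, Q, hQi, hQ, hQb⟩ := hA.direction_moments (β := β) hB1 hB hBc1 hBc hb₁ hb₂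
    hMg0 hMh0 hMg hMh s
  set M2 := 2 * (c.Lf : ℝ) ^ 2 * Mg + 2 * β ^ 2 * Mh with hM2
  have hM20 : 0 ≤ M2 := by positivity
  set E := moreauEnvelope θ (P.Φ β) with hE
  set p := prox s.x with hp
  set G : Draw n m b₁ b₂ Z W → Vec d := fun ω => P.G₁ s ω + P.G₂ β s ω with hG
  have hEl : ∀ x, ℓ ≤ E x := fun x => by
    rw [hE, (hprox x).moreauEnvelope_eq]
    have : 0 ≤ 1 / (2 * θ) * ‖prox x - x‖ ^ 2 := by positivity
    linarith [hℓ (prox x)]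
  set R : Draw n m b₁ b₂ Z W → ℝ := fun ω =>
    (E s.x - ℓ) + η / θ * inner ℝ (p - s.x) (G ω) + η ^ 2 / (2 * θ) * Q ω with hR
  have hstep : ∀ ω, E (P.step β γ γ η s ω).x - ℓ ≤ R ω := by
    intro ω
    have h1 := (hprox (P.step β γ γ η s ω).x).moreauEnvelope_le p
    have h2 : p - (P.step β γ γ η s ω).x = (p - s.x) + η • G ω := by
      simp only [step, hG]; abel
    rw [h2, norm_add_sq_real, inner_smul_right, norm_smul, mul_pow, Real.norm_eq_abs, sq_abs]
      at h1
    have h3 : E s.x = P.Φ β p + 1 / (2 * θ) * ‖p - s.x‖ ^ 2 := (hprox s.x).moreauEnvelope_eq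
    have h4 : η ^ 2 / (2 * θ) * ‖G ω‖ ^ 2 ≤ η ^ 2 / (2 * θ) * Q ω := by
      gcongr; exact hQ ω
    have h5 : 1 / (2 * θ) * (‖p - s.x‖ ^ 2 + 2 * (η * inner ℝ (p - s.x) (G ω))
        + η ^ 2 * ‖G ω‖ ^ 2) = 1 / (2 * θ) * ‖p - s.x‖ ^ 2 + η / θ * inner ℝ (p - s.x) (G ω)
          + η ^ 2 / (2 * θ) * ‖G ω‖ ^ 2 := by field_simp
    rw [h5] at h1
    simp only [hR]
    linarith
  have hInt1 : Integrable (fun ω => inner ℝ (p - s.x) (G ω)) (P.drawLaw B Bc b₁ b₂) :=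
    hGi.const_inner _
  have hInt2 : Integrable (fun ω => (E s.x - ℓ) + η / θ * inner ℝ (p - s.x) (G ω))
      (P.drawLaw B Bc b₁ b₂) := (integrable_const _).fun_add (hInt1.const_mul _)
  have hRi : Integrable R (P.drawLaw B Bc b₁ b₂) := hInt2.fun_add (hQi.const_mul _)
  have hR0 : ∀ ω, 0 ≤ R ω := fun ω => (sub_nonneg.2 (hEl _)).trans (hstep ω)
  have hRe : ∫ ω, R ω ∂(P.drawLaw B Bc b₁ b₂) ≤ (E s.x - ℓ)
      + η / θ * inner ℝ (p - s.x) (P.meanDirection β s) + η ^ 2 / (2 * θ) * M2 := by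
    simp only [hR]
    rw [integral_add hInt2 (hQi.const_mul _), integral_add (integrable_const _)
      (hInt1.const_mul _), integral_const_mul, integral_const_mul, integral_inner hGi, hGe]
    simp only [integral_const, probReal_univ, one_smul]
    gcongr
  have hdesc := hA.inner_meanDirection_le hβ (by omega) (by omega) s p
  have hmin : P.Φ β p + 1 / (2 * θ) * ‖p - s.x‖ ^ 2 ≤ P.Φ β s.x := by
    simpa using hprox s.x s.x
  have hgrad : ‖θ⁻¹ • (s.x - p)‖ ^ 2 = θ⁻¹ ^ 2 * ‖p - s.x‖ ^ 2 := by
    rw [norm_smul, mul_pow, norm_inv, Real.norm_of_nonneg hθ.le, norm_sub_rev]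
  have hcurv : curvature c β * ‖p - s.x‖ ^ 2 ≤ 1 / (4 * θ) * ‖p - s.x‖ ^ 2 := by gcongr
  have hin : inner ℝ (p - s.x) (P.meanDirection β s)
      ≤ P.bias c β s - 1 / (4 * θ) * ‖p - s.x‖ ^ 2 := by
    rw [real_inner_comm]
    have : 1 / (2 * θ) * ‖p - s.x‖ ^ 2 = 2 * (1 / (4 * θ) * ‖p - s.x‖ ^ 2) := by
      field_simp; ring
    linarith
  have hfin : ∫ ω, R ω ∂(P.drawLaw B Bc b₁ b₂) + η / 4 * ‖θ⁻¹ • (s.x - p)‖ ^ 2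
      ≤ (E s.x - ℓ) + (η / θ * P.bias c β s + η ^ 2 / (2 * θ) * M2) := by
    have h1 := mul_le_mul_of_nonneg_left hin (by positivity : 0 ≤ η / θ)
    have h2 : η / θ * (1 / (4 * θ) * ‖p - s.x‖ ^ 2) = η / 4 * (θ⁻¹ ^ 2 * ‖p - s.x‖ ^ 2) := by
      field_simp
    rw [mul_sub, h2] at h1
    rw [hgrad]
    linarith
  have hb0 := P.bias_nonneg c hβ s
  calc _ ≤ ENNReal.ofReal (∫ ω, R ω ∂(P.drawLaw B Bc b₁ b₂))
        + ENNReal.ofReal (η / 4 * ‖θ⁻¹ • (s.x - p)‖ ^ 2) := by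
        gcongr
        rw [ofReal_integral_eq_lintegral_ofReal hRi (Filter.Eventually.of_forall hR0)]
        exact lintegral_mono fun ω => ENNReal.ofReal_le_ofReal (hstep ω)
    _ ≤ _ := by
        rw [← ENNReal.ofReal_add (integral_nonneg hR0) (by positivity),
          ← ENNReal.ofReal_add (sub_nonneg.2 (hEl _)) (by positivity)]
        exact ENNReal.ofReal_le_ofReal hfin

lemma measurable_msvrUpdate_block {S : Type*} [MeasurableSpace S] {N b : ℕ} {φ φ' : S → ℝ}
    (hφ : Measurable φ) (hφ' : Measurable φ') (γ u : ℝ) (i : Fin N) :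
    Measurable fun q : Finset (Fin N) × (Fin N → Fin b → S) =>
      if i ∈ q.1 then msvrUpdate N q.1.card γ u (batchMean φ (q.2 i)) (batchMean φ' (q.2 i))
      else u :=
  (measurable_msvrUpdate (X := Unit) (φ := fun _ => φ) (φ' := fun _ => φ') (u := fun _ => u)
    (hφ.comp measurable_snd) (hφ'.comp measurable_snd) measurable_const γ i).comp
    ((measurable_const (a := ())).prodMk measurable_id)

/-- The estimation error is measured at `xPrev` of the state, which is the point whose mini-batch
entered the last update. -/
lemma Assumptions.lintegral_u₁_le (hA : P.Assumptions c) {β γ η : ℝ} {B Bc : ℕ}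
    (hB1 : 1 ≤ B) (hB : B ≤ n) (hBc : Bc ≤ m) (hb₁ : 1 ≤ b₁)
    (hγ : 0 < γ) (hγ1 : γ ≤ 1 / 2) (s : AlgState d n m) (i : Fin n) :
    ∫⁻ ω, ENNReal.ofReal (((P.step β γ γ η s ω).u₁ i
        - P.gMean i (P.step β γ γ η s ω).xPrev) ^ 2) ∂(P.drawLaw B Bc b₁ b₂)
      ≤ ENNReal.ofReal ((1 - (B / n : ℝ) * γ / 2) ^ 2 * (s.u₁ i - P.gMean i s.xPrev) ^ 2
        + (2 * (B / n : ℝ) * γ ^ 2 * (c.σg : ℝ) ^ 2 / b₁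
          + 13 / (B / n : ℝ) * ((c.Lg : ℝ) ^ 2 * ‖s.x - s.xPrev‖ ^ 2))) := by
  have := hA.ν_prob
  have hgm : ∀ x, Measurable (P.g i x) := fun x => (hA.g_meas i).comp measurable_prodMk_left
  refine (le_of_eq ?_).trans (lintegral_msvrUpdate_le hB1 hB hb₁ hgm (hA.g_integrable i)
    (hA.g_meanSquareLipschitz i) (hA.g_variance i) hγ hγ1 (s.u₁ i) s.x s.xPrev i)
  rw [← (hA.measurePreserving_block₁ (B := B) (b₁ := b₁) (b₂ := b₂) hBc).lintegral_comp
    (((measurable_msvrUpdate_block (hgm s.x) (hgm s.xPrev) γ (s.u₁ i) i).sub_const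
      _).pow_const 2).ennreal_ofReal]
  rfl

lemma Assumptions.lintegral_u₂_le (hA : P.Assumptions c) {β γ η : ℝ} {B Bc : ℕ}
    (hB : B ≤ n) (hBc1 : 1 ≤ Bc) (hBc : Bc ≤ m) (hb₂ : 1 ≤ b₂)
    (hγ : 0 < γ) (hγ1 : γ ≤ 1 / 2) (s : AlgState d n m) (k : Fin m) :
    ∫⁻ ω, ENNReal.ofReal (((P.step β γ γ η s ω).u₂ k
        - P.hMean k (P.step β γ γ η s ω).xPrev) ^ 2) ∂(P.drawLaw B Bc b₁ b₂)
      ≤ ENNReal.ofReal ((1 - (Bc / m : ℝ) * γ / 2) ^ 2 * (s.u₂ k - P.hMean k s.xPrev) ^ 2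
        + (2 * (Bc / m : ℝ) * γ ^ 2 * (c.σh : ℝ) ^ 2 / b₂
          + 13 / (Bc / m : ℝ) * ((c.Lh : ℝ) ^ 2 * ‖s.x - s.xPrev‖ ^ 2))) := by
  have := hA.τ_prob
  have hgm : ∀ x, Measurable (P.h k x) := fun x => (hA.h_meas k).comp measurable_prodMk_left
  refine (le_of_eq ?_).trans (lintegral_msvrUpdate_le hBc1 hBc hb₂ hgm (hA.h_integrable k)
    (hA.h_meanSquareLipschitz k) (hA.h_variance k) hγ hγ1 (s.u₂ k) s.x s.xPrev k)
  rw [← (hA.measurePreserving_block₂ (Bc := Bc) (b₁ := b₁) (b₂ := b₂) hB).lintegral_comp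
    (((measurable_msvrUpdate_block (hgm s.x) (hgm s.xPrev) γ (s.u₂ k) k).sub_const
      _).pow_const 2).ennreal_ofReal]
  rfl

end Problem

/-! ### The law of the state of the algorithm -/

namespace AlgState

variable {d n m : ℕ}

/-- The components of a state as a tuple. -/
def toTuple (s : AlgState d n m) : (Vec d × Vec d) × ((Fin n → ℝ) × (Fin m → ℝ)) :=
  ((s.xPrev, s.x), (s.u₁, s.u₂))

/-- The σ-algebra generated by the components. -/
instance : MeasurableSpace (AlgState d n m) := MeasurableSpace.comap toTuple inferInstance

lemma measurable_toTuple : Measurable (toTuple : AlgState d n m → _) := comap_measurable _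

@[fun_prop]
lemma measurable_xPrev : Measurable (xPrev : AlgState d n m → _) :=
  measurable_toTuple.fst.fst

@[fun_prop]
lemma measurable_x : Measurable (x : AlgState d n m → _) :=
  measurable_toTuple.fst.snd

@[fun_prop]
lemma measurable_u₁ : Measurable (u₁ : AlgState d n m → _) :=
  measurable_toTuple.snd.fst

@[fun_prop]
lemma measurable_u₂ : Measurable (u₂ : AlgState d n m → _) :=
  measurable_toTuple.snd.snd

lemma measurable_of_components {X : Type*} [MeasurableSpace X] {f : X → AlgState d n m}
    (h1 : Measurable fun q => (f q).xPrev) (h2 : Measurable fun q => (f q).x)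
    (h3 : Measurable fun q => (f q).u₁) (h4 : Measurable fun q => (f q).u₂) : Measurable f :=
  measurable_comap_iff.2 ((h1.prodMk h2).prodMk (h3.prodMk h4))

end AlgState

lemma measurable_blockMean {X S V : Type*} [MeasurableSpace X] [MeasurableSpace S]
    [NormedAddCommGroup V] [NormedSpace ℝ V] [MeasurableSpace V] [BorelSpace V]
    [SecondCountableTopology V] {N b : ℕ} {a : X → Fin N → ℝ} {v : Fin N → X → S → V}
    (ha : ∀ i, Measurable fun q => a q i) (hv : ∀ i, Measurable (Function.uncurry (v i))) :
    Measurable fun q : X × (Finset (Fin N) × (Fin N → Fin b → S)) =>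
      blockMean (a q.1) (fun i => v i q.1) q.2 := by
  have h1 : ∀ i, Measurable fun q : X × (Finset (Fin N) × (Fin N → Fin b → S)) =>
      a q.1 i • batchMean (v i q.1) (q.2.2 i) := fun i => by
    have h2 : Measurable fun q : X × (Finset (Fin N) × (Fin N → Fin b → S)) =>
      (q.1, q.2.2 i) := by fun_prop
    exact ((ha i).comp measurable_fst).smul ((measurable_batchMean (hv i)).comp h2)
  have h3 : Measurable fun q : X × (Finset (Fin N) × (Fin N → Fin b → S)) =>
      (q.2.1.card : ℝ)⁻¹ :=
    (Measurable.of_discrete (f := fun s : Finset (Fin N) => (s.card : ℝ)⁻¹)).comp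
      measurable_snd.fst
  refine h3.smul ?_
  have h4 : ∀ q : X × (Finset (Fin N) × (Fin N → Fin b → S)),
      ∑ i ∈ q.2.1, a q.1 i • batchMean (v i q.1) (q.2.2 i)
        = ∑ i, if i ∈ q.2.1 then a q.1 i • batchMean (v i q.1) (q.2.2 i) else 0 := fun q => by
    rw [Finset.sum_ite_mem, Finset.univ_inter]
  simp only [h4]
  refine Finset.measurable_sum _ fun i _ => Measurable.ite ?_ (h1 i) measurable_const
  exact measurable_snd.fst (MeasurableSet.of_discrete (s := {s : Finset (Fin N) | i ∈ s}))

namespace Problem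

variable {d n m b₁ b₂ : ℕ} {Z W : Type*} [MeasurableSpace Z] [MeasurableSpace W]
  {P : Problem d n m Z W} {c : Moduli}

lemma Assumptions.measurable_step (hA : P.Assumptions c) (β γ η : ℝ) :
    Measurable fun q : AlgState d n m × Draw n m b₁ b₂ Z W => P.step β γ γ η q.1 q.2 := by
  have hdf : ∀ i, Measurable (P.df i) := fun i =>
    measurable_of_mem_subdiff (hA.f_weaklyConvex i) (hA.df_mem i)
  have hdh : Measurable P.dhinge := measurable_of_mem_subdiff hinge_weaklyConvex hA.dhinge_mem
  have p1 : Measurable fun q : AlgState d n m × Draw n m b₁ b₂ Z W =>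
      (q.1, (q.2.1.1, q.2.2.1)) := by fun_prop
  have p2 : Measurable fun q : AlgState d n m × Draw n m b₁ b₂ Z W =>
      (q.1, (q.2.1.2, q.2.2.2)) := by fun_prop
  have g1 := (measurable_blockMean (b := b₁)
    (a := fun (s : AlgState d n m) i => P.df i (s.u₁ i)) (v := fun i s => P.dg i s.x)
    (fun i => (hdf i).comp ((measurable_pi_apply i).comp AlgState.measurable_u₁))
    (fun i => (hA.dg_meas i).comp
      ((AlgState.measurable_x.comp measurable_fst).prodMk measurable_snd))).comp p1
  have g2 := (measurable_blockMean (b := b₂)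
    (a := fun (s : AlgState d n m) k => P.dhinge (s.u₂ k)) (v := fun k s => P.dh k s.x)
    (fun k => hdh.comp ((measurable_pi_apply k).comp AlgState.measurable_u₂))
    (fun k => (hA.dh_meas k).comp
      ((AlgState.measurable_x.comp measurable_fst).prodMk measurable_snd))).comp p2
  refine AlgState.measurable_of_components (AlgState.measurable_x.comp measurable_fst) ?_ ?_ ?_
  · simp only [step, G₁_eq, G₂_eq]
    exact (AlgState.measurable_x.comp measurable_fst).sub
      ((g1.add (g2.const_smul β)).const_smul η)
  · refine measurable_pi_iff.2 fun i => ?_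
    exact (measurable_msvrUpdate (b := b₁) (N := n) (φ := fun s : AlgState d n m => P.g i s.x)
      (φ' := fun s => P.g i s.xPrev) (u := fun s => s.u₁ i)
      ((hA.g_meas i).comp ((AlgState.measurable_x.comp measurable_fst).prodMk measurable_snd))
      ((hA.g_meas i).comp ((AlgState.measurable_xPrev.comp measurable_fst).prodMk measurable_snd))
      ((measurable_pi_apply i).comp AlgState.measurable_u₁) γ i).comp p1
  · refine measurable_pi_iff.2 fun k => ?_
    exact (measurable_msvrUpdate (b := b₂) (N := m) (φ := fun s : AlgState d n m => P.h k s.x)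
      (φ' := fun s => P.h k s.xPrev) (u := fun s => s.u₂ k)
      ((hA.h_meas k).comp ((AlgState.measurable_x.comp measurable_fst).prodMk measurable_snd))
      ((hA.h_meas k).comp ((AlgState.measurable_xPrev.comp measurable_fst).prodMk measurable_snd))
      ((measurable_pi_apply k).comp AlgState.measurable_u₂) γ k).comp p2

lemma Assumptions.measurable_run (hA : P.Assumptions c) (β γ η : ℝ) (x₀ : Vec d)
    (u₁ : Fin n → ℝ) (u₂ : Fin m → ℝ) (t : ℕ) :
    Measurable fun ω : ℕ → Draw n m b₁ b₂ Z W => P.run β γ γ η x₀ u₁ u₂ ω t := by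
  induction t with
  | zero => exact measurable_const
  | succ t ih => exact (hA.measurable_step β γ η).comp (ih.prodMk (measurable_pi_apply t))

lemma run_congr {β γ η : ℝ} {x₀ : Vec d} {u₁ : Fin n → ℝ} {u₂ : Fin m → ℝ}
    {ω ω' : ℕ → Draw n m b₁ b₂ Z W} {t : ℕ} (h : ∀ i < t, ω i = ω' i) :
    P.run β γ γ η x₀ u₁ u₂ ω t = P.run β γ γ η x₀ u₁ u₂ ω' t := by
  induction t with
  | zero => rfl
  | succ t ih =>
    rw [run, run, ih fun i hi => h i (by omega), h t (by omega)]

/-- The law of the state after `t` iterations, as a Markov chain driven by independent draws. -/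
def stateLaw (P : Problem d n m Z W) (β γ η : ℝ) (B Bc b₁ b₂ : ℕ) (s₀ : AlgState d n m) :
    ℕ → Measure (AlgState d n m)
  | 0 => Measure.dirac s₀
  | t + 1 => ((stateLaw P β γ η B Bc b₁ b₂ s₀ t).prod (P.drawLaw B Bc b₁ b₂)).map
      fun q => P.step β γ γ η q.1 q.2

lemma Assumptions.isProbabilityMeasure_stateLaw (hA : P.Assumptions c) {B Bc : ℕ} (hB : B ≤ n)
    (hBc : Bc ≤ m) (β γ η : ℝ) (s₀ : AlgState d n m) (t : ℕ) :
    IsProbabilityMeasure (P.stateLaw β γ η B Bc b₁ b₂ s₀ t) := by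
  have := hA.isProbabilityMeasure_drawLaw (b₁ := b₁) (b₂ := b₂) hB hBc
  induction t with
  | zero => exact Measure.dirac.isProbabilityMeasure
  | succ t ih =>
    exact Measure.isProbabilityMeasure_map (hA.measurable_step β γ η).aemeasurable

/-- A bound on the conditional expectation after one iteration integrates along the chain. -/
lemma Assumptions.lintegral_stateLaw_succ_le (hA : P.Assumptions c) {B Bc : ℕ} (hB : B ≤ n)
    (hBc : Bc ≤ m) {β γ η : ℝ} {s₀ : AlgState d n m} (t : ℕ) {ψ Ξ : AlgState d n m → ℝ≥0∞}
    (hψ : Measurable ψ)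
    (h : ∀ s, ∫⁻ ω, ψ (P.step β γ γ η s ω) ∂(P.drawLaw B Bc b₁ b₂) ≤ Ξ s) :
    ∫⁻ s, ψ s ∂(P.stateLaw β γ η B Bc b₁ b₂ s₀ (t + 1))
      ≤ ∫⁻ s, Ξ s ∂(P.stateLaw β γ η B Bc b₁ b₂ s₀ t) := by
  have := hA.isProbabilityMeasure_drawLaw (b₁ := b₁) (b₂ := b₂) hB hBc
  have hm := hA.measurable_step (b₁ := b₁) (b₂ := b₂) β γ η
  rw [stateLaw, lintegral_map hψ hm,
    lintegral_prod (fun q => ψ (P.step β γ γ η q.1 q.2)) (hψ.comp hm).aemeasurable]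
  exact lintegral_mono h

/-- Along independent draws, the state of the algorithm is distributed as the Markov chain: the
state at time `t` depends on the draws before `t` only, hence is independent of the draw at `t`. -/
lemma Assumptions.map_run (hA : P.Assumptions c) {B Bc : ℕ} (hB : B ≤ n) (hBc : Bc ≤ m)
    (β γ η : ℝ) (x₀ : Vec d) (u₁ : Fin n → ℝ) (u₂ : Fin m → ℝ) {Ω : Type*} [MeasurableSpace Ω]
    {Pr : Measure Ω} [IsProbabilityMeasure Pr] {ω : ℕ → Ω → Draw n m b₁ b₂ Z W}
    (hω : ∀ t, HasLaw (ω t) (P.drawLaw B Bc b₁ b₂) Pr) (hi : iIndepFun ω Pr) (t : ℕ) :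
    Pr.map (fun o => P.run β γ γ η x₀ u₁ u₂ (fun t => ω t o) t)
      = P.stateLaw β γ η B Bc b₁ b₂ ⟨x₀, x₀, u₁, u₂⟩ t := by
  classical
  have hpath : AEMeasurable (fun o t => ω t o) Pr :=
    aemeasurable_pi_iff.2 fun t => (hω t).aemeasurable
  have hrun : ∀ t, AEMeasurable (fun o => P.run β γ γ η x₀ u₁ u₂ (fun t => ω t o) t) Pr :=
    fun t => (hA.measurable_run β γ η x₀ u₁ u₂ t).comp_aemeasurable hpath
  induction t with
  | zero =>
    simp [run, stateLaw]
  | succ t ih =>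
    have := hA.isProbabilityMeasure_drawLaw (b₁ := b₁) (b₂ := b₂) hB hBc
    obtain ⟨w₀⟩ : Nonempty (Draw n m b₁ b₂ Z W) :=
      nonempty_of_isProbabilityMeasure (P.drawLaw B Bc b₁ b₂)
    let pad : (Finset.range t → Draw n m b₁ b₂ Z W) → ℕ → Draw n m b₁ b₂ Z W := fun z i =>
      if h : i ∈ Finset.range t then z ⟨i, h⟩ else w₀
    have hpad : Measurable pad := by
      refine measurable_pi_iff.2 fun i => ?_
      by_cases h : i ∈ Finset.range t
      · simp only [pad, h, dite_true]; exact measurable_pi_apply _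
      · simp only [pad, h, dite_false]; exact measurable_const
    have hind := hi.indepFun_finset₀ (Finset.range t) {t} (by simp) fun t => (hω t).aemeasurable
    have hind2 := hind.comp ((hA.measurable_run β γ η x₀ u₁ u₂ t).comp hpad)
      (measurable_pi_apply (⟨t, Finset.mem_singleton_self t⟩ : ({t} : Finset ℕ)))
    have e1 : ((fun ω => P.run β γ γ η x₀ u₁ u₂ ω t) ∘ pad) ∘
        (fun o (i : Finset.range t) => ω i o)
        = fun o => P.run β γ γ η x₀ u₁ u₂ (fun t => ω t o) t := by
      funext o
      refine run_congr fun i hi => ?_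
      simp [pad, hi]
    have hind3 : IndepFun (fun o => P.run β γ γ η x₀ u₁ u₂ (fun t => ω t o) t) (ω t) Pr := by
      rw [← e1]; exact hind2
    rw [stateLaw, ← ih, ← (hω t).map_eq,
      ← (indepFun_iff_map_prod_eq_prod_map_map (hrun t) (hω t).aemeasurable).1 hind3,
      AEMeasurable.map_map_of_aemeasurable (hA.measurable_step β γ η).aemeasurable
        ((hrun t).prodMk (hω t).aemeasurable)]
    rfl

lemma lintegral_uniformOn_finset {s : Finset ℕ} (f : ℕ → ℝ≥0∞) :
    ∫⁻ t, f t ∂(uniformOn (s : Set ℕ)) = (s.card : ℝ≥0∞)⁻¹ * ∑ t ∈ s, f t := by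
  rw [uniformOn, ProbabilityTheory.cond, lintegral_smul_measure, lintegral_finset]
  simp

/-- The expectation at an independent uniformly random time is the average over the times. -/
lemma Assumptions.lintegral_run_uniform (hA : P.Assumptions c) {B Bc : ℕ} (hB : B ≤ n)
    (hBc : Bc ≤ m)
    (β γ η : ℝ) (x₀ : Vec d) (u₁ : Fin n → ℝ) (u₂ : Fin m → ℝ) {Ω : Type*} [MeasurableSpace Ω]
    {Pr : Measure Ω} [IsProbabilityMeasure Pr] {ω : ℕ → Ω → Draw n m b₁ b₂ Z W} {tHat : Ω → ℕ}
    (hω : ∀ t, HasLaw (ω t) (P.drawLaw B Bc b₁ b₂) Pr) (hi : iIndepFun ω Pr) {T : ℕ}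
    (ht : HasLaw tHat (uniformOn (Set.Icc 1 T)) Pr) (hti : IndepFun tHat (fun o t => ω t o) Pr)
    {ψ : AlgState d n m → ℝ≥0∞} (hψ : Measurable ψ) :
    ∫⁻ o, ψ (P.run β γ γ η x₀ u₁ u₂ (fun t => ω t o) (tHat o)) ∂Pr
      = (T : ℝ≥0∞)⁻¹ * ∑ t ∈ Finset.Icc 1 T,
        ∫⁻ s, ψ s ∂(P.stateLaw β γ η B Bc b₁ b₂ ⟨x₀, x₀, u₁, u₂⟩ t) := by
  have hpath : AEMeasurable (fun o t => ω t o) Pr :=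
    aemeasurable_pi_iff.2 fun t => (hω t).aemeasurable
  have hrun := fun t => hA.measurable_run (b₁ := b₁) (b₂ := b₂) β γ η x₀ u₁ u₂ t
  let H : ℕ × (ℕ → Draw n m b₁ b₂ Z W) → ℝ≥0∞ := fun q =>
    ψ (P.run β γ γ η x₀ u₁ u₂ q.2 q.1)
  have hH : Measurable H := measurable_from_prod_countable_right fun t => hψ.comp (hrun t)
  have h1 : ∫⁻ o, ψ (P.run β γ γ η x₀ u₁ u₂ (fun t => ω t o) (tHat o)) ∂Pr
      = ∫⁻ q, H q ∂(Pr.map fun o => (tHat o, fun t => ω t o)) :=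
    (lintegral_map' hH.aemeasurable (ht.aemeasurable.prodMk hpath)).symm
  rw [h1, (indepFun_iff_map_prod_eq_prod_map_map ht.aemeasurable hpath).1 hti, ht.map_eq,
    lintegral_prod _ hH.aemeasurable, ← Finset.coe_Icc, lintegral_uniformOn_finset]
  simp only [Nat.card_Icc, Nat.add_sub_cancel]
  congr 1
  refine Finset.sum_congr rfl fun t _ => ?_
  have h2 : AEMeasurable (fun o => P.run β γ γ η x₀ u₁ u₂ (fun t => ω t o) t) Pr :=
    (hrun t).comp_aemeasurable hpath
  rw [← hA.map_run hB hBc β γ η x₀ u₁ u₂ hω hi t, lintegral_map' hψ.aemeasurable h2]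
  exact lintegral_map' (hψ.comp (hrun t)).aemeasurable hpath

end Problem

/-! ### Estimates along the chain -/

lemma IsProx.measurable_prox {V : Type*} [NormedAddCommGroup V] [InnerProductSpace ℝ V]
    [MeasurableSpace V] [BorelSpace V] {θ ρ : ℝ} {φ : V → ℝ}
    (hθ : 0 < θ) (hρθ : ρ * θ < 1) (hφ : HasSupports ρ φ) {prox : V → V}
    (hp : ∀ x, IsProx θ φ x (prox x)) : Measurable prox := by
  have h1 : 0 < 1 - ρ * θ := by linarith
  refine (LipschitzWith.of_dist_le_mul (K := ⟨(1 - ρ * θ)⁻¹, by positivity⟩)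
    fun x y => ?_).continuous.measurable
  rw [dist_eq_norm, dist_eq_norm]
  change _ ≤ (1 - ρ * θ)⁻¹ * _
  rw [inv_mul_eq_div, le_div_iff₀ h1, mul_comm]
  exact (hp x).dist_le hθ hφ (hp y)

section Moments

variable {X : Type*} [MeasurableSpace X]

/-- First and second moments as Bochner integrals from a bound `K ≤ k ^ 2` on the second moment. -/
lemma integral_abs_le_of_lintegral_sq_le {μ : Measure X} [IsProbabilityMeasure μ] {f : X → ℝ}
    {K k : ℝ} (hf : Measurable f) (hK : 0 ≤ K) (hk : 0 ≤ k) (hKk : K ≤ k ^ 2)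
    (h : ∫⁻ z, ENNReal.ofReal (f z ^ 2) ∂μ ≤ ENNReal.ofReal K) :
    Integrable (fun z => |f z|) μ ∧ Integrable (fun z => f z ^ 2) μ ∧
      ∫ z, |f z| ∂μ ≤ k ∧ ∫ z, f z ^ 2 ∂μ ≤ K := by
  have h' : ∫⁻ z, ENNReal.ofReal (‖f z‖ ^ 2) ∂μ ≤ ENNReal.ofReal K := by
    simpa only [Real.norm_eq_abs, sq_abs] using h
  have hm := memLp_two_of_lintegral_sq_le hf.aestronglyMeasurable h'
  have h1 := integral_sq_le_of_lintegral_sq_le hK hf.aestronglyMeasurable h'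
  simp only [Real.norm_eq_abs] at h1
  have hma : MemLp (fun z => |f z|) 2 μ := hm.abs
  have h2 := sq_integral_le hma
  refine ⟨hma.integrable one_le_two, hm.integrable_sq, ?_, by simpa only [sq_abs] using h1⟩
  exact (le_abs_self _).trans (abs_le_of_sq_le_sq (h2.trans (h1.trans hKk)) hk)

/-- A contracting mean-square recursion with bounded forcing. -/
lemma lintegral_sq_le_of_recursion {μ : ℕ → Measure X} [∀ t, IsProbabilityMeasure (μ t)]
    {e D : X → ℝ} (he : Measurable e) (hD : Measurable D) {r k₁ k₂ q S e₀ : ℝ}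
    (hk₁ : 0 ≤ k₁) (hk₂ : 0 ≤ k₂) (hq : 0 ≤ q) (hS : 0 ≤ S)
    (h0 : ∫⁻ s, ENNReal.ofReal (e s ^ 2) ∂(μ 0) ≤ ENNReal.ofReal (e₀ ^ 2))
    (hDq : ∀ t, ∫⁻ s, ENNReal.ofReal (D s ^ 2) ∂(μ t) ≤ ENNReal.ofReal q)
    (hrec : ∀ t, ∫⁻ s, ENNReal.ofReal (e s ^ 2) ∂(μ (t + 1))
      ≤ ∫⁻ s, ENNReal.ofReal (r ^ 2 * e s ^ 2 + (k₁ + k₂ * D s ^ 2)) ∂(μ t))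
    (hr : r ^ 2 * S + (k₁ + k₂ * q) ≤ S) (t : ℕ) :
    ∫⁻ s, ENNReal.ofReal (e s ^ 2) ∂(μ t) ≤ ENNReal.ofReal ((r ^ t) ^ 2 * e₀ ^ 2 + S) := by
  induction t with
  | zero =>
    refine h0.trans (ENNReal.ofReal_le_ofReal ?_)
    simpa using hS
  | succ t ih =>
    obtain ⟨-, hei, -, heb⟩ := integral_abs_le_of_lintegral_sq_le he
      (K := (r ^ t) ^ 2 * e₀ ^ 2 + S) (by positivity)
      (Real.sqrt_nonneg ((r ^ t) ^ 2 * e₀ ^ 2 + S)) (Real.sq_sqrt (by positivity)).ge ih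
    obtain ⟨-, hDi, -, hDb⟩ := integral_abs_le_of_lintegral_sq_le hD hq (Real.sqrt_nonneg q)
      (Real.sq_sqrt hq).ge (hDq t)
    have i1 := hei.const_mul (r ^ 2)
    have i2 : Integrable (fun s => k₁ + k₂ * D s ^ 2) (μ t) :=
      (integrable_const _).fun_add (hDi.const_mul _)
    refine (hrec t).trans ?_
    rw [← ofReal_integral_eq_lintegral_ofReal (i1.fun_add i2)
      (Filter.Eventually.of_forall fun s => by positivity), integral_add i1 i2,
      integral_add (integrable_const _) (hDi.const_mul _), integral_const_mul, integral_const_mul]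
    refine ENNReal.ofReal_le_ofReal ?_
    simp only [integral_const, probReal_univ, one_smul]
    have h1 := mul_le_mul_of_nonneg_left heb (sq_nonneg r)
    have h2 := mul_le_mul_of_nonneg_left hDb hk₂
    have h3 : (r ^ (t + 1)) ^ 2 * e₀ ^ 2 = r ^ 2 * ((r ^ t) ^ 2 * e₀ ^ 2) := by ring
    rw [h3]
    linarith

/-- Telescoping a decrease in expectation. -/
lemma sum_lintegral_le_of_descent {μ : ℕ → Measure X} {V A : X → ℝ≥0∞} {v : ℝ≥0∞}
    {ρ : ℕ → ℝ≥0∞} (h0 : ∫⁻ s, V s ∂(μ 0) ≤ v)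
    (h : ∀ t, ∫⁻ s, V s ∂(μ (t + 1)) + ∫⁻ s, A s ∂(μ t) ≤ ∫⁻ s, V s ∂(μ t) + ρ t) (T : ℕ) :
    ∑ t ∈ Finset.range T, ∫⁻ s, A s ∂(μ t) ≤ v + ∑ t ∈ Finset.range T, ρ t := by
  have key : ∫⁻ s, V s ∂(μ T) + ∑ t ∈ Finset.range T, ∫⁻ s, A s ∂(μ t)
      ≤ v + ∑ t ∈ Finset.range T, ρ t := by
    induction T with
    | zero => simpa using h0
    | succ T ih =>
      rw [Finset.sum_range_succ, Finset.sum_range_succ]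
      calc _ = (∫⁻ s, V s ∂(μ (T + 1)) + ∫⁻ s, A s ∂(μ T))
            + ∑ t ∈ Finset.range T, ∫⁻ s, A s ∂(μ t) := by ring
        _ ≤ (∫⁻ s, V s ∂(μ T) + ρ T) + ∑ t ∈ Finset.range T, ∫⁻ s, A s ∂(μ t) :=
            add_le_add (h T) le_rfl
        _ = (∫⁻ s, V s ∂(μ T) + ∑ t ∈ Finset.range T, ∫⁻ s, A s ∂(μ t)) + ρ T := by ring
        _ ≤ _ := by
            rw [← add_assoc]; gcongr
  exact le_add_self.trans key

end Moments

/-- The contraction factor `1 - pγ/2` absorbs the noise of the variance-reduced estimators at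
the level `S`. -/
lemma msvr_stationary {p γ v b L2 q S : ℝ} (hp : 0 < p) (hp1 : p ≤ 1) (hγ : 0 < γ)
    (hγ1 : γ ≤ 1 / 2) (hS0 : 0 ≤ S)
    (hS : 4 * γ * v / b + 26 * L2 * q / (p ^ 2 * γ) ≤ S) :
    (1 - p * γ / 2) ^ 2 * S + (2 * p * γ ^ 2 * v / b + 13 / p * L2 * q) ≤ S := by
  have h1 : p * γ / 2 * (4 * γ * v / b + 26 * L2 * q / (p ^ 2 * γ))
      = 2 * p * γ ^ 2 * v / b + 13 / p * L2 * q := by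
    field_simp; ring
  have h2 : 0 < p * γ := by positivity
  have h3 := mul_le_mul_of_nonneg_left hS (by positivity : 0 ≤ p * γ / 2)
  have h4 : p * γ ≤ 1 := by nlinarith
  have h5 : (1 - p * γ / 2) ^ 2 ≤ 1 - p * γ / 2 := by nlinarith
  nlinarith [mul_le_mul_of_nonneg_right h5 hS0]

lemma sum_geometric_le {a : ℝ} (ha : 0 < a) (ha1 : a ≤ 1) (T : ℕ) :
    ∑ t ∈ Finset.range T, (1 - a / 2) ^ t ≤ 2 / a := by
  rw [geom_sum_eq (by linarith)]
  have h1 : 0 ≤ (1 - a / 2) ^ T := pow_nonneg (by linarith) _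
  have h2 : ((1 - a / 2) ^ T - 1) / (1 - a / 2 - 1) = (1 - (1 - a / 2) ^ T) * (2 / a) := by
    have : (1 - a / 2 - 1) ≠ 0 := by linarith
    rw [div_eq_iff this]
    field_simp
    ring
  rw [h2]
  have : 0 < 2 / a := by positivity
  nlinarith

lemma sum_affine_powers (e C₁ C₂ r₁ r₂ f K : ℝ) (T : ℕ) :
    ∑ t ∈ Finset.range T, (e * (C₁ * r₁ ^ t + C₂ * r₂ ^ t + f) + K)
      = e * (C₁ * ∑ t ∈ Finset.range T, r₁ ^ t + C₂ * ∑ t ∈ Finset.range T, r₂ ^ t)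
        + T * (e * f + K) := by
  simp only [Finset.sum_add_distrib, ← Finset.mul_sum, Finset.sum_const, Finset.card_range,
    nsmul_eq_mul]
  ring

lemma average_affine {N : ℕ} (hN : (N : ℝ) ≠ 0) (p q k : ℝ) (a b : Fin N → ℝ) :
    (N : ℝ)⁻¹ * ∑ i, (p * a i + q * b i + k)
      = p * ((N : ℝ)⁻¹ * ∑ i, a i) + q * ((N : ℝ)⁻¹ * ∑ i, b i) + k := by
  simp only [Finset.sum_add_distrib, ← Finset.mul_sum, Finset.sum_const, Finset.card_univ,
    Fintype.card_fin, nsmul_eq_mul]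
  field_simp

namespace Problem

variable {d n m b₁ b₂ : ℕ} {Z W : Type*} [MeasurableSpace Z] [MeasurableSpace W]
  {P : Problem d n m Z W} {c : Moduli}

lemma Assumptions.measurable_bias (hA : P.Assumptions c) (β : ℝ) :
    Measurable (P.bias c β) := by
  have h1 : ∀ i, Measurable (P.gMean i) := fun i => (hA.gMean_lipschitz i).continuous.measurable
  have h2 : ∀ k, Measurable (P.hMean k) := fun k => (hA.h_lipschitz k).continuous.measurable
  unfold bias
  have h3 : ∀ i, Measurable fun s : AlgState d n m => |s.u₁ i - P.gMean i s.x| := fun i =>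
    measurable_abs.comp (((measurable_pi_apply i).comp AlgState.measurable_u₁).sub
      ((h1 i).comp AlgState.measurable_x))
  have h4 : ∀ k, Measurable fun s : AlgState d n m => |s.u₂ k - P.hMean k s.x| := fun k =>
    measurable_abs.comp (((measurable_pi_apply k).comp AlgState.measurable_u₂).sub
      ((h2 k).comp AlgState.measurable_x))
  refine ((Finset.measurable_sum _ fun i _ => ?_).const_mul _).add
    (((Finset.measurable_sum _ fun k _ => (h4 k).const_mul 2).const_mul _).const_mul β)
  exact ((h3 i).const_mul _).add (((h3 i).pow_const 2).const_mul _)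

/-- The bias expressed through the tracking errors at the previous iterate and the last move. -/
lemma Assumptions.bias_le (hA : P.Assumptions c) {β : ℝ} (hβ : 0 ≤ β) (s : AlgState d n m) :
    P.bias c β s ≤ (n : ℝ)⁻¹ * ∑ i, (2 * c.Lf * (|s.u₁ i - P.gMean i s.xPrev|
        + c.Lg * |‖s.x - s.xPrev‖|) + c.ρf * (2 * (s.u₁ i - P.gMean i s.xPrev) ^ 2
        + 2 * ((c.Lg : ℝ) ^ 2 * ‖s.x - s.xPrev‖ ^ 2)))
      + β * ((m : ℝ)⁻¹ * ∑ k, 2 * (|s.u₂ k - P.hMean k s.xPrev|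
        + c.Lh * |‖s.x - s.xPrev‖|)) := by
  have hρ := c.ρf_pos
  rw [abs_norm]
  have h1 : ∀ i, |s.u₁ i - P.gMean i s.x| ≤ |s.u₁ i - P.gMean i s.xPrev|
      + c.Lg * ‖s.x - s.xPrev‖ := fun i => by
    have h := (hA.gMean_lipschitz i).dist_le_mul s.x s.xPrev
    rw [Real.dist_eq, dist_eq_norm, abs_sub_comm] at h
    calc _ = |(s.u₁ i - P.gMean i s.xPrev) + (P.gMean i s.xPrev - P.gMean i s.x)| := by
          congr 1; ring
      _ ≤ _ := (abs_add_le _ _).trans (by gcongr)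
  have h2 : ∀ k, |s.u₂ k - P.hMean k s.x| ≤ |s.u₂ k - P.hMean k s.xPrev|
      + c.Lh * ‖s.x - s.xPrev‖ := fun k => by
    have h := (hA.h_lipschitz k).dist_le_mul s.x s.xPrev
    rw [Real.dist_eq, dist_eq_norm, abs_sub_comm] at h
    calc _ = |(s.u₂ k - P.hMean k s.xPrev) + (P.hMean k s.xPrev - P.hMean k s.x)| := by
          congr 1; ring
      _ ≤ _ := (abs_add_le _ _).trans (by gcongr)
  have h3 : ∀ i, |s.u₁ i - P.gMean i s.x| ^ 2 ≤ 2 * (s.u₁ i - P.gMean i s.xPrev) ^ 2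
      + 2 * ((c.Lg : ℝ) ^ 2 * ‖s.x - s.xPrev‖ ^ 2) := fun i => by
    refine (pow_le_pow_left₀ (abs_nonneg _) (h1 i) 2).trans ?_
    rw [← sq_abs (s.u₁ i - P.gMean i s.xPrev)]
    nlinarith [sq_nonneg (|s.u₁ i - P.gMean i s.xPrev| - c.Lg * ‖s.x - s.xPrev‖)]
  unfold bias
  gcongr
  · exact h1 _
  · exact h3 _
  · exact h2 _

/-- The parameters of a run: step sizes, batch sizes, second-moment bounds and their constraints. -/
structure RunBounds (P : Problem d n m Z W) (B Bc b₁ b₂ : ℕ) (β γ η θ Mg Mh : ℝ) : Prop where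
  β_nonneg : 0 ≤ β
  γ_pos : 0 < γ
  γ_le : γ ≤ 1 / 2
  η_nonneg : 0 ≤ η
  θ_pos : 0 < θ
  B_pos : 1 ≤ B
  B_le : B ≤ n
  Bc_pos : 1 ≤ Bc
  Bc_le : Bc ≤ m
  b₁_pos : 1 ≤ b₁
  b₂_pos : 1 ≤ b₂
  Mg_nonneg : 0 ≤ Mg
  Mh_nonneg : 0 ≤ Mh
  dg_moment : ∀ i x, ∫⁻ ζ, ENNReal.ofReal (‖P.dg i x ζ‖ ^ 2) ∂P.ν ≤ ENNReal.ofReal Mg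
  dh_moment : ∀ k x, ∫⁻ ξ, ENNReal.ofReal (‖P.dh k x ξ‖ ^ 2) ∂P.τ ≤ ENNReal.ofReal Mh

/-- The bound on the second moment of the search direction. -/
def directionBound (c : Moduli) (β Mg Mh : ℝ) : ℝ := 2 * (c.Lf : ℝ) ^ 2 * Mg + 2 * β ^ 2 * Mh

variable {B Bc : ℕ} {β γ η θ Mg Mh : ℝ}

lemma RunBounds.directionBound_nonneg (hR : P.RunBounds B Bc b₁ b₂ β γ η θ Mg Mh) :
    0 ≤ directionBound c β Mg Mh := by
  have := hR.Mg_nonneg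
  have := hR.Mh_nonneg
  unfold directionBound
  positivity

lemma Assumptions.lintegral_move_stateLaw_le (hA : P.Assumptions c)
    (hR : P.RunBounds B Bc b₁ b₂ β γ η θ Mg Mh) (x₀ : Vec d) (u₁ : Fin n → ℝ) (u₂ : Fin m → ℝ)
    (t : ℕ) :
    ∫⁻ s, ENNReal.ofReal (‖s.x - s.xPrev‖ ^ 2)
        ∂(P.stateLaw β γ η B Bc b₁ b₂ ⟨x₀, x₀, u₁, u₂⟩ t)
      ≤ ENNReal.ofReal (η ^ 2 * directionBound c β Mg Mh) := by
  have hm : Measurable fun s : AlgState d n m => ENNReal.ofReal (‖s.x - s.xPrev‖ ^ 2) := by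
    fun_prop
  cases t with
  | zero =>
    rw [stateLaw, lintegral_dirac' _ hm]
    simp
  | succ t =>
    have := hA.isProbabilityMeasure_stateLaw (b₁ := b₁) (b₂ := b₂) hR.B_le hR.Bc_le β γ η
      ⟨x₀, x₀, u₁, u₂⟩ t
    refine (hA.lintegral_stateLaw_succ_le hR.B_le hR.Bc_le t hm fun s =>
      hA.lintegral_move_le hR.B_pos hR.B_le hR.Bc_pos hR.Bc_le hR.b₁_pos hR.b₂_pos hR.Mg_nonneg
        hR.Mh_nonneg hR.dg_moment hR.dh_moment s).trans ?_
    simp [directionBound]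

lemma RunBounds.prob_pos₁ (hR : P.RunBounds B Bc b₁ b₂ β γ η θ Mg Mh) :
    0 < (B / n : ℝ) ∧ (B / n : ℝ) ≤ 1 := by
  have h1 : (1 : ℝ) ≤ B := by exact_mod_cast hR.B_pos
  have h2 : (B : ℝ) ≤ n := by exact_mod_cast hR.B_le
  exact ⟨div_pos (by linarith) (by linarith), (div_le_one (by linarith)).2 h2⟩

lemma RunBounds.prob_pos₂ (hR : P.RunBounds B Bc b₁ b₂ β γ η θ Mg Mh) :
    0 < (Bc / m : ℝ) ∧ (Bc / m : ℝ) ≤ 1 := by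
  have h1 : (1 : ℝ) ≤ Bc := by exact_mod_cast hR.Bc_pos
  have h2 : (Bc : ℝ) ≤ m := by exact_mod_cast hR.Bc_le
  exact ⟨div_pos (by linarith) (by linarith), (div_le_one (by linarith)).2 h2⟩

/-- Each estimator of an inner function has mean square error at most a transient with factor
`1 - pγ/2` per iteration (before squaring), where `p = B/n`, plus a stationary level `S`. -/
lemma Assumptions.lintegral_error₁_le (hA : P.Assumptions c)
    (hR : P.RunBounds B Bc b₁ b₂ β γ η θ Mg Mh) (x₀ : Vec d) (u₁ : Fin n → ℝ) (u₂ : Fin m → ℝ)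
    {S : ℝ} (hS0 : 0 ≤ S) (hS : 4 * γ * (c.σg : ℝ) ^ 2 / b₁
      + 26 * (c.Lg : ℝ) ^ 2 * (η ^ 2 * directionBound c β Mg Mh) / ((B / n : ℝ) ^ 2 * γ) ≤ S)
    (i : Fin n) (t : ℕ) :
    ∫⁻ s, ENNReal.ofReal ((s.u₁ i - P.gMean i s.xPrev) ^ 2)
        ∂(P.stateLaw β γ η B Bc b₁ b₂ ⟨x₀, x₀, u₁, u₂⟩ t)
      ≤ ENNReal.ofReal (((1 - (B / n : ℝ) * γ / 2) ^ t) ^ 2 * |u₁ i - P.gMean i x₀| ^ 2 + S) := by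
  have hpr := hA.isProbabilityMeasure_stateLaw (b₁ := b₁) (b₂ := b₂) hR.B_le hR.Bc_le β γ η
      ⟨x₀, x₀, u₁, u₂⟩
  obtain ⟨hp, hp1⟩ := hR.prob_pos₁
  have hγ := hR.γ_pos
  have he : Measurable fun s : AlgState d n m => s.u₁ i - P.gMean i s.xPrev :=
    ((measurable_pi_apply i).comp AlgState.measurable_u₁).sub
      ((hA.gMean_lipschitz i).continuous.measurable.comp AlgState.measurable_xPrev)
  refine lintegral_sq_le_of_recursion (D := fun s : AlgState d n m => ‖s.x - s.xPrev‖)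
    (k₁ := 2 * (B / n : ℝ) * γ ^ 2 * (c.σg : ℝ) ^ 2 / b₁)
    (k₂ := 13 / (B / n : ℝ) * (c.Lg : ℝ) ^ 2) he (by fun_prop) (by positivity) (by positivity)
    (mul_nonneg (sq_nonneg η) hR.directionBound_nonneg) hS0 ?_
    (hA.lintegral_move_stateLaw_le hR x₀ u₁ u₂) (fun t => ?_)
    (msvr_stationary hp hp1 hγ hR.γ_le hS0 hS) t
  · rw [stateLaw, lintegral_dirac' _ (he.pow_const 2).ennreal_ofReal, sq_abs]
  · refine hA.lintegral_stateLaw_succ_le hR.B_le hR.Bc_le t (he.pow_const 2).ennreal_ofReal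
      fun s => ?_
    rw [mul_assoc (13 / (B / n : ℝ))]
    exact hA.lintegral_u₁_le hR.B_pos hR.B_le hR.Bc_le hR.b₁_pos hγ hR.γ_le s i

lemma Assumptions.lintegral_error₂_le (hA : P.Assumptions c)
    (hR : P.RunBounds B Bc b₁ b₂ β γ η θ Mg Mh) (x₀ : Vec d) (u₁ : Fin n → ℝ) (u₂ : Fin m → ℝ)
    {S : ℝ} (hS0 : 0 ≤ S) (hS : 4 * γ * (c.σh : ℝ) ^ 2 / b₂
      + 26 * (c.Lh : ℝ) ^ 2 * (η ^ 2 * directionBound c β Mg Mh) / ((Bc / m : ℝ) ^ 2 * γ) ≤ S)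
    (k : Fin m) (t : ℕ) :
    ∫⁻ s, ENNReal.ofReal ((s.u₂ k - P.hMean k s.xPrev) ^ 2)
        ∂(P.stateLaw β γ η B Bc b₁ b₂ ⟨x₀, x₀, u₁, u₂⟩ t)
      ≤ ENNReal.ofReal (((1 - (Bc / m : ℝ) * γ / 2) ^ t) ^ 2 * |u₂ k - P.hMean k x₀| ^ 2 + S) := by
  have hpr := hA.isProbabilityMeasure_stateLaw (b₁ := b₁) (b₂ := b₂) hR.B_le hR.Bc_le β γ η
      ⟨x₀, x₀, u₁, u₂⟩
  obtain ⟨hp, hp1⟩ := hR.prob_pos₂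
  have hγ := hR.γ_pos
  have he : Measurable fun s : AlgState d n m => s.u₂ k - P.hMean k s.xPrev :=
    ((measurable_pi_apply k).comp AlgState.measurable_u₂).sub
      ((hA.h_lipschitz k).continuous.measurable.comp AlgState.measurable_xPrev)
  refine lintegral_sq_le_of_recursion (D := fun s : AlgState d n m => ‖s.x - s.xPrev‖)
    (k₁ := 2 * (Bc / m : ℝ) * γ ^ 2 * (c.σh : ℝ) ^ 2 / b₂)
    (k₂ := 13 / (Bc / m : ℝ) * (c.Lh : ℝ) ^ 2) he (by fun_prop) (by positivity) (by positivity)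
    (mul_nonneg (sq_nonneg η) hR.directionBound_nonneg) hS0 ?_
    (hA.lintegral_move_stateLaw_le hR x₀ u₁ u₂) (fun t => ?_)
    (msvr_stationary hp hp1 hγ hR.γ_le hS0 hS) t
  · rw [stateLaw, lintegral_dirac' _ (he.pow_const 2).ennreal_ofReal, sq_abs]
  · refine hA.lintegral_stateLaw_succ_le hR.B_le hR.Bc_le t (he.pow_const 2).ennreal_ofReal
      fun s => ?_
    rw [mul_assoc (13 / (Bc / m : ℝ))]
    exact hA.lintegral_u₂_le hR.B_le hR.Bc_pos hR.Bc_le hR.b₂_pos hγ hR.γ_le s k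

/-- The first absolute moment of the error decays with the factor `r` itself, not its square. -/
lemma Assumptions.integral_error₁_le (hA : P.Assumptions c)
    (hR : P.RunBounds B Bc b₁ b₂ β γ η θ Mg Mh) (x₀ : Vec d) (u₁ : Fin n → ℝ) (u₂ : Fin m → ℝ)
    {σ₁ : ℝ} (hσ₁ : 0 ≤ σ₁)
    (hS₁ : 4 * γ * (c.σg : ℝ) ^ 2 / b₁ + 26 * (c.Lg : ℝ) ^ 2 * (η ^ 2
      * directionBound c β Mg Mh) / ((B / n : ℝ) ^ 2 * γ) ≤ σ₁ ^ 2) (t : ℕ) {r : ℝ}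
    (hr : r = (1 - (B / n : ℝ) * γ / 2) ^ t) (hr0 : 0 ≤ r) {μ : Measure (AlgState d n m)}
    (hμ : μ = P.stateLaw β γ η B Bc b₁ b₂ ⟨x₀, x₀, u₁, u₂⟩ t) (i : Fin n) :
    Integrable (fun s : AlgState d n m => |s.u₁ i - P.gMean i s.xPrev|) μ ∧
      Integrable (fun s : AlgState d n m => (s.u₁ i - P.gMean i s.xPrev) ^ 2) μ ∧
      ∫ s, |s.u₁ i - P.gMean i s.xPrev| ∂μ ≤ r * |u₁ i - P.gMean i x₀| + σ₁ ∧
      ∫ s, (s.u₁ i - P.gMean i s.xPrev) ^ 2 ∂μ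
        ≤ r ^ 2 * |u₁ i - P.gMean i x₀| ^ 2 + σ₁ ^ 2 := by
  have hpr := hA.isProbabilityMeasure_stateLaw (b₁ := b₁) (b₂ := b₂) hR.B_le hR.Bc_le β γ η
      ⟨x₀, x₀, u₁, u₂⟩ t
  subst hμ hr
  refine integral_abs_le_of_lintegral_sq_le (((measurable_pi_apply i).comp
    AlgState.measurable_u₁).sub ((hA.gMean_lipschitz i).continuous.measurable.comp
    AlgState.measurable_xPrev)) (by positivity) (by positivity) ?_
    (hA.lintegral_error₁_le hR x₀ u₁ u₂ (sq_nonneg σ₁) hS₁ i t)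
  nlinarith [mul_nonneg (mul_nonneg hr0 (abs_nonneg (u₁ i - P.gMean i x₀))) hσ₁]

lemma Assumptions.integral_error₂_le (hA : P.Assumptions c)
    (hR : P.RunBounds B Bc b₁ b₂ β γ η θ Mg Mh) (x₀ : Vec d) (u₁ : Fin n → ℝ) (u₂ : Fin m → ℝ)
    {σ₂ : ℝ} (hσ₂ : 0 ≤ σ₂)
    (hS₂ : 4 * γ * (c.σh : ℝ) ^ 2 / b₂ + 26 * (c.Lh : ℝ) ^ 2 * (η ^ 2
      * directionBound c β Mg Mh) / ((Bc / m : ℝ) ^ 2 * γ) ≤ σ₂ ^ 2) (t : ℕ) {r : ℝ}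
    (hr : r = (1 - (Bc / m : ℝ) * γ / 2) ^ t) (hr0 : 0 ≤ r) {μ : Measure (AlgState d n m)}
    (hμ : μ = P.stateLaw β γ η B Bc b₁ b₂ ⟨x₀, x₀, u₁, u₂⟩ t) (k : Fin m) :
    Integrable (fun s : AlgState d n m => |s.u₂ k - P.hMean k s.xPrev|) μ ∧
      Integrable (fun s : AlgState d n m => (s.u₂ k - P.hMean k s.xPrev) ^ 2) μ ∧
      ∫ s, |s.u₂ k - P.hMean k s.xPrev| ∂μ ≤ r * |u₂ k - P.hMean k x₀| + σ₂ ∧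
      ∫ s, (s.u₂ k - P.hMean k s.xPrev) ^ 2 ∂μ
        ≤ r ^ 2 * |u₂ k - P.hMean k x₀| ^ 2 + σ₂ ^ 2 := by
  have hpr := hA.isProbabilityMeasure_stateLaw (b₁ := b₁) (b₂ := b₂) hR.B_le hR.Bc_le β γ η
      ⟨x₀, x₀, u₁, u₂⟩ t
  subst hμ hr
  refine integral_abs_le_of_lintegral_sq_le (((measurable_pi_apply k).comp
    AlgState.measurable_u₂).sub ((hA.h_lipschitz k).continuous.measurable.comp
    AlgState.measurable_xPrev)) (by positivity) (by positivity) ?_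
    (hA.lintegral_error₂_le hR x₀ u₁ u₂ (sq_nonneg σ₂) hS₂ k t)
  nlinarith [mul_nonneg (mul_nonneg hr0 (abs_nonneg (u₂ k - P.hMean k x₀))) hσ₂]

/-- The part of the expected bias that does not decay with time: `σ₁`, `σ₂` are the stationary
levels of the estimation errors and `δ` bounds the root mean square length of a move. -/
def biasFloor (c : Moduli) (β σ₁ σ₂ δ : ℝ) : ℝ :=
  2 * c.Lf * (σ₁ + c.Lg * δ) + c.ρf * (2 * σ₁ ^ 2 + 2 * ((c.Lg : ℝ) ^ 2 * δ ^ 2))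
    + 2 * β * (σ₂ + c.Lh * δ)

/-- Averaging the bounds on the individual errors over the indices. -/
lemma bias_arithmetic (c : Moduli) (hn : (n : ℝ) ≠ 0) (hm : (m : ℝ) ≠ 0)
    {r₁ r₂ σ₁ σ₂ δ δ₁ δ₂ : ℝ} (hβ : 0 ≤ β) (hr₁0 : 0 ≤ r₁) (hr₁1 : r₁ ≤ 1) (hr₂0 : 0 ≤ r₂)
    {v₁ A : Fin n → ℝ} {v₂ H : Fin m → ℝ} (h₁ : (n : ℝ)⁻¹ * ∑ i, |v₁ i| ^ 2 ≤ δ₁)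
    (h₂ : (m : ℝ)⁻¹ * ∑ k, |v₂ k| ≤ δ₂)
    (hA : ∀ i, A i ≤ 2 * c.Lf * ((r₁ * |v₁ i| + σ₁) + c.Lg * δ)
      + c.ρf * (2 * (r₁ ^ 2 * |v₁ i| ^ 2 + σ₁ ^ 2) + 2 * ((c.Lg : ℝ) ^ 2 * δ ^ 2)))
    (hH : ∀ k, H k ≤ 2 * ((r₂ * |v₂ k| + σ₂) + c.Lh * δ)) :
    (n : ℝ)⁻¹ * ∑ i, A i + β * ((m : ℝ)⁻¹ * ∑ k, H k)
      ≤ (2 * c.Lf * (1 + δ₁) + 2 * c.ρf * δ₁) * r₁ + 2 * β * δ₂ * r₂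
        + biasFloor c β σ₁ σ₂ δ := by
  have hρ := c.ρf_pos
  have s1 : (n : ℝ)⁻¹ * ∑ i, A i ≤ (2 * c.Lf * r₁) * ((n : ℝ)⁻¹ * ∑ i, |v₁ i|)
      + (2 * c.ρf * r₁ ^ 2) * ((n : ℝ)⁻¹ * ∑ i, |v₁ i| ^ 2)
      + (2 * c.Lf * (σ₁ + c.Lg * δ)
        + c.ρf * (2 * σ₁ ^ 2 + 2 * ((c.Lg : ℝ) ^ 2 * δ ^ 2))) := by
    rw [← average_affine hn]
    refine mul_le_mul_of_nonneg_left (Finset.sum_le_sum fun i _ => (hA i).trans_eq ?_)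
      (by positivity)
    ring
  have s2 : (m : ℝ)⁻¹ * ∑ k, H k ≤ (2 * r₂) * ((m : ℝ)⁻¹ * ∑ k, |v₂ k|)
      + 0 * ((m : ℝ)⁻¹ * ∑ k, |v₂ k|) + 2 * (σ₂ + c.Lh * δ) := by
    rw [← average_affine hm]
    refine mul_le_mul_of_nonneg_left (Finset.sum_le_sum fun k _ => (hH k).trans_eq ?_)
      (by positivity)
    ring
  have s3 := mul_le_mul_of_nonneg_left s2 hβ
  have ha : (n : ℝ)⁻¹ * ∑ i, |v₁ i| ≤ 1 + δ₁ := by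
    calc _ ≤ (n : ℝ)⁻¹ * ∑ i, (1 * |v₁ i| ^ 2 + 0 * |v₁ i| + 1) := by
          gcongr with i
          nlinarith [sq_nonneg (|v₁ i| - 1), abs_nonneg (v₁ i)]
      _ ≤ _ := by
          rw [average_affine hn]
          linarith
  set a₁ := (n : ℝ)⁻¹ * ∑ i, |v₁ i|
  set a₂ := (n : ℝ)⁻¹ * ∑ i, |v₁ i| ^ 2 with ha₂
  set a₃ := (m : ℝ)⁻¹ * ∑ k, |v₂ k|
  have ha20 : 0 ≤ a₂ := by positivity
  have t1 : (2 * c.Lf * r₁) * a₁ ≤ (2 * c.Lf * r₁) * (1 + δ₁) := by gcongr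
  have t2 : (2 * c.ρf * r₁ ^ 2) * a₂ ≤ (2 * c.ρf * r₁) * δ₁ := by
    have : r₁ ^ 2 ≤ r₁ := by nlinarith
    gcongr
  have t3 : β * ((2 * r₂) * a₃) ≤ β * ((2 * r₂) * δ₂) := by gcongr
  unfold biasFloor
  linarith

/-- The expected bias along the chain. Both transients carry the first power of the contraction
factors, so that their sum over time is of order `1 / (pγ)`. -/
lemma Assumptions.lintegral_bias_le (hA : P.Assumptions c)
    (hR : P.RunBounds B Bc b₁ b₂ β γ η θ Mg Mh) {x₀ : Vec d} {u₁ : Fin n → ℝ} {u₂ : Fin m → ℝ}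
    {σ₁ σ₂ δ δ₁ δ₂ : ℝ} (hσ₁ : 0 ≤ σ₁) (hσ₂ : 0 ≤ σ₂) (hδ : 0 ≤ δ)
    (hδ2 : η ^ 2 * directionBound c β Mg Mh ≤ δ ^ 2)
    (hS₁ : 4 * γ * (c.σg : ℝ) ^ 2 / b₁ + 26 * (c.Lg : ℝ) ^ 2 * (η ^ 2
      * directionBound c β Mg Mh) / ((B / n : ℝ) ^ 2 * γ) ≤ σ₁ ^ 2)
    (hS₂ : 4 * γ * (c.σh : ℝ) ^ 2 / b₂ + 26 * (c.Lh : ℝ) ^ 2 * (η ^ 2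
      * directionBound c β Mg Mh) / ((Bc / m : ℝ) ^ 2 * γ) ≤ σ₂ ^ 2)
    (h₁ : (n : ℝ)⁻¹ * ∑ i, |u₁ i - P.gMean i x₀| ^ 2 ≤ δ₁)
    (h₂ : (m : ℝ)⁻¹ * ∑ k, |u₂ k - P.hMean k x₀| ≤ δ₂) (t : ℕ) :
    ∫⁻ s, ENNReal.ofReal (P.bias c β s) ∂(P.stateLaw β γ η B Bc b₁ b₂ ⟨x₀, x₀, u₁, u₂⟩ t)
      ≤ ENNReal.ofReal ((2 * c.Lf * (1 + δ₁) + 2 * c.ρf * δ₁) * (1 - (B / n : ℝ) * γ / 2) ^ t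
        + 2 * β * δ₂ * (1 - (Bc / m : ℝ) * γ / 2) ^ t + biasFloor c β σ₁ σ₂ δ) := by
  have hpr := hA.isProbabilityMeasure_stateLaw (b₁ := b₁) (b₂ := b₂) hR.B_le hR.Bc_le β γ η
      ⟨x₀, x₀, u₁, u₂⟩ t
  set μ := P.stateLaw β γ η B Bc b₁ b₂ ⟨x₀, x₀, u₁, u₂⟩ t with hμ
  have hβ := hR.β_nonneg
  have hγ := hR.γ_pos
  have hγ2 := hR.γ_le
  have hρ := c.ρf_pos
  obtain ⟨hp, hp1⟩ := hR.prob_pos₁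
  obtain ⟨hpc, hpc1⟩ := hR.prob_pos₂
  have hn : (0 : ℝ) < n := by exact_mod_cast (hR.B_pos.trans hR.B_le)
  have hm : (0 : ℝ) < m := by exact_mod_cast (hR.Bc_pos.trans hR.Bc_le)
  set r₁ := (1 - (B / n : ℝ) * γ / 2) ^ t with hr₁
  set r₂ := (1 - (Bc / m : ℝ) * γ / 2) ^ t with hr₂
  have hr₁0 : 0 ≤ r₁ := pow_nonneg (by nlinarith) t
  have hr₁1 : r₁ ≤ 1 := pow_le_one₀ (by nlinarith) (by nlinarith)
  have hr₂0 : 0 ≤ r₂ := pow_nonneg (by nlinarith) t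
  have E1 := hA.integral_error₁_le hR x₀ u₁ u₂ hσ₁ hS₁ t hr₁ hr₁0 hμ
  have E2 := hA.integral_error₂_le hR x₀ u₁ u₂ hσ₂ hS₂ t hr₂ hr₂0 hμ
  obtain ⟨D1, D2, D3, D4⟩ := integral_abs_le_of_lintegral_sq_le (μ := μ)
    (f := fun s : AlgState d n m => ‖s.x - s.xPrev‖) (k := δ) (by fun_prop)
    (mul_nonneg (sq_nonneg η) (hR.directionBound_nonneg (c := c))) hδ hδ2
    (hA.lintegral_move_stateLaw_le hR x₀ u₁ u₂ t)
  have D5 := D4.trans hδ2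
  -- integrable majorants of the contributions of the single indices to the bias
  set A : Fin n → AlgState d n m → ℝ := fun i s => 2 * c.Lf * (|s.u₁ i - P.gMean i s.xPrev|
        + c.Lg * |‖s.x - s.xPrev‖|) + c.ρf * (2 * (s.u₁ i - P.gMean i s.xPrev) ^ 2
        + 2 * ((c.Lg : ℝ) ^ 2 * ‖s.x - s.xPrev‖ ^ 2)) with hAdef
  set H : Fin m → AlgState d n m → ℝ := fun k s => 2 * (|s.u₂ k - P.hMean k s.xPrev|
        + c.Lh * |‖s.x - s.xPrev‖|) with hHdef
  have IA1 : ∀ i, Integrable (fun s : AlgState d n m => |s.u₁ i - P.gMean i s.xPrev|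
      + c.Lg * |‖s.x - s.xPrev‖|) μ := fun i => (E1 i).1.fun_add (D1.const_mul _)
  have IA2 : ∀ i, Integrable (fun s : AlgState d n m => 2 * (s.u₁ i - P.gMean i s.xPrev) ^ 2
        + 2 * ((c.Lg : ℝ) ^ 2 * ‖s.x - s.xPrev‖ ^ 2)) μ := fun i =>
    ((E1 i).2.1.const_mul _).fun_add ((D2.const_mul _).const_mul _)
  have IA : ∀ i, Integrable (A i) μ := fun i =>
    ((IA1 i).const_mul _).fun_add ((IA2 i).const_mul _)
  have IH1 : ∀ k, Integrable (fun s : AlgState d n m => |s.u₂ k - P.hMean k s.xPrev|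
      + c.Lh * |‖s.x - s.xPrev‖|) μ := fun k => (E2 k).1.fun_add (D1.const_mul _)
  have IH : ∀ k, Integrable (H k) μ := fun k => (IH1 k).const_mul _
  have BA : ∀ i, ∫ s, A i s ∂μ ≤ 2 * c.Lf * ((r₁ * |u₁ i - P.gMean i x₀| + σ₁) + c.Lg * δ)
      + c.ρf * (2 * (r₁ ^ 2 * |u₁ i - P.gMean i x₀| ^ 2 + σ₁ ^ 2)
        + 2 * ((c.Lg : ℝ) ^ 2 * δ ^ 2)) := fun i => by
    simp only [hAdef]
    rw [integral_add ((IA1 i).const_mul _) ((IA2 i).const_mul _), integral_const_mul,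
      integral_const_mul, integral_add (E1 i).1 (D1.const_mul _),
      integral_add ((E1 i).2.1.const_mul _) ((D2.const_mul _).const_mul _), integral_const_mul,
      integral_const_mul, integral_const_mul, integral_const_mul]
    gcongr
    · exact (E1 i).2.2.1
    · exact (E1 i).2.2.2
  have BH : ∀ k, ∫ s, H k s ∂μ ≤ 2 * ((r₂ * |u₂ k - P.hMean k x₀| + σ₂) + c.Lh * δ) :=
    fun k => by
    simp only [hHdef]
    rw [integral_const_mul, integral_add (E2 k).1 (D1.const_mul _), integral_const_mul]
    gcongr
    exact (E2 k).2.2.1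
  have I1 : Integrable (fun s => (n : ℝ)⁻¹ * ∑ i, A i s) μ :=
    (integrable_finsetSum _ fun i _ => IA i).const_mul _
  have I2 : Integrable (fun s => β * ((m : ℝ)⁻¹ * ∑ k, H k s)) μ :=
    ((integrable_finsetSum _ fun k _ => IH k).const_mul _).const_mul _
  have hle : ∀ s, P.bias c β s ≤ (n : ℝ)⁻¹ * ∑ i, A i s + β * ((m : ℝ)⁻¹ * ∑ k, H k s) :=
    hA.bias_le hβ
  have h0 : ∀ s, 0 ≤ (n : ℝ)⁻¹ * ∑ i, A i s + β * ((m : ℝ)⁻¹ * ∑ k, H k s) := fun s =>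
    (P.bias_nonneg c hβ s).trans (hle s)
  calc _ ≤ ∫⁻ s, ENNReal.ofReal ((n : ℝ)⁻¹ * ∑ i, A i s + β * ((m : ℝ)⁻¹ * ∑ k, H k s)) ∂μ :=
        lintegral_mono fun s => ENNReal.ofReal_le_ofReal (hle s)
    _ = ENNReal.ofReal ((n : ℝ)⁻¹ * ∑ i, ∫ s, A i s ∂μ
          + β * ((m : ℝ)⁻¹ * ∑ k, ∫ s, H k s ∂μ)) := by
        rw [← ofReal_integral_eq_lintegral_ofReal (I1.fun_add I2) (Filter.Eventually.of_forall h0),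
          integral_add I1 I2, integral_const_mul, integral_const_mul, integral_const_mul,
          integral_finsetSum _ fun i _ => IA i, integral_finsetSum _ fun k _ => IH k]
    _ ≤ _ := by
        refine ENNReal.ofReal_le_ofReal ?_
        exact bias_arithmetic c hn.ne' hm.ne' hβ hr₁0 hr₁1 hr₂0 h₁ h₂ BA BH

/-- The summed squared gradients of the Moreau envelope along the chain: the initial gap, the
transients of the estimation errors, and the errors that persist in every iteration. -/
lemma Assumptions.sum_gradient_le (hA : P.Assumptions c)
    (hR : P.RunBounds B Bc b₁ b₂ β γ η θ Mg Mh) {x₀ : Vec d} {u₁ : Fin n → ℝ} {u₂ : Fin m → ℝ}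
    {ℓ σ₁ σ₂ δ δ₁ δ₂ : ℝ} (hθc : curvature c β < 1 / (4 * θ)) (hℓ : ∀ x, ℓ ≤ P.Φ β x)
    (hσ₁ : 0 ≤ σ₁) (hσ₂ : 0 ≤ σ₂) (hδ : 0 ≤ δ)
    (hδ2 : η ^ 2 * directionBound c β Mg Mh ≤ δ ^ 2)
    (hS₁ : 4 * γ * (c.σg : ℝ) ^ 2 / b₁ + 26 * (c.Lg : ℝ) ^ 2 * (η ^ 2
      * directionBound c β Mg Mh) / ((B / n : ℝ) ^ 2 * γ) ≤ σ₁ ^ 2)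
    (hS₂ : 4 * γ * (c.σh : ℝ) ^ 2 / b₂ + 26 * (c.Lh : ℝ) ^ 2 * (η ^ 2
      * directionBound c β Mg Mh) / ((Bc / m : ℝ) ^ 2 * γ) ≤ σ₂ ^ 2)
    (h₁ : (n : ℝ)⁻¹ * ∑ i, |u₁ i - P.gMean i x₀| ^ 2 ≤ δ₁)
    (h₂ : (m : ℝ)⁻¹ * ∑ k, |u₂ k - P.hMean k x₀| ≤ δ₂)
    {prox : Vec d → Vec d} (hprox : ∀ x, IsProx θ (P.Φ β) x (prox x)) (hpm : Measurable prox)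
    (hE : Measurable (moreauEnvelope θ (P.Φ β))) (T : ℕ) :
    ∑ t ∈ Finset.range T, ∫⁻ s, ENNReal.ofReal (η / 4 * ‖θ⁻¹ • (s.x - prox s.x)‖ ^ 2)
        ∂(P.stateLaw β γ η B Bc b₁ b₂ ⟨x₀, x₀, u₁, u₂⟩ t)
      ≤ ENNReal.ofReal ((P.Φ β x₀ - ℓ) + η / θ * ((2 * c.Lf * (1 + δ₁) + 2 * c.ρf * δ₁)
          * (2 / ((B / n : ℝ) * γ)) + 2 * β * δ₂ * (2 / ((Bc / m : ℝ) * γ)))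
        + T * (η / θ * biasFloor c β σ₁ σ₂ δ + η ^ 2 / (2 * θ) * directionBound c β Mg Mh)) := by
  have hpr := hA.isProbabilityMeasure_stateLaw (b₁ := b₁) (b₂ := b₂) hR.B_le hR.Bc_le β γ η
      ⟨x₀, x₀, u₁, u₂⟩
  have hβ := hR.β_nonneg
  have hγ := hR.γ_pos
  have hη := hR.η_nonneg
  have hθ := hR.θ_pos
  have hρ := c.ρf_pos
  obtain ⟨hp, hp1⟩ := hR.prob_pos₁
  obtain ⟨hpc, hpc1⟩ := hR.prob_pos₂
  have hγ2 := hR.γ_le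
  have hdb := hR.directionBound_nonneg (c := c)
  have hδ₁0 : 0 ≤ δ₁ := le_trans (by positivity) h₁
  have hδ₂0 : 0 ≤ δ₂ := le_trans (by positivity) h₂
  set r₁ := 1 - (B / n : ℝ) * γ / 2 with hr₁
  set r₂ := 1 - (Bc / m : ℝ) * γ / 2 with hr₂
  have hr₁0 : 0 ≤ r₁ := by nlinarith
  have hr₂0 : 0 ≤ r₂ := by nlinarith
  set C₁ := 2 * c.Lf * (1 + δ₁) + 2 * c.ρf * δ₁ with hC₁
  have hC₁0 : 0 ≤ C₁ := by positivity
  have hfl : 0 ≤ biasFloor c β σ₁ σ₂ δ := by unfold biasFloor; positivity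
  set Vf : AlgState d n m → ℝ≥0∞ := fun s =>
    ENNReal.ofReal (moreauEnvelope θ (P.Φ β) s.x - ℓ) with hVf
  set Af : AlgState d n m → ℝ≥0∞ := fun s =>
    ENNReal.ofReal (η / 4 * ‖θ⁻¹ • (s.x - prox s.x)‖ ^ 2) with hAf
  have hVm : Measurable Vf :=
    ((hE.comp AlgState.measurable_x).sub_const ℓ).ennreal_ofReal
  have hAm : Measurable Af := by
    have : Measurable fun s : AlgState d n m => prox s.x := hpm.comp AlgState.measurable_x
    fun_prop
  have hbm := hA.measurable_bias β
  set K := η ^ 2 / (2 * θ) * directionBound c β Mg Mh with hK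
  have hK0 : 0 ≤ K := by positivity
  refine (sum_lintegral_le_of_descent (V := Vf) (A := Af)
    (v := ENNReal.ofReal (P.Φ β x₀ - ℓ))
    (ρ := fun t => ENNReal.ofReal (η / θ * (C₁ * r₁ ^ t + 2 * β * δ₂ * r₂ ^ t
      + biasFloor c β σ₁ σ₂ δ) + K)) ?_ (fun t => ?_) T).trans ?_
  · rw [stateLaw, lintegral_dirac' _ hVm]
    refine ENNReal.ofReal_le_ofReal (sub_le_sub_right ?_ _)
    simpa using (hprox x₀).moreauEnvelope_le x₀
  · have step := hA.lintegral_stateLaw_succ_le hR.B_le hR.Bc_le (β := β) (γ := γ) (η := η)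
      (s₀ := ⟨x₀, x₀, u₁, u₂⟩) (b₁ := b₁) (b₂ := b₂) t hVm fun s => le_refl _
    have hsm : Measurable fun s => ∫⁻ ω, Vf (P.step β γ γ η s ω) ∂(P.drawLaw B Bc b₁ b₂) := by
      have := hA.isProbabilityMeasure_drawLaw (b₁ := b₁) (b₂ := b₂) hR.B_le hR.Bc_le
      exact (hVm.comp (hA.measurable_step β γ η)).lintegral_prod_right'
    refine (add_le_add_left step _).trans ?_
    rw [← lintegral_add_left hsm]
    refine (lintegral_mono fun s => hA.lintegral_envelope_le hβ hη hθ hθc.le hℓ hR.B_pos hR.B_le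
      hR.Bc_pos hR.Bc_le hR.b₁_pos hR.b₂_pos hR.Mg_nonneg hR.Mh_nonneg hR.dg_moment hR.dh_moment
      hprox s).trans ?_
    rw [lintegral_add_left hVm]
    gcongr
    have hb0 := fun s => P.bias_nonneg c hβ s
    have e1 : ∀ s, ENNReal.ofReal (η / θ * P.bias c β s + η ^ 2 / (2 * θ)
        * (2 * (c.Lf : ℝ) ^ 2 * Mg + 2 * β ^ 2 * Mh))
        = ENNReal.ofReal (η / θ) * ENNReal.ofReal (P.bias c β s) + ENNReal.ofReal K := fun s => by
      rw [← ENNReal.ofReal_mul (by positivity),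
        ← ENNReal.ofReal_add (mul_nonneg (by positivity) (hb0 s)) hK0]
      rfl
    simp only [e1]
    rw [lintegral_add_right _ measurable_const, lintegral_const_mul _ hbm.ennreal_ofReal,
      ENNReal.ofReal_add (by positivity) hK0, lintegral_const, measure_univ, mul_one]
    refine add_le_add ?_ le_rfl
    rw [ENNReal.ofReal_mul (p := η / θ) (by positivity)]
    refine mul_le_mul_right ?_ _
    exact hA.lintegral_bias_le hR hσ₁ hσ₂ hδ hδ2 hS₁ hS₂ h₁ h₂ t
  · rw [← ENNReal.ofReal_sum_of_nonneg fun t _ => by positivity,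
      ← ENNReal.ofReal_add (sub_nonneg.2 (hℓ x₀)) (Finset.sum_nonneg fun t _ => by positivity)]
    refine ENNReal.ofReal_le_ofReal ?_
    have g1 := sum_geometric_le (a := (B / n : ℝ) * γ) (by positivity)
      ((mul_le_of_le_one_left hγ.le hp1).trans (by linarith)) T
    have g2 := sum_geometric_le (a := (Bc / m : ℝ) * γ) (by positivity)
      ((mul_le_of_le_one_left hγ.le hpc1).trans (by linarith)) T
    rw [sum_affine_powers, ← add_assoc]
    gcongr

end Problem

/-! ### The choice of the parameters -/

/-- The scales `w = √min(b₁, b₂/β²)` and `p = min(B/n, Bc/(βm))` of the step sizes, and their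
relation to the maxima `M` and `Q` in the bound on the number of iterations. -/
lemma scale_facts {β p₁ p₂ b₁ b₂ : ℝ} (hβ : 0 < β) (hp₁ : 0 < p₁) (hp₁1 : p₁ ≤ 1) (hp₂ : 0 < p₂)
    (hp₂1 : p₂ ≤ 1) (hb₁ : 1 ≤ b₁) (hb₂ : 1 ≤ b₂) {w p M Q : ℝ}
    (hw : w = min √b₁ (√b₂ / β)) (hp : p = min p₁ (p₂ / β))
    (hM : M = max (max (β / √b₁) (β ^ 2 / √b₂)) (1 / b₁)) (hQ : Q = max (1 / p₁) (β / p₂)) :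
    0 < w ∧ w ^ 2 = min b₁ (b₂ / β ^ 2) ∧ 0 < p ∧ p ≤ 1 ∧ p * β ≤ 1 ∧ p ≤ p₁ ∧ p ≤ p₂ / β ∧
      β ≤ w * M ∧ 1 ≤ w ^ 2 * M ∧ 1 ≤ p * Q ∧ 1 ≤ p₁ * Q ∧ β ≤ p₂ * Q := by
  have hs₁ : 1 ≤ √b₁ := Real.one_le_sqrt.2 hb₁
  have hs₂ : 1 ≤ √b₂ := Real.one_le_sqrt.2 hb₂
  have hs₁0 : 0 < √b₁ := by linarith
  have hs₂0 : 0 < √b₂ := by linarith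
  have hq₁ : √b₁ ^ 2 = b₁ := Real.sq_sqrt (by linarith)
  have hq₂ : √b₂ ^ 2 = b₂ := Real.sq_sqrt (by linarith)
  have hw0 : 0 < w := by rw [hw]; positivity
  have hp0 : 0 < p := by rw [hp]; positivity
  have hM1 : β / √b₁ ≤ M := by rw [hM]; exact (le_max_left _ _).trans (le_max_left _ _)
  have hM2 : β ^ 2 / √b₂ ≤ M := by rw [hM]; exact (le_max_right _ _).trans (le_max_left _ _)
  have hM3 : 1 / b₁ ≤ M := by rw [hM]; exact le_max_right _ _
  have hQ1 : 1 / p₁ ≤ Q := by rw [hQ]; exact le_max_left _ _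
  have hQ2 : β / p₂ ≤ Q := by rw [hQ]; exact le_max_right _ _
  have hpp₁ : p ≤ p₁ := by rw [hp]; exact min_le_left _ _
  have hpp₂ : p ≤ p₂ / β := by rw [hp]; exact min_le_right _ _
  have hw2 : w ^ 2 = min b₁ (b₂ / β ^ 2) := by
    have e : (√b₂ / β) ^ 2 = b₂ / β ^ 2 := by rw [div_pow, hq₂]
    rw [hw, ← hq₁, ← e, hq₁]
    rcases le_total √b₁ (√b₂ / β) with h | h
    · rw [min_eq_left h, hq₁, min_eq_left]
      calc b₁ = √b₁ ^ 2 := hq₁.symm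
        _ ≤ _ := pow_le_pow_left₀ hs₁0.le h 2
    · rw [min_eq_right h, min_eq_right]
      calc _ ≤ √b₁ ^ 2 := pow_le_pow_left₀ (by positivity) h 2
        _ = b₁ := hq₁
  refine ⟨hw0, hw2, hp0, hpp₁.trans hp₁1, ?_, hpp₁, hpp₂, ?_, ?_, ?_, ?_, ?_⟩
  · rw [← le_div_iff₀ hβ]
    exact hpp₂.trans (by gcongr)
  · rcases min_choice √b₁ (√b₂ / β) with h | h
    · rw [hw, h]
      calc β = √b₁ * (β / √b₁) := by field_simp
        _ ≤ _ := by gcongr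
    · rw [hw, h]
      calc β = √b₂ / β * (β ^ 2 / √b₂) := by field_simp
        _ ≤ _ := by gcongr
  · rw [hw2]
    rcases min_choice b₁ (b₂ / β ^ 2) with h | h
    · rw [h]
      calc 1 = b₁ * (1 / b₁) := by field_simp
        _ ≤ _ := by gcongr
    · rw [h]
      calc (1 : ℝ) ≤ √b₂ := hs₂
        _ = √b₂ ^ 2 / β ^ 2 * (β ^ 2 / √b₂) := by field_simp
        _ = b₂ / β ^ 2 * (β ^ 2 / √b₂) := by rw [hq₂]
        _ ≤ _ := by gcongr
  · rcases min_choice p₁ (p₂ / β) with h | h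
    · rw [hp, h]
      calc 1 = p₁ * (1 / p₁) := by field_simp
        _ ≤ _ := by gcongr
    · rw [hp, h]
      calc 1 = p₂ / β * (β / p₂) := by field_simp
        _ ≤ _ := by gcongr
  · calc 1 = p₁ * (1 / p₁) := by field_simp
      _ ≤ _ := by gcongr
  · calc β = p₂ * (β / p₂) := by field_simp
      _ ≤ _ := by gcongr

section Parameters

variable {s k G β ε w p γ η M2 : ℝ}

/-- The length of a move. -/
lemma move_scale (hs : 0 < s) (hG : 0 ≤ G) (hβ : 0 < β) (hε : 0 < ε) (hw : 0 < w)
    (hp : 0 < p) (hwk : w * (ε ^ 2 / β) ≤ k) (hp1 : p ≤ 1) (hpβ : p * β ≤ 1)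
    (hη : η = s ^ 2 * (p * w * (ε ^ 4 / β ^ 3))) :
    η * G * β ≤ s ^ 2 * (G * k) * (ε ^ 2 / β) ∧ η * G * β ≤ s ^ 2 * (G * k) * (ε ^ 2 / β ^ 2) := by
  have hk : 0 ≤ k := le_trans (by positivity) hwk
  constructor
  · calc η * G * β = s ^ 2 * (G * (p * (w * (ε ^ 2 / β)))) * (ε ^ 2 / β) := by
          rw [hη]; field_simp
      _ ≤ s ^ 2 * (G * (1 * k)) * (ε ^ 2 / β) := by gcongr
      _ = _ := by ring
  · calc η * G * β = s ^ 2 * (G * ((p * β) * (w * (ε ^ 2 / β)))) * (ε ^ 2 / β ^ 2) := by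
          rw [hη]; field_simp
      _ ≤ s ^ 2 * (G * (1 * k)) * (ε ^ 2 / β ^ 2) := by gcongr
      _ = _ := by ring

/-- The stationary level of the estimation error. The scale `ν` is `1` for the inner functions and
`1 / β` for the constraint functions. -/
lemma error_scale (hs : 0 < s) (hβ : 0 < β) (hε : 0 < ε) (hw : 0 < w) (hp : 0 < p)
    {ν p₁ b v L K : ℝ} (hp₁ : 0 < p₁) (hb : 0 < b)
    (hpν : p ≤ p₁ * ν) (hwν : w ^ 2 ≤ b * ν ^ 2) (hv : 0 ≤ v)
    (hM2 : M2 ≤ G ^ 2 * β ^ 2) (hK : 4 * v + 26 * L ^ 2 * G ^ 2 ≤ K ^ 2)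
    (hγ : γ = s ^ 2 * (w ^ 2 * (ε ^ 4 / β ^ 2)))
    (hη : η = s ^ 2 * (p * w * (ε ^ 4 / β ^ 3))) :
    4 * γ * v / b + 26 * L ^ 2 * (η ^ 2 * M2) / (p₁ ^ 2 * γ) ≤ (s * K * ν * (ε ^ 2 / β)) ^ 2 := by
  have hγ0 : 0 < γ := by rw [hγ]; positivity
  have h1 : 4 * γ * v / b ≤ s ^ 2 * (4 * v) * ν ^ 2 * (ε ^ 4 / β ^ 2) := by
    rw [div_le_iff₀ hb]
    calc 4 * γ * v = s ^ 2 * (4 * v) * (w ^ 2) * (ε ^ 4 / β ^ 2) := by rw [hγ]; ring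
      _ ≤ s ^ 2 * (4 * v) * (b * ν ^ 2) * (ε ^ 4 / β ^ 2) := by gcongr
      _ = _ := by ring
  have h2 : 26 * L ^ 2 * (η ^ 2 * M2) / (p₁ ^ 2 * γ)
      ≤ s ^ 2 * (26 * L ^ 2 * G ^ 2) * ν ^ 2 * (ε ^ 4 / β ^ 2) := by
    rw [div_le_iff₀ (by positivity)]
    calc 26 * L ^ 2 * (η ^ 2 * M2) ≤ 26 * L ^ 2 * (η ^ 2 * (G ^ 2 * β ^ 2)) := by gcongr
      _ = 26 * L ^ 2 * G ^ 2 * s ^ 4 * w ^ 2 * p ^ 2 * (ε ^ 8 / β ^ 4) := by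
          rw [hη]; field_simp
      _ ≤ 26 * L ^ 2 * G ^ 2 * s ^ 4 * w ^ 2 * (p₁ * ν) ^ 2 * (ε ^ 8 / β ^ 4) := by gcongr
      _ = _ := by rw [hγ]; field_simp
  calc _ ≤ s ^ 2 * (4 * v) * ν ^ 2 * (ε ^ 4 / β ^ 2)
        + s ^ 2 * (26 * L ^ 2 * G ^ 2) * ν ^ 2 * (ε ^ 4 / β ^ 2) := add_le_add h1 h2
    _ = (4 * v + 26 * L ^ 2 * G ^ 2) * (s ^ 2 * ν ^ 2 * (ε ^ 4 / β ^ 2)) := by ring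
    _ ≤ K ^ 2 * (s ^ 2 * ν ^ 2 * (ε ^ 4 / β ^ 2)) := by gcongr
    _ = _ := by ring

/-- The non-decaying part of the bias is of order `s ε² / β`. -/
lemma biasFloor_le (c : Moduli) {β₀ ε₀ K₁ K₂ δ : ℝ} (hs : 0 < s) (hs1 : s ≤ 1) (hG : 0 ≤ G)
    (hk : 0 ≤ k) (hβ₀ : 0 < β₀) (hβ : β₀ ≤ β) (hε : 0 < ε) (hεε : ε ≤ ε₀)
    (hδ0 : 0 ≤ δ) (hδ1 : δ ≤ s ^ 2 * (G * k) * (ε ^ 2 / β))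
    (hδ2 : δ ≤ s ^ 2 * (G * k) * (ε ^ 2 / β ^ 2)) :
    Problem.biasFloor c β (s * K₁ * 1 * (ε ^ 2 / β)) (s * K₂ * (1 / β) * (ε ^ 2 / β)) δ
      ≤ s * (2 * c.Lf * (K₁ + c.Lg * (G * k))
        + 2 * c.ρf * (K₁ ^ 2 + (c.Lg : ℝ) ^ 2 * (G * k) ^ 2) * (ε₀ ^ 2 / β₀)
        + 2 * (K₂ + c.Lh * (G * k))) * (ε ^ 2 / β) := by
  have hρ := c.ρf_pos
  have hβ0 : 0 < β := hβ₀.trans_le hβ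
  have hss : s ^ 2 ≤ s := by nlinarith
  have hA : δ ≤ s * (G * k) * (ε ^ 2 / β) := hδ1.trans (by gcongr)
  have hB : δ ≤ s * (G * k) * (ε ^ 2 / β ^ 2) := hδ2.trans (by gcongr)
  set X := ε ^ 2 / β with hX
  have hX0 : 0 < X := by positivity
  have hXb : X ≤ ε₀ ^ 2 / β₀ := by rw [hX]; gcongr
  have h1 : 2 * c.Lf * (s * K₁ * 1 * X + c.Lg * δ)
      ≤ s * (2 * c.Lf * (K₁ + c.Lg * (G * k))) * X := by
    calc _ ≤ 2 * c.Lf * (s * K₁ * 1 * X + c.Lg * (s * (G * k) * X)) := by gcongr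
      _ = _ := by ring
  have h2 : c.ρf * (2 * (s * K₁ * 1 * X) ^ 2 + 2 * ((c.Lg : ℝ) ^ 2 * δ ^ 2))
      ≤ s * (2 * c.ρf * (K₁ ^ 2 + (c.Lg : ℝ) ^ 2 * (G * k) ^ 2) * (ε₀ ^ 2 / β₀)) * X := by
    calc _ ≤ c.ρf * (2 * (s * K₁ * 1 * X) ^ 2
          + 2 * ((c.Lg : ℝ) ^ 2 * (s * (G * k) * X) ^ 2)) := by gcongr
      _ = s ^ 2 * (2 * c.ρf * (K₁ ^ 2 + (c.Lg : ℝ) ^ 2 * (G * k) ^ 2) * X) * X := by ring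
      _ ≤ _ := by gcongr
  have h3 : 2 * β * (s * K₂ * (1 / β) * X + c.Lh * δ)
      ≤ s * (2 * (K₂ + c.Lh * (G * k))) * X := by
    calc _ ≤ 2 * β * (s * K₂ * (1 / β) * X + c.Lh * (s * (G * k) * (ε ^ 2 / β ^ 2))) := by gcongr
      _ = _ := by rw [hX]; field_simp
  unfold Problem.biasFloor
  linarith

/-- The second-order term of the descent inequality. -/
lemma second_order_le {Cθ θ : ℝ} (hs : 0 < s) (hs1 : s ≤ 1) (hβ : 0 < β) (hε : 0 < ε)
    (hw : 0 < w) (hp : 0 < p) (hCθ : 0 ≤ Cθ) (hθ : 0 < θ) (hθC : 1 / θ ≤ Cθ * β)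
    (hwk : w * (ε ^ 2 / β) ≤ k) (hpβ : p * β ≤ 1)
    (hη : η = s ^ 2 * (p * w * (ε ^ 4 / β ^ 3))) (hM2 : M2 ≤ G ^ 2 * β ^ 2) :
    η / (2 * θ) * M2 ≤ s * (Cθ * (G ^ 2 * k)) * ε ^ 2 := by
  have hη0 : 0 < η := by rw [hη]; positivity
  have hs2 : s ^ 2 / 2 ≤ s := by nlinarith
  have hk : (p * β) * (w * (ε ^ 2 / β)) ≤ 1 * k :=
    mul_le_mul hpβ hwk (by positivity) zero_le_one
  have hk0 : 0 ≤ (p * β) * (w * (ε ^ 2 / β)) := by positivity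
  generalize hq : (p * β) * (w * (ε ^ 2 / β)) = q at hk hk0
  have hq' : η * (G ^ 2 * β ^ 2) * (Cθ * β) / 2 = s ^ 2 / 2 * (Cθ * (G ^ 2 * q)) * ε ^ 2 := by
    rw [hη, ← hq]
    field_simp
  calc η / (2 * θ) * M2 ≤ η / (2 * θ) * (G ^ 2 * β ^ 2) := by gcongr
    _ = η * (G ^ 2 * β ^ 2) * (1 / θ) / 2 := by field_simp
    _ ≤ η * (G ^ 2 * β ^ 2) * (Cθ * β) / 2 := by gcongr
    _ = s ^ 2 / 2 * (Cθ * (G ^ 2 * q)) * ε ^ 2 := hq'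
    _ ≤ s * (Cθ * (G ^ 2 * (1 * k))) * ε ^ 2 := by gcongr
    _ = _ := by ring

/-- The contribution of a transient that is proportional to `1 / (q γ)`, where `q` is the
probability of an update and `μ` is `1` for the inner functions and `β` for the constraint
functions. -/
lemma transient_le {Cθ θ q Q A T C μ : ℝ} (hA : 0 < A) (hβ : 0 < β)
    (hCθ : 0 ≤ Cθ) (hθC : 1 / θ ≤ Cθ * β) (hγ : 0 < γ) (hq : 0 < q) (hC : 0 ≤ C) (hμ : 0 ≤ μ)
    (hγT : A * Q * β ≤ γ * T * ε ^ 2) (hqQ : μ ≤ q * Q) :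
    1 / θ * (μ * C * (2 / (q * γ))) ≤ 2 * (Cθ * C) * (T * ε ^ 2 / A) := by
  have h1 : μ * β * (2 / (q * γ)) ≤ 2 * (T * ε ^ 2 / A) := by
    rw [← mul_div_assoc, ← mul_div_assoc, div_le_div_iff₀ (by positivity) hA]
    have h2 := mul_le_mul_of_nonneg_left hγT hq.le
    have h3 : μ * (A * β) ≤ (q * Q) * (A * β) :=
      mul_le_mul_of_nonneg_right hqQ (by positivity)
    linarith
  calc _ ≤ Cθ * β * (μ * C * (2 / (q * γ))) :=
        mul_le_mul_of_nonneg_right hθC (by positivity)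
    _ = Cθ * C * (μ * β * (2 / (q * γ))) := by ring
    _ ≤ Cθ * C * (2 * (T * ε ^ 2 / A)) := mul_le_mul_of_nonneg_left h1 (by positivity)
    _ = _ := by ring

/-- The number of iterations makes the initial gap and the transients small. -/
lemma horizon_le {M Q cT T : ℝ} (hs : 0 < s) (hβ : 0 < β) (hε : 0 < ε) (hw : 0 < w) (hp : 0 < p)
    (hγ : γ = s ^ 2 * (w ^ 2 * (ε ^ 4 / β ^ 2)))
    (hη : η = s ^ 2 * (p * w * (ε ^ 4 / β ^ 3)))
    (hwM : β ≤ w * M) (hw2M : 1 ≤ w ^ 2 * M) (hpQ : 1 ≤ p * Q) (hcT : 0 < cT)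
    (hT : cT * (M * Q * (β ^ 3 / ε ^ 6)) ≤ T) :
    β * (s ^ 2 * cT) ≤ η * T * ε ^ 2 ∧ s ^ 2 * cT * Q * β ≤ γ * T * ε ^ 2 := by
  have hγ0 : 0 < γ := by rw [hγ]; positivity
  have hη0 : 0 < η := by rw [hη]; positivity
  have hQ0 : 0 < Q := pos_of_mul_pos_right (by linarith) hp.le
  constructor
  · calc β * (s ^ 2 * cT) ≤ w * M * (s ^ 2 * cT) := by gcongr
      _ ≤ w * M * (s ^ 2 * cT) * (p * Q) :=
          le_mul_of_one_le_right (mul_nonneg (hβ.le.trans hwM) (by positivity)) hpQ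
      _ = η * (cT * (M * Q * (β ^ 3 / ε ^ 6))) * ε ^ 2 := by rw [hη]; field_simp
      _ ≤ η * T * ε ^ 2 := by gcongr
  · calc s ^ 2 * cT * Q * β ≤ s ^ 2 * cT * Q * β * (w ^ 2 * M) :=
          le_mul_of_one_le_right (by positivity) hw2M
      _ = γ * (cT * (M * Q * (β ^ 3 / ε ^ 6))) * ε ^ 2 := by rw [hγ]; field_simp
      _ ≤ γ * T * ε ^ 2 := by gcongr

/-- The contribution of the stationary errors. -/
lemma stationary_le {Cθ K₃ fl θ : ℝ} (hs : 0 < s) (hs1 : s ≤ 1) (hβ : 0 < β) (hε : 0 < ε)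
    (hw : 0 < w) (hp : 0 < p) (hCθ : 0 ≤ Cθ) (hθ : 0 < θ) (hθC : 1 / θ ≤ Cθ * β)
    (hwk : w * (ε ^ 2 / β) ≤ k) (hpβ : p * β ≤ 1)
    (hη : η = s ^ 2 * (p * w * (ε ^ 4 / β ^ 3)))
    (hM2 : M2 ≤ G ^ 2 * β ^ 2) (hfl : fl ≤ s * K₃ * (ε ^ 2 / β)) (hK₃ : 0 ≤ K₃)
    (hsmall : s * (16 * (Cθ * (K₃ + G ^ 2 * k))) ≤ 1) :
    1 / θ * fl + η / (2 * θ) * M2 ≤ ε ^ 2 / 16 := by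
  have h1 : 1 / θ * fl ≤ s * (Cθ * K₃) * ε ^ 2 := by
    calc _ ≤ 1 / θ * (s * K₃ * (ε ^ 2 / β)) := by gcongr
      _ ≤ Cθ * β * (s * K₃ * (ε ^ 2 / β)) := by gcongr
      _ = _ := by field_simp
  have h2 := second_order_le hs hs1 hβ hε hw hp hCθ hθ hθC hwk hpβ hη hM2
  have h3 := mul_le_mul_of_nonneg_right hsmall (sq_nonneg ε)
  linarith

/-- With the chosen step sizes, all error terms together are at most `(η / 4) T ε²`. -/
lemma total_error_le {Δ Cθ C₁ δ₂ K₃ fl θ p₁ p₂ M Q cT : ℝ} {T : ℝ}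
    (hs : 0 < s) (hs1 : s ≤ 1) (hβ : 0 < β) (hε : 0 < ε)
    (hw : 0 < w) (hp : 0 < p) (hΔ : 0 ≤ Δ) (hCθ : 0 ≤ Cθ) (hC₁ : 0 ≤ C₁) (hδ₂ : 0 ≤ δ₂)
    (hθ : 0 < θ) (hθC : 1 / θ ≤ Cθ * β)
    (hp₁ : 0 < p₁) (hp₂ : 0 < p₂) (hwk : w * (ε ^ 2 / β) ≤ k) (hpβ : p * β ≤ 1)
    (hγ : γ = s ^ 2 * (w ^ 2 * (ε ^ 4 / β ^ 2)))
    (hη : η = s ^ 2 * (p * w * (ε ^ 4 / β ^ 3)))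
    (hM2 : M2 ≤ G ^ 2 * β ^ 2) (hfl : fl ≤ s * K₃ * (ε ^ 2 / β)) (hK₃ : 0 ≤ K₃)
    (hsmall : s * (16 * (Cθ * (K₃ + G ^ 2 * k))) ≤ 1)
    (hwM : β ≤ w * M) (hw2M : 1 ≤ w ^ 2 * M) (hpQ : 1 ≤ p * Q) (hp₁Q : 1 ≤ p₁ * Q)
    (hp₂Q : β ≤ p₂ * Q)
    (hcT : 16 * (Δ + 2 * (Cθ * C₁) + 4 * (Cθ * δ₂)) ≤ s ^ 2 * cT) (hcT0 : 0 < cT) (hT1 : 1 ≤ T)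
    (hT : cT * (M * Q * (β ^ 3 / ε ^ 6)) ≤ T) :
    Δ * β + η / θ * (C₁ * (2 / (p₁ * γ)) + 2 * β * δ₂ * (2 / (p₂ * γ)))
      + (T + 1) * (η / θ * fl + η ^ 2 / (2 * θ) * M2) ≤ η / 4 * (T * ε ^ 2) := by
  obtain ⟨hηT, hγT⟩ := horizon_le hs hβ hε hw hp hγ hη hwM hw2M hpQ hcT0 hT
  have e4 := stationary_le hs hs1 hβ hε hw hp hCθ hθ hθC hwk hpβ hη hM2 hfl hK₃ hsmall
  have hγ0 : 0 < γ := by rw [hγ]; positivity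
  have hη0 : 0 < η := by rw [hη]; positivity
  clear hγ hη hwM hw2M hpQ hT hfl hM2 hsmall
  have hA0 : 0 < s ^ 2 * cT := by positivity
  generalize s ^ 2 * cT = A at *
  have e1 : Δ * β ≤ η * (Δ * (T * ε ^ 2 / A)) := by
    calc Δ * β ≤ Δ * (η * T * ε ^ 2 / A) :=
          mul_le_mul_of_nonneg_left ((le_div_iff₀ hA0).2 hηT) hΔ
      _ = _ := by ring
  have e2 := transient_le hA0 hβ hCθ hθC hγ0 hp₁ hC₁ zero_le_one hγT hp₁Q
  have e3 := transient_le hA0 hβ hCθ hθC hγ0 hp₂ (C := 2 * δ₂) (by positivity) hβ.le hγT hp₂Q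
  have e5 : (T + 1) * (1 / θ * fl + η / (2 * θ) * M2) ≤ T * ε ^ 2 / 8 := by
    have h1 := mul_le_mul_of_nonneg_left e4 (by linarith : 0 ≤ T + 1)
    have h2 := mul_le_mul_of_nonneg_right hT1 (sq_nonneg ε)
    linarith
  have e6 : (Δ + 2 * (Cθ * C₁) + 4 * (Cθ * δ₂)) * (T * ε ^ 2 / A) ≤ T * ε ^ 2 / 16 := by
    rw [← mul_div_assoc, div_le_iff₀ hA0]
    have := mul_le_mul_of_nonneg_right hcT (by positivity : 0 ≤ T * ε ^ 2)
    linarith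
  have e7 : η * (1 / θ * (1 * C₁ * (2 / (p₁ * γ))) + 1 / θ * (β * (2 * δ₂) * (2 / (p₂ * γ)))
      + (T + 1) * (1 / θ * fl + η / (2 * θ) * M2) + Δ * (T * ε ^ 2 / A))
      ≤ η * (T * ε ^ 2 / 4) := by
    refine mul_le_mul_of_nonneg_left ?_ hη0.le
    have : 0 ≤ T * ε ^ 2 := by positivity
    linarith
  calc _ ≤ η * (Δ * (T * ε ^ 2 / A))
        + η / θ * (C₁ * (2 / (p₁ * γ)) + 2 * β * δ₂ * (2 / (p₂ * γ)))
        + (T + 1) * (η / θ * fl + η ^ 2 / (2 * θ) * M2) := by gcongr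
    _ = _ := by ring
    _ ≤ _ := e7
    _ = _ := by ring

end Parameters

/-! ### The rate of convergence -/

/-- From the average of `‖f‖²` to the average of `‖f‖`, through `‖f‖ ≤ ‖f‖² / (2ε) + ε / 2`. -/
lemma average_lintegral_enorm_le {X V : Type*} [MeasurableSpace X] [NormedAddCommGroup V]
    {μ : ℕ → Measure X} [∀ t, IsProbabilityMeasure (μ t)] {f : X → V} {r ε : ℝ} (hr : 0 < r)
    (hε : 0 < ε) {T : ℕ} (hT : 0 < T)
    (h : ∑ t ∈ Finset.Icc 1 T, ∫⁻ s, ENNReal.ofReal (r * ‖f s‖ ^ 2) ∂(μ t)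
      ≤ ENNReal.ofReal (r * (T * ε ^ 2))) :
    (T : ℝ≥0∞)⁻¹ * ∑ t ∈ Finset.Icc 1 T, ∫⁻ s, ‖f s‖ₑ ∂(μ t) ≤ ENNReal.ofReal ε := by
  have hT' : (T : ℝ≥0∞) ≠ 0 := by exact_mod_cast hT.ne'
  have h1 : ∀ s, ‖f s‖ₑ ≤ ENNReal.ofReal (1 / (2 * ε * r)) * ENNReal.ofReal (r * ‖f s‖ ^ 2)
      + ENNReal.ofReal (ε / 2) := fun s => by
    rw [← ENNReal.ofReal_mul (by positivity), ← ENNReal.ofReal_add (by positivity) (by positivity),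
      ← ofReal_norm]
    refine ENNReal.ofReal_le_ofReal ?_
    have e : 1 / (2 * ε * r) * (r * ‖f s‖ ^ 2) + ε / 2 = (‖f s‖ ^ 2 + ε ^ 2) / (2 * ε) := by
      field_simp
    rw [e, le_div_iff₀ (by positivity)]
    nlinarith [sq_nonneg (‖f s‖ - ε)]
  have h2 : ∀ t, ∫⁻ s, ‖f s‖ₑ ∂(μ t) ≤ ENNReal.ofReal (1 / (2 * ε * r))
      * ∫⁻ s, ENNReal.ofReal (r * ‖f s‖ ^ 2) ∂(μ t) + ENNReal.ofReal (ε / 2) := fun t => by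
    refine (lintegral_mono h1).trans ?_
    rw [lintegral_add_right _ measurable_const, lintegral_const_mul' _ _ ENNReal.ofReal_ne_top]
    simp
  rw [ENNReal.inv_mul_le_iff hT' (ENNReal.natCast_ne_top T)]
  calc _ ≤ ∑ t ∈ Finset.Icc 1 T, (ENNReal.ofReal (1 / (2 * ε * r))
        * ∫⁻ s, ENNReal.ofReal (r * ‖f s‖ ^ 2) ∂(μ t) + ENNReal.ofReal (ε / 2)) :=
        Finset.sum_le_sum fun t _ => h2 t
    _ = ENNReal.ofReal (1 / (2 * ε * r)) * (∑ t ∈ Finset.Icc 1 T,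
        ∫⁻ s, ENNReal.ofReal (r * ‖f s‖ ^ 2) ∂(μ t)) + T * ENNReal.ofReal (ε / 2) := by
        rw [Finset.sum_add_distrib, ← Finset.mul_sum]
        simp
    _ ≤ ENNReal.ofReal (1 / (2 * ε * r)) * ENNReal.ofReal (r * (T * ε ^ 2))
        + T * ENNReal.ofReal (ε / 2) := by gcongr
    _ = T * ENNReal.ofReal ε := by
        rw [← ENNReal.ofReal_natCast T, ← ENNReal.ofReal_mul (by positivity),
          ← ENNReal.ofReal_mul (by positivity), ← ENNReal.ofReal_mul (by positivity),
          ← ENNReal.ofReal_add (by positivity) (by positivity)]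
        congr 1
        field_simp
        norm_num

namespace Problem

variable {d n m b₁ b₂ : ℕ} {Z W : Type*} [MeasurableSpace Z] [MeasurableSpace W]
  {P : Problem d n m Z W} {c : Moduli}

/-- The constant of the non-decaying part of the bias, see `biasFloor_le`. -/
def biasConstant (c : Moduli) (K₁ K₂ G k q : ℝ) : ℝ :=
  2 * c.Lf * (K₁ + c.Lg * (G * k)) + 2 * c.ρf * (K₁ ^ 2 + (c.Lg : ℝ) ^ 2 * (G * k) ^ 2) * q
    + 2 * (K₂ + c.Lh * (G * k))

/-- The summed squared gradients of the Moreau envelope, for step sizes with a small enough common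
factor `s ^ 2`. -/
lemma Assumptions.sum_gradient_le_of_scales (hA : P.Assumptions c) {B Bc : ℕ}
    {β β₀ ε ε₀ γ η θ Mg Mh s k G w p Q M K₁ K₂ Cθ Δ δ₁ δ₂ cT : ℝ}
    (hR : P.RunBounds B Bc b₁ b₂ β γ η θ Mg Mh) {x₀ : Vec d} {u₁ : Fin n → ℝ} {u₂ : Fin m → ℝ}
    (hs : 0 < s) (hs1 : s ≤ 1) (hβ₀ : 0 < β₀) (hβ : β₀ ≤ β) (hε : 0 < ε) (hεε : ε ≤ ε₀)
    (hG : 0 ≤ G) (hGM : directionBound c β Mg Mh ≤ G ^ 2 * β ^ 2)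
    (hK₁0 : 0 ≤ K₁) (hK₂0 : 0 ≤ K₂)
    (hK₁ : 4 * (c.σg : ℝ) ^ 2 + 26 * (c.Lg : ℝ) ^ 2 * G ^ 2 ≤ K₁ ^ 2)
    (hK₂ : 4 * (c.σh : ℝ) ^ 2 + 26 * (c.Lh : ℝ) ^ 2 * G ^ 2 ≤ K₂ ^ 2)
    (hCθ : 0 ≤ Cθ) (hθC : 1 / θ ≤ Cθ * β) (hθc : curvature c β < 1 / (4 * θ))
    (hw : w = min √(b₁ : ℝ) (√(b₂ : ℝ) / β))
    (hp : p = min (B / n : ℝ) ((Bc / m : ℝ) / β))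
    (hM : M = max (max (β / √(b₁ : ℝ)) (β ^ 2 / √(b₂ : ℝ))) (1 / (b₁ : ℝ)))
    (hQ : Q = max (1 / (B / n : ℝ)) (β / (Bc / m : ℝ)))
    (hwk : w * (ε ^ 2 / β) ≤ k)
    (hγ : γ = s ^ 2 * (w ^ 2 * (ε ^ 4 / β ^ 2)))
    (hη : η = s ^ 2 * (p * w * (ε ^ 4 / β ^ 3)))
    (hsmall : s * (16 * (Cθ * (biasConstant c K₁ K₂ G k (ε₀ ^ 2 / β₀) + G ^ 2 * k))) ≤ 1)
    (hΔ : ∀ x, P.Φ β x₀ - P.Φ β x ≤ Δ * β)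
    (h₁ : (n : ℝ)⁻¹ * ∑ i, |u₁ i - P.gMean i x₀| ^ 2 ≤ δ₁)
    (h₂ : (m : ℝ)⁻¹ * ∑ k, |u₂ k - P.hMean k x₀| ≤ δ₂)
    {prox : Vec d → Vec d} (hprox : ∀ x, IsProx θ (P.Φ β) x (prox x)) (hpm : Measurable prox)
    (hE : Measurable (moreauEnvelope θ (P.Φ β))) {T : ℕ}
    (hcT : 16 * (Δ + 2 * (Cθ * (2 * c.Lf * (1 + δ₁) + 2 * c.ρf * δ₁)) + 4 * (Cθ * δ₂))
      ≤ s ^ 2 * cT) (hcT0 : 0 < cT) (hT1 : 1 ≤ T) (hT : cT * (M * Q * (β ^ 3 / ε ^ 6)) ≤ T) :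
    ∑ t ∈ Finset.range (T + 1), ∫⁻ s, ENNReal.ofReal (η / 4 * ‖θ⁻¹ • (s.x - prox s.x)‖ ^ 2)
        ∂(P.stateLaw β γ η B Bc b₁ b₂ ⟨x₀, x₀, u₁, u₂⟩ t)
      ≤ ENNReal.ofReal (η / 4 * (T * ε ^ 2)) := by
  obtain ⟨hp₁, hp₁1⟩ := hR.prob_pos₁
  obtain ⟨hp₂, hp₂1⟩ := hR.prob_pos₂
  have hβ0 : 0 < β := hβ₀.trans_le hβ
  have hρ := c.ρf_pos
  have hb₁ : (1 : ℝ) ≤ b₁ := by exact_mod_cast hR.b₁_pos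
  have hb₂ : (1 : ℝ) ≤ b₂ := by exact_mod_cast hR.b₂_pos
  have hδ₁0 : 0 ≤ δ₁ := le_trans (by positivity) h₁
  have hδ₂0 : 0 ≤ δ₂ := le_trans (by positivity) h₂
  have hΔ0 : 0 ≤ Δ := by
    have := hΔ x₀
    rw [sub_self] at this
    exact nonneg_of_mul_nonneg_left this hβ0
  obtain ⟨hw0, hw2, hp0, hp1, hpβ, hpp₁, hpp₂, hwM, hw2M, hpQ, hp₁Q, hp₂Q⟩ :=
    scale_facts hβ0 hp₁ hp₁1 hp₂ hp₂1 hb₁ hb₂ hw hp hM hQ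
  have hk : 0 ≤ k := le_trans (by positivity) hwk
  obtain ⟨hm1, hm2⟩ := move_scale hs hG hβ0 hε hw0 hp0 hwk hp1 hpβ hη
  have hη0 := hR.η_nonneg
  have hS₁ := error_scale (ν := 1) hs hβ0 hε hw0 hp0 hp₁ (by linarith : (0 : ℝ) < b₁)
    (by linarith) (by rw [hw2]; simp) (sq_nonneg (c.σg : ℝ)) hGM hK₁ hγ hη
  have hS₂ := error_scale (ν := 1 / β) hs hβ0 hε hw0 hp0 hp₂ (by linarith : (0 : ℝ) < b₂)
    (by rw [mul_one_div]; exact hpp₂)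
    (by rw [hw2, one_div, inv_pow, ← div_eq_mul_inv]; exact min_le_right _ _)
    (sq_nonneg (c.σh : ℝ)) hGM hK₂ hγ hη
  have hfl := biasFloor_le c (K₁ := K₁) (K₂ := K₂) hs hs1 hG hk hβ₀ hβ hε hεε
    (by positivity) hm1 hm2
  refine (hA.sum_gradient_le hR (ℓ := P.Φ β x₀ - Δ * β) hθc (fun x => by linarith [hΔ x])
    (by positivity) (by positivity) (by positivity : 0 ≤ η * G * β) ?_ hS₁ hS₂ h₁ h₂ hprox hpm hE
    (T + 1)).trans (ENNReal.ofReal_le_ofReal ?_)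
  · calc _ ≤ η ^ 2 * (G ^ 2 * β ^ 2) := by gcongr
      _ = _ := by ring
  · have hK₃ : 0 ≤ biasConstant c K₁ K₂ G k (ε₀ ^ 2 / β₀) := by
      unfold biasConstant; positivity
    have := total_error_le (K₃ := biasConstant c K₁ K₂ G k (ε₀ ^ 2 / β₀)) hs hs1 hβ0 hε hw0 hp0
      hΔ0 hCθ (by positivity : 0 ≤ 2 * c.Lf * (1 + δ₁) + 2 * c.ρf * δ₁) hδ₂0 hR.θ_pos hθC hp₁ hp₂
      hwk hpβ hγ hη hGM hfl hK₃ hsmall hwM hw2M hpQ hp₁Q hp₂Q hcT hcT0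
      (by exact_mod_cast hT1) hT
    rw [sub_sub_cancel]
    push_cast
    exact this

end Problem

/-- The proximal parameter is small enough for the curvature of `Φ`. -/
lemma curvature_lt (c : Moduli) {β θ : ℝ} (hβ : 0 < β)
    (hθ : θ = c.ρ0 / (4 * (c.ρ0 + (c.ρf * (c.Lg : ℝ) ^ 2 + c.Lf * c.ρg / 2)))
      / (c.ρ0 + c.ρ1 * β)) : Problem.curvature c β < 1 / (4 * θ) := by
  have h0 := c.ρ0_pos
  have h1 := c.ρ1_pos
  have h2 := c.ρf_pos
  have h3 := c.ρg_pos
  have hC : 0 ≤ c.ρf * (c.Lg : ℝ) ^ 2 + c.Lf * c.ρg / 2 := by positivity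
  unfold Problem.curvature
  generalize c.ρf * (c.Lg : ℝ) ^ 2 + c.Lf * c.ρg / 2 = C at *
  have e : 1 / (4 * θ) = (c.ρ0 + C) + c.ρ1 * β + c.ρ1 * β * (C / c.ρ0) := by
    rw [hθ]
    field_simp
    ring
  have h4 : 0 ≤ c.ρ1 * β * (C / c.ρ0) := by positivity
  have h5 : 0 < c.ρ1 * β := by positivity
  rw [e]
  linarith

/-- The second moment of the search direction grows at most like `β ^ 2`. -/
lemma directionBound_le (c : Moduli) {β β₀ Mg Mh G : ℝ} (hβ₀ : 0 < β₀) (hβ : β₀ ≤ β)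
    (hMg : 0 ≤ Mg) (hMh : 0 ≤ Mh)
    (hG : G = 2 * (c.Lf : ℝ) ^ 2 * Mg / β₀ ^ 2 + 2 * Mh + 1) :
    Problem.directionBound c β Mg Mh ≤ G ^ 2 * β ^ 2 := by
  have hβ0 : 0 < β := hβ₀.trans_le hβ
  have h0 : 0 ≤ 2 * (c.Lf : ℝ) ^ 2 * Mg / β₀ ^ 2 + 2 * Mh := by positivity
  have hGG : 2 * (c.Lf : ℝ) ^ 2 * Mg / β₀ ^ 2 + 2 * Mh ≤ G ^ 2 := by
    rw [hG]; nlinarith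
  calc Problem.directionBound c β Mg Mh
      = 2 * (c.Lf : ℝ) ^ 2 * Mg / β₀ ^ 2 * β₀ ^ 2 + 2 * Mh * β ^ 2 := by
        unfold Problem.directionBound; field_simp
    _ ≤ 2 * (c.Lf : ℝ) ^ 2 * Mg / β₀ ^ 2 * β ^ 2 + 2 * Mh * β ^ 2 := by gcongr
    _ = (2 * (c.Lf : ℝ) ^ 2 * Mg / β₀ ^ 2 + 2 * Mh) * β ^ 2 := by ring
    _ ≤ _ := by gcongr

/-- The reciprocal of the proximal parameter grows at most like `β`. -/
lemma one_div_theta_le {ρ0 ρ1 a β β₀ θ : ℝ} (h0 : 0 < ρ0) (ha : 0 < a) (hβ₀ : 0 < β₀) (hβ : β₀ ≤ β)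
    (hθ : θ = a / (ρ0 + ρ1 * β)) : 1 / θ ≤ (ρ0 / β₀ + ρ1) / a * β := by
  have h : ρ0 ≤ ρ0 / β₀ * β := by
    rw [div_mul_eq_mul_div, le_div_iff₀ hβ₀]; gcongr
  rw [hθ, one_div_div, div_mul_eq_mul_div]
  gcongr
  linarith

/-- The bound on `min(b₁, b₂/β²) ε⁴/β²` bounds the scale `w` and the averaging weight `γ`. -/
lemma averaging_weight_le {w ε β κ k s γ : ℝ} (hβ : 0 < β) (hε : 0 < ε)
    (hκ : w ^ 2 * (ε ^ 4 / β ^ 2) ≤ κ) (hκk : κ ≤ k) (hk1 : 1 ≤ k) (hs0 : 0 < s) (hs1 : s ≤ 1)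
    (hsk : s * k ≤ 1 / 2) (hγ : γ = s ^ 2 * (w ^ 2 * (ε ^ 4 / β ^ 2))) :
    w * (ε ^ 2 / β) ≤ k ∧ γ ≤ 1 / 2 := by
  have h := hκ.trans hκk
  constructor
  · refine le_of_sq_le_sq ?_ (by linarith)
    calc (w * (ε ^ 2 / β)) ^ 2 = w ^ 2 * (ε ^ 4 / β ^ 2) := by field_simp
      _ ≤ k := h
      _ ≤ k ^ 2 := by nlinarith
  · calc γ ≤ s ^ 2 * k := by rw [hγ]; gcongr
      _ = s * (s * k) := by ring
      _ ≤ 1 * (1 / 2) := by gcongr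
      _ = _ := by norm_num

/-- The rate of convergence for one problem, in terms of the constants that its parameters are
made of: `s ^ 2` is the common factor of the step sizes and `N / s ^ 2` that of the number of
iterations. -/
theorem Problem.Assumptions.convergence {c : Moduli} {d n m : ℕ} {Z W : Type*} [MeasurableSpace Z]
    [MeasurableSpace W] {P : Problem d n m Z W} (hA : P.Assumptions c)
    {β₀ ε₀ κ Δ δ₁ δ₂ a Mg Mh G k K₁ K₂ Cθ s N : ℝ} (hβ₀ : 0 < β₀)
    (ha : a = c.ρ0 / (4 * (c.ρ0 + (c.ρf * (c.Lg : ℝ) ^ 2 + c.Lf * c.ρg / 2)))) (ha0 : 0 < a)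
    (hMg0 : 0 ≤ Mg) (hMh0 : 0 ≤ Mh)
    (hdg : ∀ i x, ∫⁻ ζ, ENNReal.ofReal (‖P.dg i x ζ‖ ^ 2) ∂P.ν ≤ ENNReal.ofReal Mg)
    (hdh : ∀ k x, ∫⁻ ξ, ENNReal.ofReal (‖P.dh k x ξ‖ ^ 2) ∂P.τ ≤ ENNReal.ofReal Mh)
    (hG : G = 2 * (c.Lf : ℝ) ^ 2 * Mg / β₀ ^ 2 + 2 * Mh + 1) (hG0 : 0 ≤ G)
    (hk1 : 1 ≤ k) (hκk : κ ≤ k) (hK₁1 : 1 ≤ K₁) (hK₂1 : 1 ≤ K₂)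
    (hK₁s : 4 * (c.σg : ℝ) ^ 2 + 26 * (c.Lg : ℝ) ^ 2 * G ^ 2 ≤ K₁ ^ 2)
    (hK₂s : 4 * (c.σh : ℝ) ^ 2 + 26 * (c.Lh : ℝ) ^ 2 * G ^ 2 ≤ K₂ ^ 2)
    (hCθ : Cθ = (c.ρ0 / β₀ + c.ρ1) / a) (hCθ0 : 0 ≤ Cθ) (hs0 : 0 < s) (hsk : s * k ≤ 1 / 2)
    (hs1 : s ≤ 1)
    (hsmall : s * (16 * (Cθ * (Problem.biasConstant c K₁ K₂ G k (ε₀ ^ 2 / β₀) + G ^ 2 * k))) ≤ 1)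
    (hN : 16 * (|Δ| + 2 * (Cθ * (2 * c.Lf * (1 + |δ₁|) + 2 * c.ρf * |δ₁|)) + 4 * (Cθ * |δ₂|)) ≤ N)
    (hN0 : 0 < N) {β ε : ℝ} (hβ : β₀ ≤ β) (hε : 0 < ε) (hεε : ε ≤ ε₀)
    {B Bc b₁ b₂ : ℕ} (hB : 1 ≤ B) (hBn : B ≤ n) (hBc : 1 ≤ Bc) (hBcm : Bc ≤ m) (hb₁ : 1 ≤ b₁)
    (hb₂ : 1 ≤ b₂) (hκ : min (b₁ : ℝ) (b₂ / β ^ 2) * (ε ^ 4 / β ^ 2) ≤ κ)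
    {x₀ : Vec d} {u₁ : Fin n → ℝ} {u₂ : Fin m → ℝ} (hΔ : ∀ x, P.Φ β x₀ - P.Φ β x ≤ Δ * β)
    (hδ₁ : (n : ℝ)⁻¹ * ∑ i, |u₁ i - P.gMean i x₀| ^ 2 ≤ δ₁)
    (hδ₂ : (m : ℝ)⁻¹ * ∑ k, |u₂ k - P.hMean k x₀| ≤ δ₂)
    {θ γ η : ℝ} (hθ : θ = a / (c.ρ0 + c.ρ1 * β))
    (hγ : γ = s ^ 2 * (min (b₁ : ℝ) (b₂ / β ^ 2) * (ε ^ 4 / β ^ 2)))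
    (hη : η = s ^ 2 * (min ((B : ℝ) / n) (Bc / (β * m)) * min √(b₁ : ℝ) (√(b₂ : ℝ) / β)
      * (ε ^ 4 / β ^ 3))) :
    0 < γ ∧ γ < 1 ∧ Differentiable ℝ (moreauEnvelope θ (P.Φ β)) ∧ ∀ T : ℕ,
      N / s ^ 2 * (max (max (β / √(b₁ : ℝ)) (β ^ 2 / √(b₂ : ℝ))) (1 / (b₁ : ℝ))
          * max ((n : ℝ) / B) (β * m / Bc) * (β ^ 3 / ε ^ 6)) ≤ T →
      ∀ (Ω : Type*) [MeasurableSpace Ω] (Pr : Measure Ω) [IsProbabilityMeasure Pr]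
        (ω : ℕ → Ω → Draw n m b₁ b₂ Z W) (tHat : Ω → ℕ),
        (∀ t, HasLaw (ω t) (P.drawLaw B Bc b₁ b₂) Pr) →
        iIndepFun ω Pr →
        HasLaw tHat (uniformOn (Set.Icc 1 T)) Pr →
        IndepFun tHat (fun o t => ω t o) Pr →
        ∫⁻ o, ‖∇ (moreauEnvelope θ (P.Φ β))
            (P.run β γ γ η x₀ u₁ u₂ (fun t => ω t o) (tHat o)).x‖ₑ ∂Pr
          ≤ ENNReal.ofReal ε := by
  have hβ0 : 0 < β := hβ₀.trans_le hβ
  have h0 := c.ρ0_pos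
  have h1 := c.ρ1_pos
  have hn : 0 < n := hB.trans hBn
  have hm : 0 < m := hBc.trans hBcm
  have hp₁ : 0 < (B / n : ℝ) := by positivity
  have hp₂ : 0 < (Bc / m : ℝ) := by positivity
  have hp₁1 : (B / n : ℝ) ≤ 1 := by rw [div_le_one (by positivity)]; exact_mod_cast hBn
  have hp₂1 : (Bc / m : ℝ) ≤ 1 := by rw [div_le_one (by positivity)]; exact_mod_cast hBcm
  rw [mul_comm β (m : ℝ), ← div_div] at hη
  obtain ⟨hw0, hw2, hp0, -⟩ := scale_facts hβ0 hp₁ hp₁1 hp₂ hp₂1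
    (by exact_mod_cast hb₁ : (1 : ℝ) ≤ b₁) (by exact_mod_cast hb₂ : (1 : ℝ) ≤ b₂) rfl rfl rfl rfl
  rw [← hw2] at hγ hκ
  obtain ⟨w, hw⟩ : ∃ w, w = min √(b₁ : ℝ) (√(b₂ : ℝ) / β) := ⟨_, rfl⟩
  obtain ⟨p, hp⟩ : ∃ p, p = min (B / n : ℝ) ((Bc / m : ℝ) / β) := ⟨_, rfl⟩
  rw [← hw] at hw0 hγ hκ hη
  rw [← hp] at hp0 hη
  have hγ0 : 0 < γ := by rw [hγ]; positivity
  have hη0 : 0 < η := by rw [hη]; positivity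
  have hθ0 : 0 < θ := by rw [hθ]; positivity
  obtain ⟨hwk, hγ2⟩ := averaging_weight_le hβ0 hε hκ hκk hk1 hs0 hs1 hsk hγ
  have hθC : 1 / θ ≤ Cθ * β := hCθ ▸ one_div_theta_le h0 ha0 hβ₀ hβ hθ
  have hθc := curvature_lt c hβ0 (hθ.trans (by rw [ha]))
  have hρθ : 2 * Problem.curvature c β * θ < 1 := by
    rw [lt_div_iff₀ (by positivity)] at hθc
    linarith
  have hsup := hA.hasSupports hβ0.le hn hm
  have hlow : ∀ x, P.Φ β x₀ - Δ * β ≤ P.Φ β x := fun x => by linarith [hΔ x]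
  choose prox hprox using exists_isProx hθ0 (hA.continuous_Φ β) hlow
  have hgrad := IsProx.hasGradientAt hθ0 hρθ hsup hprox
  have hpm := IsProx.measurable_prox hθ0 hρθ hsup hprox
  have hdiff : Differentiable ℝ (moreauEnvelope θ (P.Φ β)) := fun x =>
    (hgrad x).differentiableAt
  refine ⟨hγ0, by linarith, hdiff, ?_⟩
  intro T hT Ω _ Pr _ ω tHat hω hi ht hti
  have hgx : ∀ x, ∇ (moreauEnvelope θ (P.Φ β)) x = θ⁻¹ • (x - prox x) := fun x =>
    (hgrad x).gradient
  simp only [hgx]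
  have hT1 : 1 ≤ T := by
    have : (0 : ℝ) < T := lt_of_lt_of_le (by positivity) hT
    exact_mod_cast this
  have hpr := hA.isProbabilityMeasure_stateLaw (b₁ := b₁) (b₂ := b₂) hBn hBcm β γ η
      ⟨x₀, x₀, u₁, u₂⟩
  have hψ : Measurable fun s : AlgState d n m => ‖θ⁻¹ • (s.x - prox s.x)‖ₑ := by
    have h4 : Measurable fun x : Vec d => θ⁻¹ • (x - prox x) :=
      (measurable_id.sub hpm).const_smul θ⁻¹
    exact h4.enorm.comp AlgState.measurable_x
  rw [hA.lintegral_run_uniform hBn hBcm β γ η x₀ u₁ u₂ hω hi ht hti hψ]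
  refine average_lintegral_enorm_le (r := η / 4) (by positivity) hε hT1 ?_
  -- the sum over `1, …, T` is bounded by the one over `0, …, T`
  refine (Finset.sum_le_sum_of_subset (t := Finset.range (T + 1)) fun t ht => ?_).trans
    (hA.sum_gradient_le_of_scales (s := s) (k := k) (G := G) (w := w) (p := p) (K₁ := K₁)
      (K₂ := K₂) (Cθ := Cθ) (Δ := |Δ|) (δ₁ := |δ₁|) (δ₂ := |δ₂|) (cT := N / s ^ 2) (ε₀ := ε₀)
      ⟨hβ0.le, hγ0, hγ2, hη0.le, hθ0, hB, hBn, hBc, hBcm, hb₁, hb₂, hMg0, hMh0, hdg, hdh⟩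
      hs0 hs1 hβ₀ hβ hε hεε hG0 (directionBound_le c hβ₀ hβ hMg0 hMh0 hG) (by linarith)
      (by linarith) hK₁s hK₂s hCθ0 hθC hθc hw hp rfl rfl hwk hγ hη hsmall
      (fun x => (hΔ x).trans (by gcongr; exact le_abs_self _)) (hδ₁.trans (le_abs_self _))
      (hδ₂.trans (le_abs_self _)) hprox hpm hdiff.continuous.measurable ?_ (by positivity) hT1 ?_)
  · rw [Finset.mem_Icc] at ht
    rw [Finset.mem_range]
    omega
  · rw [mul_div_cancel₀ _ (by positivity)]
    linarith
  · convert hT using 5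
    · field_simp
    · field_simp

end

theorem theorem3 (c : Moduli) :
    ∃ a : ℝ, 0 < a ∧ a < 1 ∧
    ∀ (D : ℕ) (β₀ ε₀ κ Δ δ₁ δ₂ : ℝ), 0 < β₀ →
    ∃ cγ cη cT : ℝ, 0 < cγ ∧ 0 < cη ∧ 0 < cT ∧
    ∀ (d n m : ℕ) (Z : Type*) [MeasurableSpace Z] (W : Type*) [MeasurableSpace W]
      (P : Problem d n m Z W), P.Assumptions c →
      ((d ≤ D ∧ P.SampleSubgradients) ∨ P.MomentBounds c) →
    ∀ (β ε : ℝ), β₀ ≤ β → 0 < ε → ε ≤ ε₀ →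
    ∀ (B Bc b₁ b₂ : ℕ), 1 ≤ B → B ≤ n → 1 ≤ Bc → Bc ≤ m → 1 ≤ b₁ → 1 ≤ b₂ →
      min (b₁ : ℝ) (b₂ / β ^ 2) * (ε ^ 4 / β ^ 2) ≤ κ →
    ∀ (x₀ : Vec d) (u₁ : Fin n → ℝ) (u₂ : Fin m → ℝ),
      (∀ x, P.Φ β x₀ - P.Φ β x ≤ Δ * β) →
      (n : ℝ)⁻¹ * ∑ i, |u₁ i - P.gMean i x₀| ^ 2 ≤ δ₁ →
      (m : ℝ)⁻¹ * ∑ k, |u₂ k - P.hMean k x₀| ≤ δ₂ →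
    ∀ (θ γ η : ℝ),
      θ = a / (c.ρ0 + c.ρ1 * β) →
      γ = cγ * (min (b₁ : ℝ) (b₂ / β ^ 2) * (ε ^ 4 / β ^ 2)) →
      η = cη * (min ((B : ℝ) / n) (Bc / (β * m)) * min √(b₁ : ℝ) (√(b₂ : ℝ) / β)
            * (ε ^ 4 / β ^ 3)) →
      0 < γ ∧ γ < 1 ∧
      Differentiable ℝ (moreauEnvelope θ (P.Φ β)) ∧
      ∀ T : ℕ,
        cT * (max (max (β / √(b₁ : ℝ)) (β ^ 2 / √(b₂ : ℝ))) (1 / (b₁ : ℝ))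
            * max ((n : ℝ) / B) (β * m / Bc) * (β ^ 3 / ε ^ 6)) ≤ T →
      ∀ (Ω : Type*) [MeasurableSpace Ω] (Pr : Measure Ω) [IsProbabilityMeasure Pr]
        (ω : ℕ → Ω → Draw n m b₁ b₂ Z W) (tHat : Ω → ℕ),
        (∀ t, HasLaw (ω t) (P.drawLaw B Bc b₁ b₂) Pr) →
        iIndepFun ω Pr →
        HasLaw tHat (uniformOn (Set.Icc 1 T)) Pr →
        IndepFun tHat (fun o t => ω t o) Pr →
        ∫⁻ o, ‖∇ (moreauEnvelope θ (P.Φ β))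
            (P.run β γ γ η x₀ u₁ u₂ (fun t => ω t o) (tHat o)).x‖ₑ ∂Pr
          ≤ ENNReal.ofReal ε := by
  have h0 := c.ρ0_pos
  have h1 := c.ρ1_pos
  have h2 := c.ρf_pos
  have h3 := c.ρg_pos
  -- `2 * (C + β ρ1 / 2)` is the weak convexity modulus of `Φ` obtained from the composite structure
  obtain ⟨C, hC⟩ : ∃ x : ℝ, x = c.ρf * (c.Lg : ℝ) ^ 2 + c.Lf * c.ρg / 2 := ⟨_, rfl⟩
  have hC0 : 0 ≤ C := by rw [hC]; positivity
  obtain ⟨a, ha⟩ : ∃ x : ℝ, x = c.ρ0 / (4 * (c.ρ0 + C)) := ⟨_, rfl⟩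
  have ha0 : 0 < a := by rw [ha]; positivity
  refine ⟨a, ha0, by rw [ha, div_lt_one (by positivity)]; linarith, ?_⟩
  rw [hC] at ha
  intro D β₀ ε₀ κ Δ δ₁ δ₂ hβ₀
  -- second moments of the stochastic subgradients, then of the search direction (`G ^ 2 β ^ 2`)
  obtain ⟨Mg, hMg⟩ : ∃ x : ℝ, x = (2 * D + 1) * (c.Lg : ℝ) ^ 2 := ⟨_, rfl⟩
  obtain ⟨Mh, hMh⟩ : ∃ x : ℝ, x = (2 * D + 1) * (c.Lh : ℝ) ^ 2 := ⟨_, rfl⟩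
  have hMg0 : 0 ≤ Mg := by rw [hMg]; positivity
  have hMh0 : 0 ≤ Mh := by rw [hMh]; positivity
  obtain ⟨G, hG⟩ : ∃ x : ℝ, x = 2 * (c.Lf : ℝ) ^ 2 * Mg / β₀ ^ 2 + 2 * Mh + 1 := ⟨_, rfl⟩
  have hG0 : 0 ≤ G := by rw [hG]; positivity
  obtain ⟨k, hk⟩ : ∃ x : ℝ, x = |κ| + 1 := ⟨_, rfl⟩
  have hk1 : 1 ≤ k := by rw [hk]; linarith [abs_nonneg κ]
  have hκk : κ ≤ k := by rw [hk]; linarith [le_abs_self κ]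
  -- `s K₁ ε² / β` and `s K₂ ε² / β²` are the stationary levels of the estimation errors
  obtain ⟨K₁, hK₁⟩ : ∃ x : ℝ,
    x = 4 * (c.σg : ℝ) ^ 2 + 26 * (c.Lg : ℝ) ^ 2 * G ^ 2 + 1 := ⟨_, rfl⟩
  obtain ⟨K₂, hK₂⟩ : ∃ x : ℝ,
    x = 4 * (c.σh : ℝ) ^ 2 + 26 * (c.Lh : ℝ) ^ 2 * G ^ 2 + 1 := ⟨_, rfl⟩
  have hK₁1 : 1 ≤ K₁ := by rw [hK₁, le_add_iff_nonneg_left]; positivity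
  have hK₂1 : 1 ≤ K₂ := by rw [hK₂, le_add_iff_nonneg_left]; positivity
  have hK₁s : 4 * (c.σg : ℝ) ^ 2 + 26 * (c.Lg : ℝ) ^ 2 * G ^ 2 ≤ K₁ ^ 2 := by nlinarith
  have hK₂s : 4 * (c.σh : ℝ) ^ 2 + 26 * (c.Lh : ℝ) ^ 2 * G ^ 2 ≤ K₂ ^ 2 := by nlinarith
  obtain ⟨Cθ, hCθ⟩ : ∃ x : ℝ, x = (c.ρ0 / β₀ + c.ρ1) / a := ⟨_, rfl⟩
  have hCθ0 : 0 ≤ Cθ := by rw [hCθ]; positivity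
  obtain ⟨K, hK⟩ : ∃ x : ℝ,
    x = 16 * (Cθ * (Problem.biasConstant c K₁ K₂ G k (ε₀ ^ 2 / β₀) + G ^ 2 * k)) := ⟨_, rfl⟩
  have hK0 : 0 ≤ K := by
    rw [hK]; unfold Problem.biasConstant; positivity
  -- `s k ≤ 1 / 2` keeps `γ` below `1 / 2`, and `s K ≤ 1` keeps the persistent errors below `ε²`
  obtain ⟨s, hs⟩ : ∃ x : ℝ, x = 1 / (2 * k + K) := ⟨_, rfl⟩
  have hs0 : 0 < s := by rw [hs]; positivity
  have hsK : s * (2 * k + K) = 1 := by rw [hs]; field_simp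
  have hsk : s * k ≤ 1 / 2 := by linarith [show 0 ≤ s * K by positivity]
  have hs1 : s ≤ 1 := by linarith [le_mul_of_one_le_right hs0.le hk1]
  have hsmall : s * K ≤ 1 := by linarith [show 0 ≤ s * k by positivity]
  -- the bounds on the initial data are real parameters of either sign, whence the absolute values
  obtain ⟨N, hN⟩ : ∃ x : ℝ, x = 16 * (|Δ| + 2 * (Cθ * (2 * c.Lf * (1 + |δ₁|) + 2 * c.ρf * |δ₁|))
    + 4 * (Cθ * |δ₂|)) + 1 := ⟨_, rfl⟩
  have hN0 : 0 < N := by rw [hN]; positivity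
  refine ⟨s ^ 2, s ^ 2, N / s ^ 2, by positivity, by positivity, by positivity, ?_⟩
  intro d n m Z _ W _ P hA hmom β ε hβ hε hεε B Bc b₁ b₂ hB hBn hBc hBcm hb₁ hb₂ hκ x₀ u₁ u₂ hΔ hδ₁
    hδ₂ θ γ η hθ hγ hη
  obtain ⟨hdg, hdh⟩ := hA.second_moments hmom
  exact hA.convergence hβ₀ ha ha0 hMg0 hMh0 (hMg ▸ hdg) (hMh ▸ hdh) hG hG0 hk1 hκk hK₁1 hK₂1 hK₁s
    hK₂s hCθ hCθ0 hs0 hsk hs1 (hK ▸ hsmall) (by linarith) hN0 hβ hε hεε hB hBn hBc hBcm hb₁ hb₂ hκ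
    hΔ hδ₁ hδ₂ hθ hγ hη
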